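/- Let $k\subset K$ be an extension of fields. A two-sided vector space is a $k$-central $K$-$K$-bimodule (equivalently, a $K\otimes_k K$-module) that is finite-dimensional over $K$ for the left action. Let $S_1,\dots,S_r$ be pairwise non-isomorphic simple two-sided vector spaces, let $m_i=\dim_K S_i$ be the left dimensions, let $l_1,\dots,l_r\ge 1$, and let $V$ be a two-sided vector space isomorphic to $\bigoplus_{i=1}^r S_i^{\oplus l_i}$. Let $V_i$ be the $S_i$-homogeneous component of $V$ and let $\phi_i:K\to\operatorname{End}({}_K V_i)$ be the right action of $K$ on $V_i$. For a commutative $K$-algebra $R$, let $F_i(R)$ be the set of $R$-submodules $M\subset R\otimes_K V_i$ that are direct summands, are locally free of constant rank $m_i$, and are invariant under $1\otimes\phi_i(x)$ for all $x\in K$. Let $H_i(R)$ be the set of those $M\in F_i(R)$ for which the image of $\bigwedge^{m_i}_R M$ in $\bigwedge^{m_i}_R(R\otimes_K V_i)\cong R\otimes_K\bigwedge^{m_i}V_i$ is contained in the $R$-submodule generated by the elements $1\otimes(v_1\wedge\dots\wedge v_{m_i})$, where $v_1,\dots,v_{m_i}$ is a basis of an $(\operatorname{im}\phi_i)$-invariant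 subspace of $V_i$. A homomorphism $R\to T$ of $K$-algebras sends $M$ to the image of $T\otimes_R M$ in $T\otimes_K V_i$. Put $$F_\phi([S_1]+\dots+[S_r],V)=\prod_{i=1}^r F_i,\qquad H_\phi([S_1]+\dots+[S_r],V)=\prod_{i=1}^r H_i .$$ Then these two functors from commutative $K$-algebras to sets are represented by schemes $\mathbb F_\phi([S_1]+\dots+[S_r],V)$ and $\mathbb H_\phi([S_1]+\dots+[S_r],V)$ over $\operatorname{Spec}K$. The scheme $\mathbb F_\phi([S_1]+\dots+[S_r],V)$ contains an open subscheme that is smooth over $K$, reduced, irreducible, of dimension $\sum_{i=1}^r(l_im_i-m_i)$, and that contains all $K$-rational points of $\mathbb F_\phi([S_1]+\dots+[S_r],V)$. If $K$ is infinite, then the same holds for $\mathbb H_\phi([S_1]+\dots+[S_r],V)$. -/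

import Mathlib

open CategoryTheory AlgebraicGeometry TensorProduct

universe u v w

noncomputable section

namespace TwoSided

/-! ## Pulling back families of subspaces -/

section Families

variable {K : Type u} [Field K] {V : Type u} [AddCommGroup V] [Module K V]

/-- The map `R ⊗ V → T ⊗ V` induced by a homomorphism `R → T` of `K`-algebras. -/
def scalarMap (V : Type u) [AddCommGroup V] [Module K V] {R T : Type u} [CommRing R] [Algebra K R]
    [CommRing T] [Algebra K T] (f : R →ₐ[K] T) : R ⊗[K] V →ₗ[K] T ⊗[K] V :=
  LinearMap.rTensor V f.toLinearMap

/-- The pullback of `M ⊆ R ⊗ V` along `R → T`: the `T`-submodule of `T ⊗ V` generated by the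
image of `M`, that is, the image of `T ⊗_R M → T ⊗_R (R ⊗ V) ≅ T ⊗ V`. -/
def familyPullback {R T : Type u} [CommRing R] [Algebra K R] [CommRing T] [Algebra K T]
    (f : R →ₐ[K] T) (M : Submodule R (R ⊗[K] V)) : Submodule T (T ⊗[K] V) :=
  Submodule.span T (scalarMap V f '' (M : Set (R ⊗[K] V)))

/-- `M ⊆ R ⊗ V` is a direct summand which is locally free of constant rank `m` (a direct summand
of a finitely generated free module is automatically finitely generated and projective). -/
structure IsSummandOfRank {R : Type u} [CommRing R] [Algebra K R] (m : ℕ)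
    (M : Submodule R (R ⊗[K] V)) : Prop where
  isComplemented : IsComplemented M
  rank_eq : ∀ p : PrimeSpectrum R, Module.rankAtStalk (R := R) M p = m

/-- `M ⊆ R ⊗ V` is invariant under `1 ⊗ a` for all `a ∈ A`. -/
def IsInvariant {R : Type u} [CommRing R] [Algebra K R] (A : Subring (Module.End K V))
    (M : Submodule R (R ⊗[K] V)) : Prop :=
  ∀ a ∈ A, ∀ x ∈ M, LinearMap.baseChange R a x ∈ M

/-- The elements `(1 ⊗ v₁) ∧ ⋯ ∧ (1 ⊗ vₘ)` of `⋀ᵐ (R ⊗ V)`, where `v₁, …, vₘ` is a basis of an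
`A`-invariant subspace of `V`. -/
def invariantWedges (R : Type u) [CommRing R] [Algebra K R] (A : Subring (Module.End K V))
    (m : ℕ) : Set (⋀[R]^m (R ⊗[K] V)) :=
  {ω | ∃ v : Fin m → V, LinearIndependent K v ∧
    (∀ a ∈ A, ∀ x ∈ Submodule.span K (Set.range v), a x ∈ Submodule.span K (Set.range v)) ∧
    ω = exteriorPower.ιMulti R m (fun j => (1 : R) ⊗ₜ[K] v j)}

/-- `M ⊆ R ⊗ V` is generated by `A`-invariants: the image of `⋀ᵐ M` in `⋀ᵐ (R ⊗ V)`, which is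
generated by the elements `w₁ ∧ ⋯ ∧ wₘ` with `w₁, …, wₘ ∈ M`, consists of `R`-linear combinations
of elements `v₁ ∧ ⋯ ∧ vₘ` with `v₁, …, vₘ` a basis of an `A`-invariant subspace of `V`. -/
def IsGeneratedByInvariants {R : Type u} [CommRing R] [Algebra K R]
    (A : Subring (Module.End K V)) (m : ℕ) (M : Submodule R (R ⊗[K] V)) : Prop :=
  ∀ w : Fin m → R ⊗[K] V, (∀ j, w j ∈ M) →
    exteriorPower.ιMulti R m w ∈ Submodule.span R (invariantWedges R A m)

section Lemmas

variable {R T T' : Type u} [CommRing R] [Algebra K R] [CommRing T] [Algebra K T]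
  [CommRing T'] [Algebra K T']

@[simp] theorem scalarMap_tmul (f : R →ₐ[K] T) (r : R) (x : V) :
    scalarMap V f (r ⊗ₜ x) = f r ⊗ₜ x := rfl

theorem scalarMap_smul (f : R →ₐ[K] T) (r : R) (x : R ⊗[K] V) :
    scalarMap V f (r • x) = f r • scalarMap V f x := by
  induction x with
  | zero => simp
  | tmul s y => simp [TensorProduct.smul_tmul']
  | add x y hx hy => simp [hx, hy]

theorem scalarMap_id (x : R ⊗[K] V) : scalarMap V (AlgHom.id K R) x = x := by
  induction x with
  | zero => simp
  | tmul s y => simp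
  | add x y hx hy => simp only [map_add, hx, hy]

theorem scalarMap_comp (g : T →ₐ[K] T') (f : R →ₐ[K] T) (x : R ⊗[K] V) :
    scalarMap V (g.comp f) x = scalarMap V g (scalarMap V f x) := by
  induction x with
  | zero => simp
  | tmul s y => simp
  | add x y hx hy => simp only [map_add, hx, hy]

theorem scalarMap_baseChange (f : R →ₐ[K] T) (a : Module.End K V) (x : R ⊗[K] V) :
    LinearMap.baseChange T a (scalarMap V f x) = scalarMap V f (LinearMap.baseChange R a x) := by
  induction x with
  | zero => simp
  | tmul s y => simp
  | add x y hx hy => simp only [map_add, hx, hy]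

theorem scalarMap_mem_familyPullback (f : R →ₐ[K] T) {M : Submodule R (R ⊗[K] V)} {x : R ⊗[K] V}
    (hx : x ∈ M) : scalarMap V f x ∈ familyPullback f M :=
  Submodule.subset_span ⟨x, hx, rfl⟩

theorem pullback_id (M : Submodule R (R ⊗[K] V)) : familyPullback (AlgHom.id K R) M = M := by
  have h : scalarMap V (AlgHom.id K R) '' (M : Set (R ⊗[K] V)) = M := by
    ext x
    simp [scalarMap_id]
  rw [familyPullback, h, Submodule.span_eq]

theorem pullback_comp (g : T →ₐ[K] T') (f : R →ₐ[K] T) (M : Submodule R (R ⊗[K] V)) :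
    familyPullback (g.comp f) M = familyPullback g (familyPullback f M) := by
  apply le_antisymm
  · refine Submodule.span_le.2 ?_
    rintro _ ⟨x, hx, rfl⟩
    rw [scalarMap_comp]
    exact scalarMap_mem_familyPullback g (scalarMap_mem_familyPullback f hx)
  · refine Submodule.span_le.2 ?_
    rintro _ ⟨y, hy, rfl⟩
    change scalarMap V g y ∈ familyPullback (g.comp f) M
    refine Submodule.span_induction ?_ ?_ ?_ ?_ hy
    · rintro _ ⟨x, hx, rfl⟩
      rw [← scalarMap_comp]
      exact scalarMap_mem_familyPullback _ hx
    · simp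
    · intro x y _ _ hx hy
      rw [map_add]
      exact add_mem hx hy
    · intro t x _ hx
      rw [scalarMap_smul]
      exact Submodule.smul_mem _ _ hx

theorem IsInvariant.pullback {A : Subring (Module.End K V)} {M : Submodule R (R ⊗[K] V)}
    (h : IsInvariant A M) (f : R →ₐ[K] T) : IsInvariant A (familyPullback f M) := by
  intro a ha y hy
  refine Submodule.span_induction ?_ ?_ ?_ ?_ hy
  · rintro _ ⟨x, hx, rfl⟩
    rw [scalarMap_baseChange]
    exact scalarMap_mem_familyPullback _ (h a ha x hx)
  · simp
  · intro x y _ _ hx hy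
    rw [map_add]
    exact add_mem hx hy
  · intro t x _ hx
    rw [map_smul]
    exact Submodule.smul_mem _ _ hx

theorem IsSummandOfRank.pullback [FiniteDimensional K V] {m : ℕ} {M : Submodule R (R ⊗[K] V)}
    (h : IsSummandOfRank m M) (f : R →ₐ[K] T) : IsSummandOfRank m (familyPullback f M) := by
  let : Algebra R T := f.toRingHom.toAlgebra
  have : IsScalarTower K R T := IsScalarTower.of_algebraMap_eq' f.comp_algebraMap.symm
  obtain ⟨N, hN⟩ := h.isComplemented
  let q : R ⊗[K] V →ₗ[R] M := M.projectionOnto N hN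
  have hq : q ∘ₗ M.subtype = LinearMap.id := by
    ext x
    exact congrArg Subtype.val (Submodule.projectionOnto_apply_left hN x)
  have : Module.Projective R M := Module.Projective.of_split M.subtype q hq
  have : Module.Finite R M := Module.Finite.of_surjective q
    (fun x => ⟨x, by simpa using LinearMap.congr_fun hq x⟩)
  let e : T ⊗[R] (R ⊗[K] V) ≃ₗ[T] T ⊗[K] V :=
    TensorProduct.AlgebraTensorModule.cancelBaseChange K R T T V
  let i : T ⊗[R] M →ₗ[T] T ⊗[K] V := e.toLinearMap ∘ₗ M.subtype.baseChange T
  let p : T ⊗[K] V →ₗ[T] T ⊗[R] M := q.baseChange T ∘ₗ e.symm.toLinearMap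
  have hpi : p ∘ₗ i = LinearMap.id := by
    have : p ∘ₗ i = (q ∘ₗ M.subtype).baseChange T := by
      ext x
      simp [p, i]
    rw [this, hq, LinearMap.baseChange_id]
  have he : ∀ x : R ⊗[K] V, e (1 ⊗ₜ x) = scalarMap V f x := by
    intro x
    induction x with
    | zero => simp
    | tmul s y =>
      simp only [e, TensorProduct.AlgebraTensorModule.cancelBaseChange_tmul, scalarMap_tmul]
      rw [Algebra.smul_def, mul_one]
      rfl
    | add x y hx hy => simp only [TensorProduct.tmul_add, map_add, hx, hy]
  have hr : LinearMap.range i = familyPullback f M := by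
    apply le_antisymm
    · rintro _ ⟨x, rfl⟩
      induction x with
      | zero => simp
      | tmul t x =>
        have : i (t ⊗ₜ x) = t • scalarMap V f (x : R ⊗[K] V) := by
          rw [← he, ← map_smul]
          simp [i, TensorProduct.smul_tmul']
        rw [this]
        exact Submodule.smul_mem _ _ (scalarMap_mem_familyPullback f x.2)
      | add x y hx hy =>
        rw [map_add]
        exact add_mem hx hy
    · refine Submodule.span_le.2 ?_
      rintro _ ⟨x, hx, rfl⟩
      exact ⟨1 ⊗ₜ ⟨x, hx⟩, by simp [i, he]⟩
  have hinj : Function.Injective i := fun x y hxy => by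
    simpa using (LinearMap.congr_fun hpi x).symm.trans
      ((congrArg p hxy).trans (LinearMap.congr_fun hpi y))
  let E : T ⊗[R] M ≃ₗ[T] familyPullback f M :=
    (LinearEquiv.ofInjective i hinj).trans (LinearEquiv.ofEq _ _ hr)
  refine ⟨⟨LinearMap.ker p, ?_⟩, fun P => ?_⟩
  · have hpi' : ∀ x, p (i x) = x := LinearMap.congr_fun hpi
    rw [← hr]
    refine IsCompl.of_eq (eq_bot_iff.2 ?_) (eq_top_iff.2 ?_)
    · rintro _ ⟨⟨x, rfl⟩, hx⟩
      have hx' : x = 0 := (hpi' x).symm.trans hx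
      simp [hx']
    · intro x _
      refine Submodule.mem_sup.2 ⟨i (p x), ⟨p x, rfl⟩, x - i (p x), ?_, by simp⟩
      rw [LinearMap.mem_ker, map_sub, hpi', sub_self]
  · exact (congrFun (Module.rankAtStalk_eq_of_equiv E) P).symm.trans
      ((Module.rankAtStalk_baseChange P).trans (h.rank_eq _))

theorem mem_of_forall_mem_span {W E : Type u} [AddCommGroup W] [Module T W] [AddCommGroup E]
    [Module T E] {m : ℕ} (g : W [⋀^Fin m]→ₗ[T] E) (s : Set W) (N : Submodule T E)
    (h : ∀ w : Fin m → W, (∀ j, w j ∈ s) → g w ∈ N) (w : Fin m → W)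
    (hw : ∀ j, w j ∈ Submodule.span T s) : g w ∈ N := by
  have key : ∀ (t : Finset (Fin m)) (w : Fin m → W), (∀ j ∈ t, w j ∈ Submodule.span T s) →
      (∀ j ∉ t, w j ∈ s) → g w ∈ N := by
    intro t
    induction t using Finset.induction_on with
    | empty => exact fun w _ h2 => h w fun j => h2 j (by simp)
    | insert a t ha ih =>
      intro w h1 h2
      have hz : ∀ z ∈ Submodule.span T s, g (Function.update w a z) ∈ N := by
        intro z hz
        induction hz using Submodule.span_induction with
        | mem x hx =>
          refine ih _ (fun j hj => ?_) (fun j hj => ?_)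
          · have hja : j ≠ a := fun e => ha (e ▸ hj)
            rw [Function.update_of_ne hja]
            exact h1 j (Finset.mem_insert_of_mem hj)
          · by_cases hja : j = a
            · subst hja
              simpa using hx
            · rw [Function.update_of_ne hja]
              exact h2 j (by simp [hja, hj])
        | zero => rw [g.map_update_zero]; exact N.zero_mem
        | add x y _ _ hx hy => rw [g.map_update_add]; exact N.add_mem hx hy
        | smul c x _ hx => rw [g.map_update_smul]; exact N.smul_mem c hx
      simpa using hz (w a) (h1 a (Finset.mem_insert_self a t))
  exact key Finset.univ w (fun j _ => hw j) (fun j hj => absurd (Finset.mem_univ j) hj)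

theorem IsGeneratedByInvariants.pullback {A : Subring (Module.End K V)} {m : ℕ}
    {M : Submodule R (R ⊗[K] V)} (h : IsGeneratedByInvariants A m M) (f : R →ₐ[K] T) :
    IsGeneratedByInvariants A m (familyPullback f M) := by
  let c : Module R (⋀[T]^m (T ⊗[K] V)) := Module.compHom _ f.toRingHom
  have hc : ∀ (r : R) (x : ⋀[T]^m (T ⊗[K] V)), r • x = f r • x := fun _ _ => rfl
  have key : ∀ (w : Fin m → R ⊗[K] V) (j : Fin m) (z : R ⊗[K] V),
      (fun j' => scalarMap V f (Function.update w j z j')) =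
        Function.update (fun j' => scalarMap V f (w j')) j (scalarMap V f z) := by
    intro w j z
    ext j'
    by_cases hj : j' = j
    · subst hj
      simp
    · simp [hj]
  let Φ : (R ⊗[K] V) [⋀^Fin m]→ₗ[R] (⋀[T]^m (T ⊗[K] V)) :=
    { toFun := fun w => exteriorPower.ιMulti T m (fun j => scalarMap V f (w j))
      map_update_add' := fun {hd} w j x y => by
        obtain rfl : hd = instDecidableEqFin m := Subsingleton.elim _ _
        rw [key, key, key, map_add, AlternatingMap.map_update_add]
      map_update_smul' := fun {hd} w j r x => by
        obtain rfl : hd = instDecidableEqFin m := Subsingleton.elim _ _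
        rw [key, key, scalarMap_smul, AlternatingMap.map_update_smul, hc]
      map_eq_zero_of_eq' := fun w i j hw hij =>
        (exteriorPower.ιMulti T m).map_eq_zero_of_eq _ (by simp [hw]) hij }
  let Ψ : ⋀[R]^m (R ⊗[K] V) →ₗ[R] (⋀[T]^m (T ⊗[K] V)) :=
    exteriorPower.alternatingMapLinearEquiv Φ
  have hΨ : ∀ w, Ψ (exteriorPower.ιMulti R m w) =
      exteriorPower.ιMulti T m (fun j => scalarMap V f (w j)) := fun w =>
    exteriorPower.alternatingMapLinearEquiv_apply_ιMulti Φ w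
  have hspan : ∀ x ∈ Submodule.span R (invariantWedges (V := V) R A m),
      Ψ x ∈ Submodule.span T (invariantWedges (V := V) T A m) := by
    intro x hx
    induction hx using Submodule.span_induction with
    | mem x hx =>
      obtain ⟨v, hv, hA, rfl⟩ := hx
      rw [hΨ]
      exact Submodule.subset_span ⟨v, hv, hA, by simp⟩
    | zero => rw [map_zero]; exact Submodule.zero_mem _
    | add x y _ _ hx hy => rw [map_add]; exact Submodule.add_mem _ hx hy
    | smul r x _ hx => rw [map_smul, hc]; exact Submodule.smul_mem _ _ hx
  refine fun w hw => mem_of_forall_mem_span _ _ _ (fun w hw => ?_) w hw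
  choose x hx hxw using hw
  have hw' : w = fun j => scalarMap V f (x j) := funext fun j => (hxw j).symm
  rw [hw', ← hΨ]
  exact hspan _ (h x hx)

end Lemmas

/-! ## The functors of families -/

variable (V) [FiniteDimensional K V]

/-- The functor of points of the Grassmannian of `m`-dimensional subspaces of `V`. -/
def grassmannian (m : ℕ) : CommAlgCat.{u} K ⥤ Type u where
  obj R := {M : Submodule R (R ⊗[K] V) // IsSummandOfRank m M}
  map f := ↾fun M => ⟨familyPullback f.hom M.1, M.2.pullback f.hom⟩
  map_id _ := ConcreteCategory.hom_ext _ _ fun M => Subtype.ext (pullback_id M.1)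
  map_comp f g :=
    ConcreteCategory.hom_ext _ _ fun M => Subtype.ext (pullback_comp g.hom f.hom M.1)

/-- The subfunctor `F_A(m, V)` of `A`-invariant families. -/
def invariantFamilies (A : Subring (Module.End K V)) (m : ℕ) :
    Subfunctor (grassmannian (K := K) V m) where
  obj _ := {M | IsInvariant A M.1}
  map f _ hM := IsInvariant.pullback hM f.hom

/-- The subfunctor `G_A(m, V)` of families generated by `A`-invariants. -/
def generatedFamilies (A : Subring (Module.End K V)) (m : ℕ) :
    Subfunctor (grassmannian (K := K) V m) where
  obj _ := {M | IsGeneratedByInvariants A m M.1}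
  map f _ hM := IsGeneratedByInvariants.pullback hM f.hom

end Families

/-- The product of a family of functors with values in types. -/
def piFunctor {C : Type v} [Category.{w} C] {ι : Type} (F : ι → C ⥤ Type u) : C ⥤ Type u where
  obj R := ∀ i, (F i).obj R
  map f := ↾fun x i => (F i).map f (x i)
  map_id R := by
    ext x i
    simp
  map_comp f g := by
    ext x i
    simp

/-! ## Two-sided vector spaces

A `k`-central `K`-`K`-bimodule is a module over `K ⊗[k] K`, where `K` acts on the left through
`x ↦ x ⊗ 1` and on the right through `x ↦ 1 ⊗ x`. It is a two-sided vector space if it is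
finite-dimensional over `K` for the left action. -/

section TwoSidedSpaces

variable (k : Type w) (K : Type u) [Field k] [Field K] [Algebra k K]
variable (V : Type u) [AddCommGroup V] [Module K V] [Module (K ⊗[k] K) V]
  [IsScalarTower K (K ⊗[k] K) V]

/-- The ring homomorphism `φ : K → End(_K V)` giving the right action of `K` on `V`. -/
def rightAction : K →+* Module.End K V :=
  (Module.toModuleEnd K (S := K ⊗[k] K) V).comp
    (Algebra.TensorProduct.includeRight : K →ₐ[k] K ⊗[k] K).toRingHom

variable {V} in
instance finiteDimensional_submodule [FiniteDimensional K V] (W : Submodule (K ⊗[k] K) V) :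
    FiniteDimensional K W :=
  inferInstanceAs (FiniteDimensional K (W.restrictScalars K))

variable [FiniteDimensional K V] {r : ℕ} (S : Fin r → Type v) [∀ i, AddCommGroup (S i)]
  [∀ i, Module K (S i)] [∀ i, Module (K ⊗[k] K) (S i)] [∀ i, IsScalarTower K (K ⊗[k] K) (S i)]

/-- The functor `F_φ(q₁[S₁] + ⋯ + qᵣ[Sᵣ], V)` for semisimple `V`: the product of the functors
`F_{im φᵢ}(qᵢ dim Sᵢ, Vᵢ)`, where `Vᵢ` is the `Sᵢ`-homogeneous component of `V` and `φᵢ` is the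
right action on it. -/
def functorF (q : Fin r → ℕ) : CommAlgCat.{u} K ⥤ Type u :=
  piFunctor fun i =>
    (invariantFamilies (isotypicComponent (K ⊗[k] K) V (S i))
      (rightAction k K (isotypicComponent (K ⊗[k] K) V (S i))).range
      (q i * Module.finrank K (S i))).toFunctor

/-- The functor `H_φ(q₁[S₁] + ⋯ + qᵣ[Sᵣ], V)` for semisimple `V`: the product of the functors
`H_{im φᵢ}(qᵢ dim Sᵢ, Vᵢ)`, where `H_A` is the intersection of `F_A` and `G_A` in the
Grassmannian. -/
def functorH (q : Fin r → ℕ) : CommAlgCat.{u} K ⥤ Type u :=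
  piFunctor fun i =>
    (invariantFamilies (isotypicComponent (K ⊗[k] K) V (S i))
        (rightAction k K (isotypicComponent (K ⊗[k] K) V (S i))).range
        (q i * Module.finrank K (S i)) ⊓
      generatedFamilies (isotypicComponent (K ⊗[k] K) V (S i))
        (rightAction k K (isotypicComponent (K ⊗[k] K) V (S i))).range
        (q i * Module.finrank K (S i))).toFunctor

end TwoSidedSpaces

/-! ## Representing schemes -/

section Schemes

variable {K : Type u} [Field K]

/-- The functor of points `R ↦ Hom_{Spec K}(Spec R, Y)` of a scheme `Y` over `Spec K`. -/
def functorOfPoints (Y : Over (Spec (CommRingCat.of K))) : CommAlgCat.{u} K ⥤ Type u :=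
  (algSpec (CommRingCat.of K)).rightOp ⋙ yoneda.obj Y

/-- The scheme `Y` over `Spec K` represents `F`. -/
def Represents (Y : Over (Spec (CommRingCat.of K))) (F : CommAlgCat.{u} K ⥤ Type u) : Prop :=
  Nonempty (functorOfPoints Y ≅ F)

/-- `Y` contains an open subscheme which is smooth over `K`, reduced, irreducible and of dimension
`d`, and through which every `K`-rational point of `Y` factors. -/
def HasSmoothOpenCoveringPoints (Y : Over (Spec (CommRingCat.of K))) (d : ℕ) : Prop :=
  ∃ U : Y.left.Opens, Smooth (U.ι ≫ Y.hom) ∧ IsReduced (U : Scheme.{u}) ∧ IrreducibleSpace U ∧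
    topologicalKrullDim U = d ∧
    ∀ p : Over.mk (𝟙 (Spec (CommRingCat.of K))) ⟶ Y, Set.range p.left ⊆ U

end Schemes

end TwoSided

/-! Representability. Each `F_i` is a closed subfunctor of the Grassmannian of `V_i`, because
invariance of a direct summand `M` says that certain vectors with coordinates in `R` vanish
(`isClosedSub_invariantFamilies`). So is `H_i`: exterior powers commute with base change, and being
generated by invariants says that the wedges of elements of `M` vanish modulo a fixed `K`-subspace
of `⋀ᵐ V_i` (`isClosedSub_generatedFamilies`). The Grassmannian is a Zariski sheaf covered by open
subfunctors, one for each of finitely many coordinate projections `q : V → Q`, formed by the images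
of sections of `q`. Sections of `q` are a torsor under `Hom(Q, ker q)`, so every chart is an affine
space (`grassmannian_hasAffineCharts`). Affine charts pass to closed subfunctors and finite
products.

Gluing. A functor on `K`-algebras becomes a functor on rings when the structure map `K → R` is
recorded as part of an element (`total`). It extends to schemes as families of elements over the
stalks that locally come from rings of sections. This extension is a Zariski sheaf for which the
charts are open immersions, so the criterion of local representability applies
(`exists_pointsEquiv`, `exists_represents`).

Smooth open part. Let `V ≅ S^l` with `S` simple, and let `q` be one of the `l` coordinate
projections `V → S`. The image of a section `σ` of `q` is invariant exactly when `σ` is linear over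
`K ⊗ K`. As `K ⊗ K` is commutative and `S` is generated by one element `s₀`, the annihilator of `s₀`
is that of `S`, which also kills `V`. Hence `σ` is determined by `σ s₀`, which may be any lift of `1
⊗ s₀`, and the chart is the affine space on `ker q`, of dimension `lm - m`
(`exists_isUniversal_invariantFamilies`). A rational point is a nonzero subbimodule of dimension
`m`; some coordinate projection is nonzero on it, hence onto by simplicity, so the point lies in
that chart (`exists_mem_graphs`). The diagonal copy of `S` lies in all charts, so their union is
irreducible.

For `H` with `K` infinite: every rational point of `F` lies in `H`, and a closed condition on affine
space that holds at all rational points holds identically. The charts of `F` are therefore charts of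
`H`. -/

/-! ## Zariski sheaves on rings and their extension to schemes -/

namespace RingFunctor

open Opposite

/-- The homomorphism from `R` to the stalk of `X` at `x` given by a morphism `X ⟶ Spec R`. -/
def germHom {X : Scheme.{u}} {R : CommRingCat.{u}} (h : X ⟶ Spec R) (x : X) :
    R ⟶ X.presheaf.stalk x :=
  (Scheme.ΓSpecIso R).inv ≫ (Spec R).presheaf.germ ⊤ (h x) (TopologicalSpace.Opens.mem_top _) ≫
      h.stalkMap x

theorem germHom_eq {X : Scheme.{u}} {R : CommRingCat.{u}} (h : X ⟶ Spec R) (x : X) :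
    germHom h x = (Scheme.ΓSpecIso R).inv ≫ h.appTop ≫ X.presheaf.germ ⊤ x
        (TopologicalSpace.Opens.mem_top _) := by
  rw [germHom, Scheme.Hom.germ_stalkMap]
  rfl

theorem germHom_comp {X Y : Scheme.{u}} {R : CommRingCat.{u}} (f : X ⟶ Y) (h : Y ⟶ Spec R)
    (x : X) : germHom (f ≫ h) x = germHom h (f x) ≫ f.stalkMap x := by
  simp only [germHom, Scheme.Hom.stalkMap_comp, Category.assoc]
  rfl

theorem germHom_comp_specMap {X : Scheme.{u}} {R T : CommRingCat.{u}} (h : X ⟶ Spec T)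
    (φ : R ⟶ T) (x : X) : germHom (h ≫ Spec.map φ) x = φ ≫ germHom h x := by
  rw [germHom_eq, germHom_eq, Scheme.Hom.comp_appTop]
  simp only [Category.assoc]
  rw [← Scheme.ΓSpecIso_inv_naturality_assoc]

/-- A morphism to an affine scheme is determined by its effect on global sections, and a section by
its germs. -/
theorem germHom_injective {X : Scheme.{u}} {R : CommRingCat.{u}} {h h' : X ⟶ Spec R}
    (H : ∀ x, germHom h x = germHom h' x) : h = h' := by
  apply ext_to_Spec
  ext a
  refine TopCat.Presheaf.section_ext X.sheaf ⊤ _ _ fun x hx => ?_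
  have := congrArg (fun f => f.hom a) ((germHom_eq h x).symm.trans ((H x).trans (germHom_eq h' x)))
  exact this

theorem germHom_toSpecΓ {X : Scheme.{u}} (U : X.Opens) (x : (U : Scheme.{u})) :
    germHom U.toSpecΓ x = X.presheaf.germ U x.1 x.2 ≫ U.ι.stalkMap x := by
  refine (germHom_eq _ _).trans (Eq.trans ?_ (U.ι.germ_stalkMap U x x.2).symm)
  rw [Scheme.Opens.toSpecΓ_appTop, Category.assoc, Iso.inv_hom_id_assoc, Scheme.Opens.topIso_inv]
  have h := TopCat.Presheaf.germ_res (U : Scheme.{u}).presheaf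
    (homOfLE (show ⊤ ≤ U.ι ⁻¹ᵁ U by simp)) x trivial
  rw [Scheme.Opens.ι_app]
  refine Eq.trans ?_ (congrArg (fun g => X.presheaf.map _ ≫ g) h)
  refine Eq.trans ?_ (Category.assoc _ _ _)
  refine congrArg (fun g => g ≫ (U : Scheme.{u}).presheaf.germ ⊤ x trivial) ?_
  exact (X.presheaf.map_comp _ _)

variable (E : CommRingCat.{u} ⥤ Type u)

/-- A family of elements over the stalks of `X` is locally induced if it comes locally from
elements over rings of sections. -/
def IsLocallyInduced (X : Scheme.{u}) (s : ∀ x : X, E.obj (X.presheaf.stalk x)) : Prop :=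
  ∀ x, ∃ (U : X.Opens) (_ : x ∈ U) (t : E.obj Γ(X, U)),
    ∀ (y) (hy : y ∈ U), E.map (X.presheaf.germ U y hy) t = s y

variable {E} in
theorem IsLocallyInduced.pullback {X Y : Scheme.{u}} (f : X ⟶ Y)
    {s : ∀ y : Y, E.obj (Y.presheaf.stalk y)} (hs : IsLocallyInduced E Y s) :
    IsLocallyInduced E X fun x => E.map (f.stalkMap x) (s (f x)) := by
  intro x
  obtain ⟨U, hU, t, ht⟩ := hs (f x)
  refine ⟨f ⁻¹ᵁ U, hU, E.map (f.app U) t, fun y hy => ?_⟩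
  change _ = E.map (f.stalkMap y) (s (f y))
  rw [← ht (f y) hy, ← Functor.map_comp_apply, ← Functor.map_comp_apply]
  exact congrArg (fun g => E.map g t) (f.germ_stalkMap U y hy).symm

/-- The sections over `X` of the extension of `E` to schemes: locally induced families. -/
def LocSection (X : Scheme.{u}) : Type u :=
  {s : ∀ x : X, E.obj (X.presheaf.stalk x) // IsLocallyInduced E X s}

variable {E} in
theorem LocSection.ext {X : Scheme.{u}} {s t : LocSection E X} (h : ∀ x, s.1 x = t.1 x) : s = t :=
  Subtype.ext (funext h)

variable {E} in
/-- The pullback of sections of the extension of `E` along a morphism of schemes. -/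
def LocSection.pullback {X Y : Scheme.{u}} (f : X ⟶ Y) (s : LocSection E Y) : LocSection E X :=
  ⟨fun x => E.map (f.stalkMap x) (s.1 (f x)), s.2.pullback f⟩

variable {E} in
theorem LocSection.pullback_val {X Y : Scheme.{u}} (f : X ⟶ Y) (s : LocSection E Y) (x : X) :
    (s.pullback f).1 x = E.map (f.stalkMap x) (s.1 (f x)) := rfl

variable {E} in
theorem LocSection.pullback_id {X : Scheme.{u}} (s : LocSection E X) : s.pullback (𝟙 X) = s := by
  refine LocSection.ext fun x => ?_
  change E.map ((𝟙 X : X ⟶ X).stalkMap x) (s.1 x) = s.1 x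
  rw [Scheme.Hom.stalkMap_id]
  exact congrArg (fun g => g (s.1 x)) (E.map_id (X.presheaf.stalk x))

variable {E} in
theorem LocSection.pullback_comp {X Y Z : Scheme.{u}} (f : X ⟶ Y) (g : Y ⟶ Z)
    (s : LocSection E Z) : s.pullback (f ≫ g) = (s.pullback g).pullback f := by
  refine LocSection.ext fun x => ?_
  change E.map ((f ≫ g).stalkMap x) (s.1 _) = E.map _ (E.map _ (s.1 _))
  rw [← Functor.map_comp_apply, Scheme.Hom.stalkMap_comp]
  rfl

/-- The extension of a functor on rings to schemes, by locally induced families. -/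
def extension : Scheme.{u}ᵒᵖ ⥤ Type u where
  obj X := LocSection E X.unop
  map f := ↾fun s => s.pullback f.unop
  map_id _ := ConcreteCategory.hom_ext _ _ fun s => s.pullback_id
  map_comp f g := ConcreteCategory.hom_ext _ _ fun s => s.pullback_comp g.unop f.unop

/-- The section of the extension induced by an element over `R` along `X ⟶ Spec R`. -/
def induced {X : Scheme.{u}} {R : CommRingCat.{u}} (h : X ⟶ Spec R) (t : E.obj R) :
    LocSection E X :=
  ⟨fun x => E.map (germHom h x) t, fun x => ⟨⊤, trivial,
    E.map ((Scheme.ΓSpecIso R).inv ≫ h.appTop) t, fun y hy => by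
      change _ = E.map (germHom h y) t
      rw [← Functor.map_comp_apply, germHom_eq, Category.assoc]⟩⟩

theorem induced_val {X : Scheme.{u}} {R : CommRingCat.{u}} (h : X ⟶ Spec R) (t : E.obj R)
    (x : X) : (induced E h t).1 x = E.map (germHom h x) t := rfl

theorem pullback_induced {X Y : Scheme.{u}} {R : CommRingCat.{u}} (f : X ⟶ Y)
    (h : Y ⟶ Spec R) (t : E.obj R) :
    (induced E h t).pullback f = induced E (f ≫ h) t := by
  refine LocSection.ext fun x => ?_
  simp only [LocSection.pullback_val, induced_val, germHom_comp, Functor.map_comp_apply]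

theorem induced_comp_specMap {X : Scheme.{u}} {R T : CommRingCat.{u}} (h : X ⟶ Spec T)
    (φ : R ⟶ T) (t : E.obj R) : induced E (h ≫ Spec.map φ) t = induced E h (E.map φ t) := by
  refine LocSection.ext fun x => ?_
  simp only [induced_val, germHom_comp_specMap, Functor.map_comp_apply]

/-- Open subfunctors of functors on rings. -/
def IsOpenSub (C : Subfunctor E) : Prop :=
  ∀ (R : CommRingCat.{u}) (s : E.obj R), ∃ I : Ideal R, ∀ (T : CommRingCat.{u}) (f : R ⟶ T),
    E.map f s ∈ C.obj T ↔ I.map f.hom = ⊤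

variable {E} in
/-- `c` is a universal element of the subfunctor `C`. -/
structure IsUniversal (C : Subfunctor E) {A : CommRingCat.{u}} (c : E.obj A) : Prop where
  mem : c ∈ C.obj A
  exists_map_eq : ∀ {T : CommRingCat.{u}} (s : E.obj T), s ∈ C.obj T → ∃ f : A ⟶ T, E.map f c = s
  injective : ∀ {T : CommRingCat.{u}} {f g : A ⟶ T}, E.map f c = E.map g c → f = g

section Open

variable {E} {C : Subfunctor E} (hC : IsOpenSub E C)
include hC

/-- In the local ring at `x` the ideal that defines `C` becomes the unit ideal, so it contains some
`g` that is invertible at `x`. The element `t` then lies in `C` over the basic open set of `g`. -/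
theorem IsOpenSub.exists_mem {X : Scheme.{u}} {s : ∀ x : X, E.obj (X.presheaf.stalk x)}
    (hs : IsLocallyInduced E X s) {x : X} (hx : s x ∈ C.obj _) :
    ∃ (U : X.Opens) (_ : x ∈ U) (t : E.obj Γ(X, U)), t ∈ C.obj _ ∧
      ∀ (y) (hy : y ∈ U), E.map (X.presheaf.germ U y hy) t = s y := by
  obtain ⟨U, hU, t, ht⟩ := hs x
  obtain ⟨I, hI⟩ := hC _ t
  rw [← ht x hU, hI] at hx
  obtain ⟨g, hg, hgu⟩ : ∃ g ∈ I, IsUnit (X.presheaf.germ U x hU g) := by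
    by_contra! H
    have : I.map (X.presheaf.germ U x hU).hom ≤ IsLocalRing.maximalIdeal _ := by
      rw [Ideal.map_le_iff_le_comap]
      exact fun g hg => H g hg
    rw [hx, top_le_iff] at this
    exact (IsLocalRing.maximalIdeal.isMaximal _).ne_top this
  refine ⟨X.basicOpen g, (X.mem_basicOpen g x hU).2 hgu,
    E.map (X.presheaf.map (homOfLE (X.basicOpen_le g)).op) t, ?_, fun y hy => ?_⟩
  · rw [hI]
    exact Ideal.eq_top_of_isUnit_mem _ (Ideal.mem_map_of_mem _ hg)
      (RingedSpace.isUnit_res_basicOpen _ g)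
  · rw [← Functor.map_comp_apply, TopCat.Presheaf.germ_res]
    exact ht y (X.basicOpen_le g hy)

/-- The open set on which a section of the extension lies in an open subfunctor. -/
def IsOpenSub.locus {X : Scheme.{u}} (s : LocSection E X) : X.Opens :=
  ⟨{x | s.1 x ∈ C.obj _}, by
    refine isOpen_iff_forall_mem_open.2 fun x hx => ?_
    obtain ⟨U, hU, t, ht, h⟩ := hC.exists_mem s.2 hx
    refine ⟨U, fun y hy => ?_, U.2, hU⟩
    change s.1 y ∈ C.obj _
    rw [← h y hy]
    exact C.map _ ht⟩

/-- A local homomorphism sends a proper ideal into the maximal ideal, so it cannot turn it into the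
unit ideal. Since stalk maps are local, membership in an open subfunctor at a point can be read off
after pullback. -/
theorem IsOpenSub.mem_of_isLocalHom {R T : CommRingCat.{u}} [IsLocalRing R] [IsLocalRing T]
    (f : R ⟶ T) [IsLocalHom f.hom] {s : E.obj R} (hs : E.map f s ∈ C.obj T) : s ∈ C.obj R := by
  obtain ⟨I, hI⟩ := hC _ s
  rw [hI] at hs
  have hI' : I = ⊤ := by
    by_contra H
    have h1 : I.map f.hom ≤ IsLocalRing.maximalIdeal T :=
      (Ideal.map_mono (IsLocalRing.le_maximalIdeal H)).trans
        (((IsLocalRing.local_hom_TFAE f.hom).out 0 2).1 ‹_›)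
    rw [hs, top_le_iff] at h1
    exact (IsLocalRing.maximalIdeal.isMaximal T).ne_top h1
  have := (hI R (𝟙 R)).2 (by rw [hI']; exact Ideal.map_top _)
  rwa [Functor.map_id_apply] at this

end Open

end RingFunctor

/-! ### The Zariski sheaf property of the extension, and open immersions from universal elements -/

namespace RingFunctor

open Opposite Limits

variable (E : CommRingCat.{u} ⥤ Type u)

theorem map_injective_of_isIso {R T : CommRingCat.{u}} (f : R ⟶ T) [IsIso f] {s t : E.obj R}
    (h : E.map f s = E.map f t) : s = t := by
  have := congrArg (E.map (inv f)) h
  simpa only [← Functor.map_comp_apply, IsIso.hom_inv_id, Functor.map_id_apply] using this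

theorem map_surjective_of_isIso {R T : CommRingCat.{u}} (f : R ⟶ T) [IsIso f] (t : E.obj T) :
    ∃ s, E.map f s = t :=
  ⟨E.map (inv f) t, by
    rw [← Functor.map_comp_apply, IsIso.inv_hom_id, Functor.map_id_apply]⟩

/-- In `extension_isSheaf` the value at a point is transported from a chosen member of the cover;
the transport disappears after pullback along equal morphisms. -/
theorem map_stalkMap_eqRec {X Y : Scheme.{u}} {f g : X ⟶ Y} (e : f = g) (x : X)
    (h : g x = f x) (t : E.obj (Y.presheaf.stalk (g x))) :
    E.map (f.stalkMap x) (h ▸ t : E.obj (Y.presheaf.stalk (f x))) = E.map (g.stalkMap x) t := by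
  subst e
  rfl

theorem appIso_inv_germ_stalkMap {X Y : Scheme.{u}} (f : X ⟶ Y) [IsOpenImmersion f] (U : X.Opens)
    (b : X) (hb : b ∈ U) (hb' : f b ∈ f ''ᵁ U) :
    ((f.appIso U).inv ≫ Y.presheaf.germ (f ''ᵁ U) (f b) hb') ≫ f.stalkMap b =
      X.presheaf.germ U b hb := by
  rw [Category.assoc]
  refine (congrArg (fun g => (f.appIso U).inv ≫ g) (f.germ_stalkMap (f ''ᵁ U) b hb')).trans ?_
  rw [← Category.assoc, Scheme.Hom.appIso_inv_app]
  exact TopCat.Presheaf.germ_res _ _ _ _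

/-- Open immersions induce isomorphisms on stalks, so the value of the glued section at `y` is
forced by any member of the cover that contains `y`. Two members give the same value because they
can be compared at a point of the fibre product. Local witnesses are carried over to image opens. -/
theorem extension_isSheaf : Presieve.IsSheaf Scheme.zariskiTopology (extension E) := by
  rw [Precoverage.isSheaf_toGrothendieck_iff_of_isStableUnderBaseChange]
  rintro Y S hS
  obtain ⟨(𝓤 : Scheme.OpenCover Y), rfl⟩ := Scheme.exists_cover_of_mem_pretopology hS
  rw [Presieve.isSheafFor_arrows_iff]
  intro (σ : ∀ i, LocSection E (𝓤.X i)) hσ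
  have compat : ∀ i j, (σ i).pullback (pullback.fst (𝓤.f i) (𝓤.f j)) =
      (σ j).pullback (pullback.snd (𝓤.f i) (𝓤.f j)) := fun i j =>
    hσ i j _ _ _ pullback.condition
  have key : ∀ i j (a : 𝓤.X i) (b : 𝓤.X j) (h : 𝓤.f j b = 𝓤.f i a)
      (t : E.obj (Y.presheaf.stalk (𝓤.f j b))), E.map ((𝓤.f j).stalkMap b) t = (σ j).1 b →
      E.map ((𝓤.f i).stalkMap a) (h ▸ t : E.obj (Y.presheaf.stalk (𝓤.f i a))) = (σ i).1 a := by
    intro i j a b h t ht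
    -- The point `w` of the fibre product lies over both `a` and `b`, and the stalk map of the first
    -- projection at `w` is invertible.
    obtain ⟨w, rfl, rfl⟩ := Scheme.Pullback.exists_preimage_pullback a b h.symm
    refine map_injective_of_isIso E ((pullback.fst (𝓤.f i) (𝓤.f j)).stalkMap w) ?_
    refine Eq.trans ?_ (congrFun (congrArg Subtype.val (compat i j)) w).symm
    rw [LocSection.pullback_val, ← ht]
    have := map_stalkMap_eqRec E (pullback.condition (f := 𝓤.f i) (g := 𝓤.f j)) w h t
    rw [Scheme.Hom.stalkMap_comp, Scheme.Hom.stalkMap_comp] at this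
    exact (Functor.map_comp_apply E _ _ _).symm.trans
      (this.trans (Functor.map_comp_apply E _ _ _))
  choose idx pt hpt using 𝓤.exists_eq
  have hinv : ∀ y, ∃ t, E.map ((𝓤.f (idx y)).stalkMap (pt y)) t = (σ (idx y)).1 (pt y) :=
    fun y => map_surjective_of_isIso E _ _
  choose t₀ ht₀ using hinv
  let τ : ∀ y : Y, E.obj (Y.presheaf.stalk y) := fun y => hpt y ▸ t₀ y
  have hτ : ∀ i (a : 𝓤.X i), E.map ((𝓤.f i).stalkMap a) (τ (𝓤.f i a)) = (σ i).1 a :=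
    fun i a => key i _ a _ (hpt _) _ (ht₀ _)
  have hloc : IsLocallyInduced E Y τ := by
    intro y
    obtain ⟨i, a, rfl⟩ := 𝓤.exists_eq y
    obtain ⟨U, hU, t, ht⟩ := (σ i).2 a
    refine ⟨(𝓤.f i) ''ᵁ U, ⟨a, hU, rfl⟩, E.map ((𝓤.f i).appIso U).inv t, ?_⟩
    rintro _ ⟨b, hb, rfl⟩
    refine map_injective_of_isIso E ((𝓤.f i).stalkMap b) ((Eq.trans ?_ (ht b hb)).trans
        (hτ i b).symm)
    rw [← appIso_inv_germ_stalkMap (𝓤.f i) U b hb ⟨b, hb, rfl⟩]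
    refine (congrArg _ (Functor.map_comp_apply E _ _ _).symm).trans ?_
    exact (Functor.map_comp_apply E _ _ _).symm
  refine ⟨(⟨τ, hloc⟩ : LocSection E Y), fun i => LocSection.ext fun a => hτ i a, ?_⟩
  intro (τ' : LocSection E Y) hτ'
  refine LocSection.ext fun y => ?_
  obtain ⟨i, a, rfl⟩ := 𝓤.exists_eq y
  refine map_injective_of_isIso E ((𝓤.f i).stalkMap a) ?_
  exact (congrFun (congrArg Subtype.val (hτ' i)) a).trans (hτ i a).symm

section Charts

variable {E} {C : Subfunctor E} {A : CommRingCat.{u}} {c : E.obj A}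

theorem IsUniversal.hom_ext (hc : IsUniversal C c) {X : Scheme.{u}} {h h' : X ⟶ Spec A}
    (H : induced E h c = induced E h' c) : h = h' :=
  germHom_injective fun x => hc.injective (congrFun (congrArg Subtype.val H) x)

/-- Locally the section is an element of `C` over a ring of sections, so universality gives a
morphism from a neighbourhood to `Spec A`. By `hom_ext` these morphisms agree on overlaps and glue.
-/
theorem IsUniversal.exists_induced_eq (hc : IsUniversal C c) (hC : IsOpenSub E C) {X : Scheme.{u}}
    (s : LocSection E X) (hs : ∀ x, s.1 x ∈ C.obj _) :
    ∃ h : X ⟶ Spec A, induced E h c = s := by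
  have key : ∀ x : X, ∃ (U : X.Opens) (_ : x ∈ U) (h : (U : Scheme.{u}) ⟶ Spec A),
      induced E h c = s.pullback U.ι := by
    intro x
    obtain ⟨U, hU, t, ht, h⟩ := hC.exists_mem s.2 (hs x)
    obtain ⟨ρ, rfl⟩ := hc.exists_map_eq t ht
    refine ⟨U, hU, U.toSpecΓ ≫ Spec.map ρ, ?_⟩
    rw [induced_comp_specMap]
    refine LocSection.ext fun y => ?_
    rw [induced_val, germHom_toSpecΓ]
    refine (Functor.map_comp_apply E _ _ _).trans ?_
    exact congrArg (E.map (U.ι.stalkMap y)) (h y.1 y.2)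
  choose U hU h hh using key
  let 𝓤 : X.OpenCover := X.openCoverOfIsOpenCover U (.mk (top_unique fun x _ => by
    simpa using ⟨x, hU x⟩))
  have hcompat : ∀ i j, pullback.fst (U i).ι (U j).ι ≫ h i = pullback.snd (U i).ι (U j).ι ≫ h j :=
    fun i j => hc.hom_ext (by
      rw [← pullback_induced, ← pullback_induced, hh, hh, ← LocSection.pullback_comp,
        ← LocSection.pullback_comp, pullback.condition])
  let g : X ⟶ Spec A := 𝓤.glueMorphisms h hcompat
  refine ⟨g, ?_⟩
  have hg : ∀ i, (U i).ι ≫ g = h i := 𝓤.ι_glueMorphisms h _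
  refine LocSection.ext fun x => ?_
  have h1 : (induced E g c).pullback (U x).ι = s.pullback (U x).ι := by
    rw [pullback_induced, ← hh x, hg x]
  let x' : (U x : Scheme.{u}) := ⟨x, hU x⟩
  exact map_injective_of_isIso E ((U x).ι.stalkMap x') (congrFun (congrArg Subtype.val h1) x')

/-- The fibre product of the chart with a section `s` over `X` is the open locus where `s` lies in
`C`. On this locus `s` is induced by a morphism to `Spec A`; conversely, if the pullback of `s`
along `f` is induced from `c`, then `mem_of_isLocalHom` puts the image of `f` in the locus. -/
theorem IsUniversal.isOpenImmersion_presheaf (hc : IsUniversal C c) (hC : IsOpenSub E C)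
    (φ : yoneda.obj (Spec A) ⟶ extension E) (hφ : ∀ {X : Scheme.{u}} (h : X ⟶ Spec A),
      φ.app (op X) h = induced E h c) :
    MorphismProperty.presheaf @IsOpenImmersion φ := by
  refine MorphismProperty.relative.of_exists fun X g => ?_
  obtain ⟨(s : LocSection E X), rfl⟩ := yonedaEquiv.symm.surjective g
  let U : X.Opens := hC.locus s
  obtain ⟨h, hh⟩ := hc.exists_induced_eq hC (s.pullback U.ι) (fun x => C.map _ x.2)
  have hφ' : ∀ {Z : Scheme.{u}} (f : Z ⟶ U), φ.app (op Z) (f ≫ h) = s.pullback (f ≫ U.ι) := by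
    intro Z f
    rw [hφ, ← pullback_induced, hh, LocSection.pullback_comp]
  refine ⟨U, yoneda.map h, U.ι, ?_, inferInstance⟩
  refine IsPullback.of_forall_isPullback_app fun Z => ?_
  rw [Types.isPullback_iff]
  refine ⟨ConcreteCategory.hom_ext _ _ fun f => hφ' f, fun f f' hff => ?_,
    fun (e : Z.unop ⟶ Spec A) (f : Z.unop ⟶ X) hef => ?_⟩
  · exact (cancel_mono U.ι).1 hff.2
  · have hef' : induced E e c = s.pullback f := (hφ e).symm.trans hef
    have hmem : ∀ z, f z ∈ U := by
      intro z
      have h1 : E.map (f.stalkMap z) (s.1 (f z)) ∈ C.obj _ := by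
        rw [← LocSection.pullback_val, ← hef']
        exact C.map _ hc.mem
      exact hC.mem_of_isLocalHom (f.stalkMap z) h1
    have hr : Set.range f ⊆ Set.range U.ι := by
      rintro _ ⟨z, rfl⟩
      rw [Scheme.Opens.range_ι]
      exact hmem z
    refine ⟨IsOpenImmersion.lift U.ι f hr, ?_, IsOpenImmersion.lift_fac _ _ _⟩
    refine hc.hom_ext ?_
    change induced E (IsOpenImmersion.lift U.ι f hr ≫ h) c = _
    rw [← hφ, hφ', IsOpenImmersion.lift_fac, hef']

end Charts

end RingFunctor

/-! ### Sections over affine schemes, and gluing of the charts -/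

namespace RingFunctor

open Opposite Limits

variable (E : CommRingCat.{u} ⥤ Type u)

/-- The localization map `R ⟶ R_f`. -/
abbrev toAway {R : CommRingCat.{u}} (f : R) : R ⟶ CommRingCat.of (Localization.Away f) :=
  CommRingCat.ofHom (algebraMap R (Localization.Away f))

/-- Zariski sheaves on rings whose elements are determined by their images in local rings. -/
structure IsZariskiSheaf : Prop where
  sep : ∀ {R : CommRingCat.{u}} (s t : E.obj R), (∀ (T : CommRingCat.{u}) [IsLocalRing T]
    (f : R ⟶ T), E.map f s = E.map f t) → s = t
  glue : ∀ {R : CommRingCat.{u}} {ι : Type u} [Finite ι] (f : ι → R),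
    Ideal.span (Set.range f) = ⊤ → ∀ t : ∀ i, E.obj (.of (Localization.Away (f i))),
    (∀ (i j : ι) (T : CommRingCat.{u}) (a : .of (Localization.Away (f i)) ⟶ T)
      (b : .of (Localization.Away (f j)) ⟶ T), toAway (f i) ≫ a = toAway (f j) ≫ b →
      E.map a (t i) = E.map b (t j)) → ∃ s, ∀ i, E.map (toAway (f i)) s = t i

variable {E}

theorem exists_induced_eq_pullback {X : Scheme.{u}} {T : CommRingCat.{u}} (s : LocSection E X)
    {U : X.Opens} {t : E.obj Γ(X, U)}
    (ht : ∀ (y) (hy : y ∈ U), E.map (X.presheaf.germ U y hy) t = s.1 y) (g : Spec T ⟶ X)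
    (hg : Set.range g ⊆ U) : ∃ t', induced E (𝟙 (Spec T)) t' = s.pullback g := by
  have hg' : Set.range g ⊆ Set.range U.ι := by rwa [Scheme.Opens.range_ι]
  let k := IsOpenImmersion.lift U.ι g hg'
  have hU : induced E U.toSpecΓ t = s.pullback U.ι := by
    refine LocSection.ext fun y => ?_
    rw [induced_val, germHom_toSpecΓ]
    exact (Functor.map_comp_apply E _ _ _).trans (congrArg (E.map (U.ι.stalkMap y)) (ht y.1 y.2))
  refine ⟨E.map (Spec.preimage (k ≫ U.toSpecΓ)) t, ?_⟩
  rw [← induced_comp_specMap, Spec.map_preimage, Category.id_comp, ← pullback_induced, hU,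
    ← LocSection.pullback_comp, IsOpenImmersion.lift_fac]

section

variable (hE : IsZariskiSheaf E)
include hE

theorem IsZariskiSheaf.induced_injective {R : CommRingCat.{u}} {s t : E.obj R}
    (h : induced E (𝟙 (Spec R)) s = induced E (𝟙 (Spec R)) t) : s = t := by
  refine hE.sep s t fun T _ f => ?_
  have h1 : induced E (𝟙 (Spec T)) (E.map f s) = induced E (𝟙 (Spec T)) (E.map f t) := by
    rw [← induced_comp_specMap, ← induced_comp_specMap, Category.id_comp]
    simpa only [pullback_induced, Category.comp_id] using congrArg (LocSection.pullback
        (Spec.map f)) h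
  -- The stalk of `Spec T` at its closed point is the local ring `T` itself, so the germ there
  -- recovers the element.
  have h2 : IsIso (germHom (𝟙 (Spec T)) (IsLocalRing.closedPoint T)) := by
    have h3 : germHom (𝟙 (Spec T)) (IsLocalRing.closedPoint T) = (stalkClosedPointIso T).inv := by
      refine (germHom_eq (𝟙 (Spec T)) _).trans ?_
      rw [Iso.inv_comp_eq]
      refine Eq.trans ?_ (ΓSpecIso_hom_stalkClosedPointIso_inv T).symm
      exact Category.id_comp _
    exact h3 ▸ inferInstance
  exact map_injective_of_isIso E _ (congrFun (congrArg Subtype.val h1) (IsLocalRing.closedPoint T))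

/-- Every point has a basic open neighbourhood on which the section is induced. By quasi-compactness
finitely many suffice, their elements agree on overlaps by `induced_injective`, and the sheaf
property glues them. -/
theorem IsZariskiSheaf.exists_induced_eq {R : CommRingCat.{u}} (s : LocSection E (Spec R)) :
    ∃ t, induced E (𝟙 (Spec R)) t = s := by
  have key : ∀ x : Spec R, ∃ f : R, x ∈ PrimeSpectrum.basicOpen f ∧
      ∃ t, induced E (𝟙 _) t = s.pullback (Spec.map (toAway f)) := by
    intro x
    obtain ⟨U, hU, t, ht⟩ := s.2 x
    obtain ⟨_, ⟨_, ⟨f, rfl⟩, rfl⟩, hf, hfU⟩ :=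
      PrimeSpectrum.isBasis_basic_opens.exists_subset_of_mem_open hU U.2
    refine ⟨f, hf, exists_induced_eq_pullback s ht _ ?_⟩
    refine subset_trans ?_ hfU
    exact (PrimeSpectrum.localization_away_comap_range (Localization.Away f) f).subset
  choose f hf t ht using key
  have hspan : Ideal.span (Set.range f) = ⊤ := by
    rw [← PrimeSpectrum.iSup_basicOpen_eq_top_iff]
    exact top_unique fun x _ => by simpa using ⟨x, hf x⟩
  obtain ⟨S, hS, hS'⟩ := (Ideal.span_eq_top_iff_finite _).1 hspan
  choose g hg using hS
  let ι := {r // r ∈ S}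
  let p : ι → Spec R := fun r => g r.2
  have hp : Set.range (fun i => f (p i)) = (S : Set R) := by
    ext r
    constructor
    · rintro ⟨i, rfl⟩
      simp only [p, hg]
      exact i.2
    · exact fun hr => ⟨⟨r, hr⟩, hg hr⟩
  obtain ⟨t', ht'⟩ := hE.glue (fun i => f (p i)) (by rw [hp, hS']) (fun i => t (p i)) (by
    intro i j T a b hab
    refine hE.induced_injective ?_
    rw [← induced_comp_specMap, ← induced_comp_specMap, Category.id_comp, Category.id_comp]
    have h1 : ∀ (x) (a : .of (Localization.Away (f x)) ⟶ T),
        induced E (Spec.map a) (t x) = s.pullback (Spec.map (toAway (f x) ≫ a)) := by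
      intro x a
      rw [Spec.map_comp, LocSection.pullback_comp, ← ht, pullback_induced, Category.comp_id]
    rw [h1, h1, hab])
  refine ⟨t', LocSection.ext fun x => ?_⟩
  obtain ⟨i, hi⟩ : ∃ i, x ∈ PrimeSpectrum.basicOpen (f (p i)) := by
    have h1 : x ∈ ⨆ i, PrimeSpectrum.basicOpen (f (p i)) := by
      rw [(PrimeSpectrum.iSup_basicOpen_eq_top_iff (f := fun i => f (p i))).2 (by rw [hp, hS'])]
      trivial
    exact TopologicalSpace.Opens.mem_iSup.1 h1
  obtain ⟨y, rfl⟩ : x ∈ Set.range (Spec.map (toAway (f (p i)))) :=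
    (PrimeSpectrum.localization_away_comap_range (Localization.Away (f (p i))) (f
        (p i))).superset hi
  have h1 : (induced E (𝟙 (Spec R)) t').pullback (Spec.map (toAway (f (p i)))) =
      s.pullback (Spec.map (toAway (f (p i)))) := by
    rw [pullback_induced, ← ht, ← ht', ← induced_comp_specMap, Category.comp_id, Category.id_comp]
  have : IsOpenImmersion (Spec.map (toAway (f (p i)))) :=
    inferInstanceAs (IsOpenImmersion (Spec.map (CommRingCat.ofHom (algebraMap _ _))))
  exact map_injective_of_isIso E ((Spec.map (toAway (f (p i)))).stalkMap y)
    (congrFun (congrArg Subtype.val h1) y)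

end

variable (E) in
/-- `Y` has the functor of points `E` on affine schemes. -/
structure PointsEquiv (Y : Scheme.{u}) where
  equiv : ∀ R : CommRingCat.{u}, (Spec R ⟶ Y) ≃ E.obj R
  naturality : ∀ {R T : CommRingCat.{u}} (f : R ⟶ T) (g : Spec R ⟶ Y),
    equiv T (Spec.map f ≫ g) = E.map f (equiv R g)

theorem hom_ext_of_affine {X Y : Scheme.{u}} {f g : X ⟶ Y}
    (h : ∀ (R : CommRingCat.{u}) (e : Spec R ⟶ X), e ≫ f = e ≫ g) : f = g :=
  X.affineCover.hom_ext _ _ fun i => h _ (X.affineCover.f i)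

/-- Affine schemes are dense in schemes. -/
theorem exists_hom_of_affine {X Y : Scheme.{u}} (Φ : ∀ R : CommRingCat.{u}, (Spec R ⟶ X) →
    (Spec R ⟶ Y))
    (hΦ : ∀ {R T : CommRingCat.{u}} (f : R ⟶ T) (g : Spec R ⟶ X),
      Φ T (Spec.map f ≫ g) = Spec.map f ≫ Φ R g) :
    ∃ π : X ⟶ Y, ∀ (R : CommRingCat.{u}) (g : Spec R ⟶ X), g ≫ π = Φ R g := by
  have hΦ' : ∀ {R T : CommRingCat.{u}} (e : Spec T ⟶ Spec R) (g : Spec R ⟶ X),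
      Φ T (e ≫ g) = e ≫ Φ R g := by
    intro R T e g
    rw [← Spec.map_preimage e, hΦ]
  have hΦ₂ : ∀ {R R' T : CommRingCat.{u}} (e : Spec T ⟶ Spec R) (e' : Spec T ⟶ Spec R')
      (g : Spec R ⟶ X) (g' : Spec R' ⟶ X), e ≫ g = e' ≫ g' → e ≫ Φ R g = e' ≫ Φ R' g' := by
    intro R R' T e e' g g' h
    rw [← hΦ', ← hΦ', h]
  let 𝓤 := X.affineCover
  let π : X ⟶ Y := 𝓤.glueMorphisms (fun i => Φ _ (𝓤.f i))
      (fun i j => hom_ext_of_affine fun R e => by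
    refine (Category.assoc _ _ _).symm.trans (Eq.trans ?_ (Category.assoc _ _ _))
    refine hΦ₂ _ _ _ _ ((Category.assoc _ _ _).trans (Eq.trans ?_ (Category.assoc _ _ _).symm))
    exact congrArg (fun g => e ≫ g) pullback.condition)
  have hπ : ∀ i, 𝓤.f i ≫ π = Φ _ (𝓤.f i) := 𝓤.ι_glueMorphisms _ _
  refine ⟨π, fun R g => ?_⟩
  refine Scheme.Cover.hom_ext (𝓤.pullback₁ g) _ _ fun i => hom_ext_of_affine fun T e => ?_
  change e ≫ pullback.fst g (𝓤.f i) ≫ g ≫ π = e ≫ pullback.fst g (𝓤.f i) ≫ Φ R g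
  have h1 : pullback.fst g (𝓤.f i) ≫ g ≫ π = pullback.snd g (𝓤.f i) ≫ Φ _ (𝓤.f i) :=
    (pullback.condition_assoc π).trans (congrArg (fun g' => pullback.snd g (𝓤.f i) ≫ g') (hπ i))
  refine (congrArg (fun g' => e ≫ g') h1).trans ?_
  refine (Category.assoc _ _ _).symm.trans (Eq.trans ?_ (Category.assoc _ _ _))
  refine hΦ₂ _ _ _ _ ((Category.assoc _ _ _).trans (Eq.trans ?_ (Category.assoc _ _ _).symm))
  exact congrArg (fun g => e ≫ g) pullback.condition.symm

/-- Universal elements of open subfunctors are open immersions. -/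
def PointsEquiv.HasOpenCharts {Y : Scheme.{u}} (η : PointsEquiv E Y) : Prop :=
  ∀ (C : Subfunctor E) {A : CommRingCat.{u}} (c : E.obj A), IsOpenSub E C → IsUniversal C c →
    IsOpenImmersion ((η.equiv A).symm c)

/-- The criterion of local representability gives a scheme for `extension E`, and the Zariski sheaf
property identifies sections over `Spec R` with `E.obj R`. The open immersions are obtained for all
open subfunctors with a universal element, not only for those used in the gluing; the charts of the
smooth part need this. -/
theorem exists_pointsEquiv (hE : IsZariskiSheaf E) {ι : Type u} (C : ι → Subfunctor E)
    (hC : ∀ i, IsOpenSub E (C i)) (A : ι → CommRingCat.{u}) (c : ∀ i, E.obj (A i))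
    (hc : ∀ i, IsUniversal (C i) (c i))
    (hcov : ∀ (R : CommRingCat.{u}) [IsLocalRing R] (s : E.obj R), ∃ i, s ∈ (C i).obj R) :
    ∃ (Y : Scheme.{u}) (η : PointsEquiv E Y), η.HasOpenCharts := by
  let F : Sheaf Scheme.zariskiTopology.{u} (Type u) :=
    ⟨extension E, (isSheaf_iff_isSheaf_of_type _ _).2 (extension_isSheaf E)⟩
  let φ (A : CommRingCat.{u}) (c : E.obj A) : yoneda.obj (Spec A) ⟶ extension E :=
    yonedaEquiv.symm (induced E (𝟙 (Spec A)) c)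
  have hφ : ∀ (A : CommRingCat.{u}) (c : E.obj A) {X : Scheme.{u}} (h : X ⟶ Spec A),
      (φ A c).app (op X) h = induced E h c := by
    intro A c X h
    change (induced E (𝟙 (Spec A)) c).pullback h = _
    rw [pullback_induced, Category.comp_id]
  have hφo : ∀ (C : Subfunctor E) (A : CommRingCat.{u}) (c : E.obj A), IsOpenSub E C →
      IsUniversal C c → MorphismProperty.presheaf @IsOpenImmersion (φ A c) :=
    fun C A c hC hc => hc.isOpenImmersion_presheaf hC _ (hφ A c)
  let f (i : ι) : yoneda.obj (Spec (A i)) ⟶ F.1 := φ (A i) (c i)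
  have hf : ∀ i, MorphismProperty.presheaf @IsOpenImmersion (f i) := fun i =>
    hφo _ _ _ (hC i) (hc i)
  have hsurj : Presheaf.IsLocallySurjective Scheme.zariskiTopology (Sigma.desc f) := by
    constructor
    intro X s
    change LocSection E X at s
    -- The loci of the `C i` cover `X` because stalks are local rings, where `hcov` applies.
    let U : ι → X.Opens := fun i => (hC i).locus s
    let 𝓤 : X.OpenCover := X.openCoverOfIsOpenCover U (.mk (top_unique fun x _ => by
      obtain ⟨i, hi⟩ := hcov _ (s.1 x)
      exact TopologicalSpace.Opens.mem_iSup.2 ⟨i, hi⟩))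
    refine GrothendieckTopology.superset_covering _ ?_ 𝓤.mem_grothendieckTopology
    rw [Sieve.generate_le_iff]
    rintro _ _ ⟨i⟩
    obtain ⟨h, hh⟩ := (hc i).exists_induced_eq (hC i) (s.pullback (U i).ι)
      (fun x => (C i).map _ x.2)
    refine ⟨(Sigma.ι (fun i => yoneda.obj (Spec (A i))) i).app (op (U i)) h, ?_⟩
    have h1 : (Sigma.ι (fun i => yoneda.obj (Spec (A i))) i) ≫ Sigma.desc f = f i :=
      Sigma.ι_desc f i
    exact (congrArg (fun g => g.app (op (U i : Scheme.{u})) h) h1).trans ((hφ _ _ h).trans hh)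
  let Y := (Scheme.LocalRepresentability.glueData hf).glued
  let ρ : (extension E).RepresentableBy Y := Scheme.LocalRepresentability.representableBy hf
  let I (R : CommRingCat.{u}) : E.obj R ≃ LocSection E (Spec R) :=
    Equiv.ofBijective (induced E (𝟙 (Spec R)))
      ⟨fun _ _ h => hE.induced_injective h, fun s => hE.exists_induced_eq s⟩
  have hI : ∀ {R T : CommRingCat.{u}} (f : R ⟶ T) (s : LocSection E (Spec R)),
      s.pullback (Spec.map f) = induced E (𝟙 (Spec T)) (E.map f ((I R).symm s)) := by
    intro R T f s
    obtain ⟨t, rfl⟩ := (I R).surjective s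
    rw [Equiv.symm_apply_apply, ← induced_comp_specMap, Category.id_comp]
    exact (pullback_induced E _ _ _).trans (congrArg (fun g => induced E g t) (Category.comp_id _))
  let η : PointsEquiv E Y :=
    { equiv := fun R => (ρ.homEquiv (X := Spec R)).trans (I R).symm
      naturality := fun {R T} f g => by
        refine (I T).injective ?_
        refine ((I T).apply_symm_apply _).trans ((ρ.homEquiv_comp _ _).trans ?_)
        exact hI f _ }
  refine ⟨Y, η, fun C A c hC hc => ?_⟩
  refine MorphismProperty.of_relative_map (F := yoneda) ?_
  have h1 : yoneda.map ((η.equiv A).symm c) ≫ ρ.toIso.hom = φ A c := by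
    refine yonedaEquiv.injective ?_
    rw [yonedaEquiv_comp, yonedaEquiv_yoneda_map]
    refine Eq.trans ?_ (yonedaEquiv.apply_symm_apply _).symm
    exact ρ.homEquiv.apply_symm_apply _
  have h2 := hφo C A c hC hc
  rw [← h1] at h2
  exact (MorphismProperty.cancel_right_of_respectsIso _ _ _).1 h2

/-- A natural family of bijections on affine points is induced by an isomorphism. -/
theorem PointsEquiv.exists_iso {Y Y' : Scheme.{u}} (η : PointsEquiv E Y) (η' : PointsEquiv E Y') :
    ∃ e : Y ≅ Y', ∀ (R : CommRingCat.{u}) (g : Spec R ⟶ Y), η'.equiv R (g ≫ e.hom) =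
        η.equiv R g := by
  have key : ∀ {Y Y' : Scheme.{u}} (η : PointsEquiv E Y) (η' : PointsEquiv E Y'),
      ∃ π : Y ⟶ Y', ∀ (R : CommRingCat.{u}) (g : Spec R ⟶ Y), η'.equiv R (g ≫ π) = η.equiv R g := by
    intro Y Y' η η'
    obtain ⟨π, hπ⟩ := exists_hom_of_affine (fun R g => (η'.equiv R).symm (η.equiv R g))
      (fun {R T} f g => (η'.equiv T).injective (by
        rw [η'.naturality, Equiv.apply_symm_apply, Equiv.apply_symm_apply, η.naturality]))
    exact ⟨π, fun R g => by rw [hπ, Equiv.apply_symm_apply]⟩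
  obtain ⟨π, hπ⟩ := key η η'
  obtain ⟨π', hπ'⟩ := key η' η
  refine ⟨⟨π, π', hom_ext_of_affine fun R e => (η.equiv R).injective ?_,
    hom_ext_of_affine fun R e => (η'.equiv R).injective ?_⟩, hπ⟩
  · rw [← Category.assoc, hπ', hπ, Category.comp_id]
  · rw [← Category.assoc, hπ, hπ', Category.comp_id]

theorem PointsEquiv.HasOpenCharts.of_pointsEquiv {Y Y' : Scheme.{u}} {η : PointsEquiv E Y}
    (h : η.HasOpenCharts) (η' : PointsEquiv E Y') : η'.HasOpenCharts := by
  intro C A c hC hc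
  obtain ⟨e, he⟩ := η.exists_iso η'
  have h1 : (η'.equiv A).symm c = (η.equiv A).symm c ≫ e.hom := by
    rw [Equiv.symm_apply_eq, he, Equiv.apply_symm_apply]
  have := h C c hC hc
  rw [h1]
  infer_instance

end RingFunctor

/-! ## Functors on algebras -/

namespace AlgFunctor

open Opposite Limits RingFunctor

variable {K : Type u} [Field K]

/-- The localization map `R ⟶ R_f` of `K`-algebras. -/
abbrev toAway {R : CommAlgCat.{u} K} (f : R) : R ⟶ CommAlgCat.of K (Localization.Away f) :=
  CommAlgCat.ofHom (IsScalarTower.toAlgHom K R (Localization.Away f))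

variable (F : CommAlgCat.{u} K ⥤ Type u)

/-- Zariski sheaves on algebras whose elements are determined by their images in local rings. -/
structure IsZariskiSheaf : Prop where
  sep : ∀ {R : CommAlgCat.{u} K} (s t : F.obj R), (∀ (T : CommAlgCat.{u} K) [IsLocalRing T]
    (f : R ⟶ T), F.map f s = F.map f t) → s = t
  glue : ∀ {R : CommAlgCat.{u} K} {ι : Type u} [Finite ι] (f : ι → R),
    Ideal.span (Set.range f) = ⊤ → ∀ t : ∀ i, F.obj (.of K (Localization.Away (f i))),
    (∀ (i j : ι) (T : CommAlgCat.{u} K) (a : .of K (Localization.Away (f i)) ⟶ T)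
      (b : .of K (Localization.Away (f j)) ⟶ T), toAway (f i) ≫ a = toAway (f j) ≫ b →
      F.map a (t i) = F.map b (t j)) → ∃ s, ∀ i, F.map (toAway (f i)) s = t i

/-- Open subfunctors of functors on algebras. -/
def IsOpenSub (C : Subfunctor F) : Prop :=
  ∀ (R : CommAlgCat.{u} K) (s : F.obj R), ∃ I : Ideal R, ∀ (T : CommAlgCat.{u} K) (f : R ⟶ T),
    F.map f s ∈ C.obj T ↔ I.map f.hom.toRingHom = ⊤

variable {F} in
/-- `c` is a universal element of the subfunctor `C`. -/
structure IsUniversal (C : Subfunctor F) {A : CommAlgCat.{u} K} (c : F.obj A) : Prop where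
  mem : c ∈ C.obj A
  exists_map_eq : ∀ {T : CommAlgCat.{u} K} (s : F.obj T), s ∈ C.obj T →
    ∃ f : A ⟶ T, F.map f c = s
  injective : ∀ {T : CommAlgCat.{u} K} {f g : A ⟶ T}, F.map f c = F.map g c → f = g

/-- The ring `R` as an algebra through `a : K → R`. -/
abbrev algOf (R : CommRingCat.{u}) (a : K →+* R) : CommAlgCat.{u} K :=
  letI := a.toAlgebra
  CommAlgCat.of K R

/-- A homomorphism of algebras from a ring homomorphism compatible with the structure maps. -/
def mkHom {R T : CommAlgCat.{u} K} (f : R →+* T)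
    (h : ∀ x, f (algebraMap K R x) = algebraMap K T x) : R ⟶ T :=
  CommAlgCat.ofHom { f with commutes' := h }

/-- A ring homomorphism `R ⟶ T` as a homomorphism of algebras. -/
def homOf {R T : CommRingCat.{u}} (f : R ⟶ T) (a : K →+* R) :
    algOf R a ⟶ algOf T (f.hom.comp a) :=
  mkHom (R := algOf R a) (T := algOf T (f.hom.comp a)) f.hom fun _ => rfl

/-- The functor on rings with a homomorphism from `K` given by a functor on `K`-algebras. -/
def total : CommRingCat.{u} ⥤ Type u where
  obj R := Σ a : K →+* R, F.obj (algOf R a)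
  map f := ↾fun s => ⟨f.hom.comp s.1, F.map (homOf f s.1) s.2⟩
  map_id R := ConcreteCategory.hom_ext _ _ fun s =>
    congrArg (fun t => (⟨s.1, t⟩ : Σ a : K →+* R, F.obj (algOf R a)))
      (congrArg (fun g => g s.2) (F.map_id (algOf R s.1)))
  map_comp {_ _ T} f g := ConcreteCategory.hom_ext _ _ fun s =>
    congrArg (fun t => (⟨g.hom.comp (f.hom.comp s.1), t⟩ : Σ a : K →+* T, F.obj (algOf T a)))
      (congrArg (fun h => h s.2) (F.map_comp (homOf f s.1) (homOf g (f.hom.comp s.1))))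

variable {F}

/-- The underlying ring of a `K`-algebra. -/
abbrev ringOf (R : CommAlgCat.{u} K) : CommRingCat.{u} := CommRingCat.of R

/-- The identity from `R` with an algebra structure that agrees with the given one. -/
def toAlg {R : CommAlgCat.{u} K} {a : K →+* R} (h : a = algebraMap K R) :
    algOf (ringOf R) a ⟶ R :=
  mkHom (R := algOf (ringOf R) a) (RingHom.id R) fun x => congrArg (fun g => g x) h

/-- The identity to `R` with an algebra structure that agrees with the given one. -/
def ofAlg {R : CommAlgCat.{u} K} {a : K →+* R} (h : a = algebraMap K R) :
    R ⟶ algOf (ringOf R) a :=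
  mkHom (T := algOf (ringOf R) a) (RingHom.id R) fun x => congrArg (fun g => g x) h.symm

theorem map_toAlg_ofAlg {R : CommAlgCat.{u} K} {a : K →+* R} (h : a = algebraMap K R)
    (s : F.obj R) : F.map (toAlg h) (F.map (ofAlg h) s) = s := by
  rw [← Functor.map_comp_apply]
  exact (congrArg (fun g => g s) (F.map_id R) : F.map (𝟙 R) s = s)

theorem map_ofAlg_toAlg {R : CommAlgCat.{u} K} {a : K →+* R} (h : a = algebraMap K R)
    (s : F.obj (algOf (ringOf R) a)) : F.map (ofAlg h) (F.map (toAlg h) s) = s := by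
  rw [← Functor.map_comp_apply]
  exact (congrArg (fun g => g s) (F.map_id (algOf (ringOf R) a)) : F.map (𝟙 _) s = s)

variable (F) in
/-- The element of the total functor given by an element over a `K`-algebra. -/
def toTotal {R : CommAlgCat.{u} K} (s : F.obj R) : (total F).obj (ringOf R) :=
  ⟨algebraMap K R, F.map (ofAlg rfl) s⟩

/-- A homomorphism of algebras as a homomorphism of rings. -/
abbrev ringHomOf {R T : CommAlgCat.{u} K} (f : R ⟶ T) : ringOf R ⟶ ringOf T :=
  CommRingCat.ofHom f.hom.toRingHom

/-- When a structure map is only propositionally equal to the given one, the identity maps `toAlg`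
and `ofAlg` take the place of casts between the fibres of `total`. -/
theorem total_eq_toTotal {R : CommAlgCat.{u} K} (e : (total F).obj (ringOf R))
    (h : e.1 = algebraMap K R) : e = toTotal F (F.map (toAlg h) e.2) := by
  obtain ⟨a, s⟩ := e
  dsimp at h
  subst h
  exact Sigma.ext rfl (heq_of_eq (map_ofAlg_toAlg _ _).symm)

theorem toTotal_injective {R : CommAlgCat.{u} K} {s t : F.obj R} (h : toTotal F s = toTotal F t) :
    s = t := by
  have h1 := eq_of_heq (Sigma.mk.inj h).2
  rw [← map_toAlg_ofAlg rfl s, h1, map_toAlg_ofAlg]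

theorem toTotal_map {R T : CommAlgCat.{u} K} (f : R ⟶ T) (s : F.obj R) :
    (total F).map (ringHomOf f) (toTotal F s) = toTotal F (F.map f s) := by
  have h : f.hom.toRingHom.comp (algebraMap K R) = algebraMap K T := f.hom.comp_algebraMap
  rw [total_eq_toTotal ((total F).map (ringHomOf f) (toTotal F s)) h]
  congr 1
  change F.map (toAlg h) (F.map (homOf (ringHomOf f) (algebraMap K R)) (F.map (ofAlg rfl) s)) = _
  rw [← Functor.map_comp_apply, ← Functor.map_comp_apply]
  rfl

/-- Every element of the total functor comes from an algebra structure. -/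
theorem total_induction {P : ∀ {R : CommRingCat.{u}}, (total F).obj R → Prop}
    (h : ∀ (R : CommAlgCat.{u} K) (s : F.obj R), P (toTotal F s)) {R : CommRingCat.{u}}
    (e : (total F).obj R) : P e := by
  have h1 : e = (toTotal F (F.map (toAlg rfl) e.2) : (total F).obj (ringOf (algOf R e.1))) :=
    total_eq_toTotal (R := algOf R e.1) e rfl
  rw [h1]
  exact h (algOf R e.1) _

/-- A ring homomorphism out of an algebra is a homomorphism of algebras for a suitable structure
on the target. -/
theorem hom_induction {R : CommAlgCat.{u} K}
    {P : ∀ {T : CommRingCat.{u}}, (ringOf R ⟶ T) → Prop}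
    (h : ∀ (T : CommAlgCat.{u} K) (f : R ⟶ T), P (ringHomOf f)) {T : CommRingCat.{u}}
    (f : ringOf R ⟶ T) : P f :=
  h (algOf T (f.hom.comp (algebraMap K R)))
    (mkHom (T := algOf T (f.hom.comp (algebraMap K R))) f.hom fun _ => rfl)

/-- A subfunctor as a subfunctor of the total functor. -/
def totalSub (C : Subfunctor F) : Subfunctor (total F) where
  obj _ := {e | e.2 ∈ C.obj _}
  map f _ he := C.map (homOf f _) he

theorem toTotal_mem {C : Subfunctor F} {R : CommAlgCat.{u} K} {s : F.obj R} :
    toTotal F s ∈ (totalSub C).obj (ringOf R) ↔ s ∈ C.obj R := by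
  refine ⟨fun h => ?_, fun h => C.map _ h⟩
  rw [← map_toAlg_ofAlg (F := F) (R := R) rfl s]
  exact C.map _ h

theorem IsOpenSub.total {C : Subfunctor F} (hC : IsOpenSub F C) :
    RingFunctor.IsOpenSub (total F) (totalSub C) := by
  intro R e
  induction e using total_induction with
  | h R s =>
    obtain ⟨I, hI⟩ := hC R s
    refine ⟨I, fun T f => ?_⟩
    induction f using hom_induction with
    | h T f => rw [toTotal_map, toTotal_mem, hI]; rfl

theorem IsUniversal.total {C : Subfunctor F} {A : CommAlgCat.{u} K} {c : F.obj A}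
    (hc : IsUniversal C c) : RingFunctor.IsUniversal (totalSub C) (toTotal F c) where
  mem := toTotal_mem.2 hc.mem
  exists_map_eq s hs := by
    induction s using total_induction with
    | h R s =>
      obtain ⟨f, hf⟩ := hc.exists_map_eq s (toTotal_mem.1 hs)
      exact ⟨ringHomOf f, by rw [toTotal_map, hf]⟩
  injective {T f g} h := by
    revert g
    induction f using hom_induction with
    | h T f =>
      intro g h
      -- An equality in the total functor includes an equality of structure maps, so `g` is itself a
      -- homomorphism of `K`-algebras.
      have hg : g.hom.comp (algebraMap K A) = algebraMap K T :=
        (congrArg Sigma.fst h).symm.trans f.hom.comp_algebraMap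
      let g' : A ⟶ T := mkHom g.hom fun x => congrArg (fun a => a x) hg
      have h' : (AlgFunctor.total F).map (ringHomOf g') (toTotal F c) =
        (AlgFunctor.total F).map (ringHomOf f) (toTotal F c) := h.symm
      rw [toTotal_map, toTotal_map] at h'
      have := hc.injective (toTotal_injective h')
      exact congrArg ringHomOf this.symm

theorem eq_of_forall_isLocalRing {R : Type u} [CommRing R] {x y : R}
    (h : ∀ (T : CommRingCat.{u}) [IsLocalRing T] (f : R →+* T), f x = f y) : x = y := by
  refine MaximalSpectrum.toPiLocalization_injective R (funext fun m => ?_)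
  exact h (.of (Localization.AtPrime m.asIdeal)) (algebraMap _ _)

/-- The structure sheaf of `Spec R` is a sheaf, so images of single elements glue; the ring laws
hold because they hold in every localization. -/
theorem exists_ringHom_glue {R A : Type u} [CommRing R] [CommRing A] {ι : Type u} (f : ι → R)
    (hf : Ideal.span (Set.range f) = ⊤) (y : ∀ i, A →+* Localization.Away (f i))
    (h : ∀ (i j : ι) (T : Type u) [CommRing T] (a : Localization.Away (f i) →+* T)
      (b : Localization.Away (f j) →+* T), a.comp (algebraMap R _) = b.comp (algebraMap R _) →
      a.comp (y i) = b.comp (y j)) :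
    ∃ a : A →+* R, ∀ i, y i = (algebraMap R (Localization.Away (f i))).comp a := by
  -- The gluing of elements is indexed by the set of values of `f`: `idx` picks an index for each
  -- value, and `l` identifies the two localizations.
  choose idx hidx using fun r : Set.range f => r.2
  let l (r : Set.range f) : Localization.Away (f (idx r)) →+* Localization.Away r.1 :=
    IsLocalization.Away.lift (f (idx r)) (g := algebraMap R (Localization.Away r.1)) (by
      rw [hidx]
      exact IsLocalization.Away.algebraMap_isUnit r.1)
  have hl : ∀ r, (l r).comp (algebraMap R _) = algebraMap R _ := fun r =>
    IsLocalization.Away.lift_comp _ _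
  have hR : ∀ u v : R, (IsLocalization.Away.awayToAwayRight (S := Localization.Away u)
      (P := Localization.Away (u * v)) u v).comp (algebraMap R _) = algebraMap R _ := fun u v =>
    IsLocalization.Away.lift_comp _ _
  have hL : ∀ u v : R, (IsLocalization.Away.awayToAwayLeft (S := Localization.Away v)
      (P := Localization.Away (u * v)) v u).comp (algebraMap R _) = algebraMap R _ := fun u v =>
    IsLocalization.Away.lift_comp _ _
  have inj := Localization.algebraMap_injective_of_span_eq_top _ hf
  have key : ∀ x : A, ∃ r : R, ∀ i, algebraMap R (Localization.Away (f i)) r = y i x := by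
    intro x
    obtain ⟨r, hr, -⟩ := Localization.existsUnique_algebraMap_eq_of_span_eq_top _ hf
      (fun r => l r (y (idx r) x)) (fun a b => by
        refine RingHom.congr_fun (h (idx a) (idx b) _
            ((IsLocalization.Away.awayToAwayRight a.1 b.1).comp (l a))
          ((IsLocalization.Away.awayToAwayLeft b.1 a.1).comp (l b)) ?_) x
        rw [RingHom.comp_assoc, RingHom.comp_assoc, hl, hl, hR, hL])
    refine ⟨r, fun i => ?_⟩
    rw [hr ⟨f i, i, rfl⟩]
    exact RingHom.congr_fun (h _ i _ (l ⟨f i, i, rfl⟩) (RingHom.id _) (by rw [hl,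
        RingHom.id_comp])) x
  choose a ha using key
  have inj' : ∀ r s : R, (∀ i, algebraMap R (Localization.Away (f i)) r =
      algebraMap R _ s) → r = s := by
    intro r s hrs
    refine inj (funext ?_)
    rintro ⟨_, i, rfl⟩
    exact hrs i
  refine ⟨⟨⟨⟨a, inj' _ _ fun i => ?_⟩, fun u v => inj' _ _ fun i => ?_⟩, inj' _ _ fun i => ?_,
    fun u v => inj' _ _ fun i => ?_⟩, fun i => RingHom.ext fun x => (ha x i).symm⟩
  all_goals simp [ha]

theorem IsZariskiSheaf.total_glue (hF : IsZariskiSheaf F) {R : CommAlgCat.{u} K} {ι : Type u}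
    [Finite ι] (f : ι → R) (hf : Ideal.span (Set.range f) = ⊤)
    (t : ∀ i, (total F).obj (ringOf (.of K (Localization.Away (f i)))))
    (ha : ∀ i, (t i).1 = algebraMap K (Localization.Away (f i)))
    (h : ∀ (i j : ι) (T : CommRingCat.{u}) (a : .of (Localization.Away (f i)) ⟶ T)
      (b : .of (Localization.Away (f j)) ⟶ T),
      RingFunctor.toAway (R := ringOf R) (f i) ≫ a = RingFunctor.toAway (R := ringOf R) (f j) ≫ b →
      (total F).map a (t i) = (total F).map b (t j)) :
    ∃ s : (total F).obj (ringOf R), ∀ i, (total F).map (ringHomOf (toAway (f i))) s = t i := by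
  obtain ⟨s, hs⟩ := hF.glue f hf
    (fun i => F.map (toAlg (R := .of K (Localization.Away (f i))) (ha i)) (t i).2)
    (fun i j T' b c hbc => toTotal_injective (by
      rw [← toTotal_map b, ← toTotal_map c]
      have h2 := h i j (ringOf T') (ringHomOf b) (ringHomOf c) (congrArg ringHomOf hbc)
      rw [total_eq_toTotal (R := .of K (Localization.Away (f i))) (t i) (ha i),
        total_eq_toTotal (R := .of K (Localization.Away (f j))) (t j) (ha j)] at h2
      exact h2))
  refine ⟨toTotal F s, fun i => ?_⟩
  rw [toTotal_map, hs]
  exact (total_eq_toTotal (R := .of K (Localization.Away (f i))) (t i) (ha i)).symm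

/-- The structure maps are compared, respectively glued, first; this makes `R` a `K`-algebra, over
which the hypothesis on `F` applies. -/
theorem IsZariskiSheaf.total (hF : IsZariskiSheaf F) : RingFunctor.IsZariskiSheaf (total F) where
  sep {R} s t h := by
    induction s using total_induction with
    | h R s =>
      have h1 : t.1 = algebraMap K R := RingHom.ext fun x =>
        eq_of_forall_isLocalRing fun T _ f =>
          congrArg (fun e => e.1 x) (h T (CommRingCat.ofHom f)).symm
      rw [total_eq_toTotal t h1] at h ⊢
      rw [hF.sep s (F.map (toAlg h1) t.2) fun T _ f => toTotal_injective (by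
        rw [← toTotal_map, ← toTotal_map, h])]
  glue {R ι _} f hf t h := by
    obtain ⟨a, ha⟩ := exists_ringHom_glue f hf (fun i => (t i).1) fun i j T _ b c hbc =>
      congrArg Sigma.fst (h i j (.of T) (CommRingCat.ofHom b) (CommRingCat.ofHom c)
        (congrArg CommRingCat.ofHom hbc))
    exact hF.total_glue (R := algOf R a) f hf t ha h

end AlgFunctor

/-! ### Representing schemes over `Spec K` -/

namespace AlgFunctor

open Opposite Limits RingFunctor TwoSided

variable {K : Type u} [Field K] {F : CommAlgCat.{u} K ⥤ Type u}

theorem toTotal_algOf {R : CommRingCat.{u}} (a : K →+* R) (s : F.obj (algOf R a)) :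
    toTotal F s = (⟨a, s⟩ : (total F).obj R) :=
  congrArg (fun t => (⟨a, t⟩ : (total F).obj R)) (congrArg (fun g => g s) (F.map_id (algOf R a)))

/-- The structure maps of the elements form a natural family and so define a morphism from `Y` to
`Spec K`. A morphism `Spec R ⟶ Y` lies over `Spec K` exactly when its structure map is that of `R`,
and such morphisms correspond to elements of `F.obj R`. -/
theorem exists_represents_of_pointsEquiv {Y : Scheme.{u}} (η : PointsEquiv (total F) Y) :
    ∃ Y' : Over (Spec (CommRingCat.of K)), Represents Y' F := by
  obtain ⟨π, hπ⟩ := exists_hom_of_affine (X := Y) (Y := Spec (CommRingCat.of K))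
    (fun R g => Spec.map (CommRingCat.ofHom (η.equiv R g).1)) (fun {R T} f g => by
      rw [η.naturality, ← Spec.map_comp]
      rfl)
  have hfst : ∀ {R : CommRingCat.{u}} (g : Spec R ⟶ Y) (a : K →+* R),
      g ≫ π = Spec.map (CommRingCat.ofHom a) ↔ (η.equiv R g).1 = a := by
    intro R g a
    rw [hπ, Spec.map_inj]
    exact ⟨fun h => congrArg CommRingCat.Hom.hom h, fun h => congrArg CommRingCat.ofHom h⟩
  let Y' : Over (Spec (CommRingCat.of K)) := Over.mk π
  let Q (R : CommAlgCat.{u} K) := (algSpec (CommRingCat.of K)).obj (op R) ⟶ Y'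
  let l {R : CommAlgCat.{u} K} (p : Q R) : Spec (ringOf R) ⟶ Y := p.left
  have hp : ∀ {R : CommAlgCat.{u} K} (p : Q R),
      (η.equiv (ringOf R) (l p)).1 = algebraMap K R :=
    fun p => (hfst _ _).1 (Over.w p)
  let e {R : CommAlgCat.{u} K} (p : Q R) : F.obj R :=
    F.map (toAlg (hp p)) (η.equiv (ringOf R) (l p)).2
  have he : ∀ {R : CommAlgCat.{u} K} (p : Q R), toTotal F (e p) = η.equiv (ringOf R) (l p) :=
    fun p => (total_eq_toTotal _ (hp p)).symm
  have hbij : ∀ R : CommAlgCat.{u} K, Function.Bijective (e (R := R)) := by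
    refine fun R => ⟨fun p q h => ?_, fun s => ?_⟩
    · refine Over.OverMorphism.ext ((η.equiv (ringOf R)).injective ?_)
      exact (he p).symm.trans ((congrArg (toTotal F) h).trans (he q))
    · have h1 : (η.equiv (ringOf R)).symm (toTotal F s) ≫ π =
          Spec.map (CommRingCat.ofHom (algebraMap K R)) := by
        rw [hfst, Equiv.apply_symm_apply]
        rfl
      let p : Q R := Over.homMk ((η.equiv (ringOf R)).symm (toTotal F s)) h1
      refine ⟨p, toTotal_injective ((he p).trans ?_)⟩
      exact (η.equiv (ringOf R)).apply_symm_apply _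
  refine ⟨Y', ⟨NatIso.ofComponents (fun R => (Equiv.ofBijective e (hbij R)).toIso) ?_⟩⟩
  intro R T f
  refine ConcreteCategory.hom_ext _ _ fun (p : Q R) => ?_
  change e (show Q T from (algSpec (CommRingCat.of K)).map f.op ≫ p) = F.map f (e p)
  refine toTotal_injective ((he _).trans ?_)
  rw [← toTotal_map, he]
  exact η.naturality (ringHomOf f) (l p)

section

variable {Y : Over (Spec (CommRingCat.of K))} (Φ : functorOfPoints Y ≅ F)

/-- The morphism `Spec R ⟶ Y` given by an element of a functor represented by `Y`. -/
def pointOf {R : CommAlgCat.{u} K} (s : F.obj R) :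
    (algSpec (CommRingCat.of K)).obj (op R) ⟶ Y :=
  Φ.inv.app R s

/-- The element given by a point of `Y`. -/
def elementOf {R : CommAlgCat.{u} K} (p : (algSpec (CommRingCat.of K)).obj (op R) ⟶ Y) : F.obj R :=
  Φ.hom.app R p

theorem elementOf_pointOf {R : CommAlgCat.{u} K} (s : F.obj R) : elementOf Φ (pointOf Φ s) = s :=
  congrArg (fun g => g s) (Φ.inv_hom_id_app R)

theorem pointOf_elementOf {R : CommAlgCat.{u} K} (p : (algSpec (CommRingCat.of K)).obj (op R) ⟶ Y) :
    pointOf Φ (elementOf Φ p) = p :=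
  congrArg (fun g => g p) (Φ.hom_inv_id_app R)

theorem pointOf_map {R T : CommAlgCat.{u} K} (f : R ⟶ T) (s : F.obj R) :
    pointOf Φ (F.map f s) = (algSpec (CommRingCat.of K)).map f.op ≫ pointOf Φ s :=
  congrArg (fun g => g s) (Φ.inv.naturality f)

theorem elementOf_map {R T : CommAlgCat.{u} K} (f : R ⟶ T)
    (p : (algSpec (CommRingCat.of K)).obj (op R) ⟶ Y) :
    elementOf Φ ((algSpec (CommRingCat.of K)).map f.op ≫ p) = F.map f (elementOf Φ p) :=
  congrArg (fun g => g p) (Φ.hom.naturality f)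

theorem pointOf_map_left {R T : CommAlgCat.{u} K} (f : R ⟶ T) (s : F.obj R) :
    (pointOf Φ (F.map f s)).left = Spec.map (ringHomOf f) ≫ (pointOf Φ s).left := by
  rw [pointOf_map]
  rfl

/-- The structure homomorphism of a morphism `Spec R ⟶ Y`. -/
def structHom {R : CommRingCat.{u}} (g : Spec R ⟶ Y.left) : K →+* R :=
  (Spec.preimage (g ≫ Y.hom)).hom

/-- A morphism `Spec R ⟶ Y` as a morphism over `Spec K`. -/
def overPoint {R : CommRingCat.{u}} (g : Spec R ⟶ Y.left) :
    (algSpec (CommRingCat.of K)).obj (op (algOf R (structHom g))) ⟶ Y :=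
  Over.homMk g (Spec.map_preimage _).symm

/-- The element of the total functor given by a morphism `Spec R ⟶ Y`. -/
def totalElement {R : CommRingCat.{u}} (g : Spec R ⟶ Y.left) : (total F).obj R :=
  ⟨structHom g, elementOf Φ (overPoint g)⟩

theorem totalElement_left {R : CommAlgCat.{u} K}
    (p : (algSpec (CommRingCat.of K)).obj (op R) ⟶ Y) :
    totalElement Φ (R := ringOf R) p.left = toTotal F (elementOf Φ p) := by
  have h : structHom (R := ringOf R) p.left = algebraMap K R := by
    have : p.left ≫ Y.hom = Spec.map (CommRingCat.ofHom (algebraMap K R)) := Over.w p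
    exact congrArg CommRingCat.Hom.hom ((congrArg Spec.preimage this).trans (Spec.preimage_map _))
  rw [total_eq_toTotal (totalElement Φ (R := ringOf R) p.left) h]
  congr 1
  refine (elementOf_map Φ (toAlg h) _).symm.trans (congrArg (elementOf Φ) ?_)
  refine Over.OverMorphism.ext ?_
  refine (congrArg (fun g => g ≫ p.left) (Spec.map_id (ringOf R))).trans ?_
  exact Category.id_comp (X := Spec (ringOf R)) p.left

/-- A scheme representing `F` represents the total functor. -/
def pointsEquiv : PointsEquiv (total F) Y.left where
  equiv R :=
    { toFun := totalElement Φ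
      invFun := fun e => (pointOf Φ e.2).left
      left_inv := fun g => by
        change (pointOf Φ (elementOf Φ (overPoint g))).left = g
        rw [pointOf_elementOf]
        rfl
      right_inv := fun e => by
        refine (totalElement_left Φ (R := algOf R e.1) (pointOf Φ e.2)).trans ?_
        rw [elementOf_pointOf]
        exact toTotal_algOf e.1 e.2 }
  naturality {R T} f g := by
    have h1 := totalElement_left Φ
      ((algSpec (CommRingCat.of K)).map (homOf f (structHom g)).op ≫ overPoint g)
    refine h1.trans ?_
    rw [elementOf_map]
    exact toTotal_algOf (F := F) (f.hom.comp (structHom g)) _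

theorem pointsEquiv_symm_toTotal {R : CommAlgCat.{u} K} (s : F.obj R) :
    ((pointsEquiv Φ).equiv (ringOf R)).symm (toTotal F s) = (pointOf Φ s).left := by
  refine (Equiv.symm_apply_eq _).2 (Eq.trans ?_ (totalElement_left Φ (pointOf Φ s)).symm)
  rw [elementOf_pointOf]

end

/-- The second assertion concerns an arbitrary representing scheme: any two are isomorphic
compatibly with their points, so open immersions can be transported from the glued scheme. -/
theorem exists_represents (hF : IsZariskiSheaf F) {ι : Type u} (C : ι → Subfunctor F)
    (hC : ∀ i, IsOpenSub F (C i)) (A : ι → CommAlgCat.{u} K) (c : ∀ i, F.obj (A i))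
    (hc : ∀ i, IsUniversal (C i) (c i))
    (hcov : ∀ (R : CommAlgCat.{u} K) [IsLocalRing R] (s : F.obj R), ∃ i, s ∈ (C i).obj R) :
    (∃ Y, Represents Y F) ∧
    ∀ {Y : Over (Spec (CommRingCat.of K))} (Φ : functorOfPoints Y ≅ F) (D : Subfunctor F)
      {B : CommAlgCat.{u} K} (d : F.obj B), IsOpenSub F D → IsUniversal D d →
      IsOpenImmersion (pointOf Φ d).left := by
  obtain ⟨Y₀, η, hη⟩ := exists_pointsEquiv hF.total (fun i => totalSub (C i))
    (fun i => (hC i).total) (fun i => ringOf (A i)) (fun i => toTotal F (c i))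
    (fun i => (hc i).total) (fun R _ e => hcov (algOf R e.1) e.2)
  refine ⟨exists_represents_of_pointsEquiv η, fun {Y} Φ D B d hD hd => ?_⟩
  have h1 := hη.of_pointsEquiv (pointsEquiv Φ) (totalSub D) (toTotal F d) hD.total hd.total
  rwa [pointsEquiv_symm_toTotal] at h1

end AlgFunctor

/-! ### Dimension, irreducibility and smoothness of a union of affine spaces -/

/-- The dimension is the supremum of the coheights of irreducible closed sets. Coheight is local:
every irreducible closed set that contains `W` meets each open set that `W` meets. -/
theorem topologicalKrullDim_eq_of_isOpenEmbedding {X : Type u} [TopologicalSpace X] {ι : Type v}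
    [Nonempty ι] {Z : ι → Type w} [∀ i, TopologicalSpace (Z i)] (f : ∀ i, Z i → X)
    (hf : ∀ i, Topology.IsOpenEmbedding (f i)) (hcov : ∀ x, ∃ i, x ∈ Set.range (f i))
    {d : WithBot ℕ∞} (hd : ∀ i, topologicalKrullDim (Z i) = d) : topologicalKrullDim X = d := by
  refine le_antisymm ?_ ?_
  · rw [topologicalKrullDim, Order.krullDim_eq_iSup_coheight]
    refine iSup_le fun W => ?_
    obtain ⟨x, hx⟩ := W.isIrreducible.nonempty
    obtain ⟨i, z, rfl⟩ := hcov x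
    let e := TopologicalSpace.IrreducibleCloseds.orderIsoOfIsOpenEmbedding (f i) (hf i)
    let W' := e.symm ⟨W, z, hx⟩
    have hW : TopologicalSpace.IrreducibleCloseds.map (f i) (hf i).continuous W' = W :=
      congrArg Subtype.val (e.apply_symm_apply ⟨W, z, hx⟩)
    rw [← hW, (hf i).coheight_map, ← hd i, topologicalKrullDim, Order.krullDim_eq_iSup_coheight]
    exact le_iSup (fun a => ((Order.coheight a : ℕ∞) : WithBot ℕ∞)) W'
  · let i := Classical.arbitrary ι
    rw [← hd i]
    exact (hf i).isInducing.topologicalKrullDim_le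

/-- Any two charts meet, in `x₀`. A nonempty open subset of one chart therefore meets the other, and
irreducibility of the latter finishes. -/
theorem irreducibleSpace_of_isOpenEmbedding {X : Type u} [TopologicalSpace X] {ι : Type v}
    {Z : ι → Type w} [∀ i, TopologicalSpace (Z i)] [∀ i, IrreducibleSpace (Z i)]
    (f : ∀ i, Z i → X)
    (hf : ∀ i, Topology.IsOpenEmbedding (f i)) (hcov : ∀ x, ∃ i, x ∈ Set.range (f i))
    {x₀ : X} (hx₀ : ∀ i, x₀ ∈ Set.range (f i)) : IrreducibleSpace X := by
  have hirr : ∀ i, IsPreirreducible (Set.range (f i)) := fun i => by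
    rw [← Set.image_univ]
    exact (PreirreducibleSpace.isPreirreducible_univ).image _ (hf i).continuous.continuousOn
  refine { isPreirreducible_univ := ?_, toNonempty := ⟨x₀⟩ }
  rintro U V hU hV ⟨x, -, hx⟩ ⟨y, -, hy⟩
  obtain ⟨i, hi⟩ := hcov x
  obtain ⟨j, hj⟩ := hcov y
  obtain ⟨z, hz, hzU, hzj⟩ := hirr i U (Set.range (f j)) hU (hf j).isOpen_range ⟨x, hi, hx⟩
    ⟨x₀, hx₀ i, hx₀ j⟩
  obtain ⟨t, ht, htU, htV⟩ := hirr j U V hU hV ⟨z, hzj, hzU⟩ ⟨y, hj, hy⟩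
  exact ⟨t, trivial, htU, htV⟩

theorem MvPolynomial.topologicalKrullDim_spec (K : Type u) [Field K] (σ : Type) [Finite σ] :
    topologicalKrullDim (Spec (CommRingCat.of (MvPolynomial σ K))) = Nat.card σ := by
  refine (PrimeSpectrum.topologicalKrullDim_eq_ringKrullDim (MvPolynomial σ K)).trans ?_
  rw [MvPolynomial.ringKrullDim_of_isNoetherianRing, ringKrullDim_eq_zero_of_field, zero_add]

theorem MvPolynomial.smooth_specMap (K : Type u) [Field K] (σ : Type) [Finite σ] :
    Smooth (Spec.map (CommRingCat.ofHom (algebraMap K (MvPolynomial σ K)))) := by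
  rw [HasRingHomProperty.Spec_iff (P := @Smooth)]
  rw [CommRingCat.hom_ofHom, RingHom.smooth_algebraMap]
  exact { }

namespace AlgFunctor

open Opposite Limits RingFunctor TwoSided

variable {K : Type u} [Field K] {F : CommAlgCat.{u} K ⥤ Type u}

theorem range_pointOf_subset {Y : Over (Spec (CommRingCat.of K))} (Φ : functorOfPoints Y ≅ F)
    {D : Subfunctor F} {A R : CommAlgCat.{u} K} {d : F.obj A} (hd : IsUniversal D d) {s : F.obj R}
    (hs : s ∈ D.obj R) :
    Set.range (pointOf Φ s).left ⊆ Set.range (pointOf Φ d).left := by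
  obtain ⟨f, rfl⟩ := hd.exists_map_eq s hs
  rw [pointOf_map_left]
  rintro _ ⟨x, rfl⟩
  exact ⟨Spec.map (ringHomOf f) x, rfl⟩

theorem exists_range_subset {Y : Over (Spec (CommRingCat.of K))}
    (Φ : functorOfPoints Y ≅ F) {J : Type} (D : J → Subfunctor F) {A : CommAlgCat.{u} K}
    (d : ∀ _ : J, F.obj A) (hd : ∀ j, IsUniversal (D j) (d j))
    (hpts : ∀ s : F.obj (.of K K), ∃ j, s ∈ (D j).obj (.of K K))
    (g : Spec (CommRingCat.of K) ⟶ Y.left) (hg : g ≫ Y.hom = 𝟙 _) :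
    ∃ j, Set.range g ⊆ Set.range (pointOf Φ (d j)).left := by
  have hid : Spec.map (CommRingCat.ofHom (algebraMap K K)) = 𝟙 (Spec (CommRingCat.of K)) := by
    rw [Algebra.algebraMap_self, CommRingCat.ofHom_id, Spec.map_id]
  let p : (algSpec (CommRingCat.of K)).obj (op (.of K K)) ⟶ Y := Over.homMk g (hg.trans hid.symm)
  obtain ⟨j, hj⟩ := hpts (elementOf Φ p)
  have h := range_pointOf_subset Φ (hd j) hj
  rw [pointOf_elementOf] at h
  exact ⟨j, h⟩

/-- The open subscheme is the union of the charts. Smoothness and reducedness are local, the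
dimension can be computed in charts, and the common point `s₀` gives irreducibility. -/
theorem hasSmoothOpenCoveringPoints {Y : Over (Spec (CommRingCat.of K))}
    (Φ : functorOfPoints Y ≅ F) {σ : Type} [Finite σ] {J : Type} [Nonempty J]
    (D : J → Subfunctor F) (d : ∀ _ : J, F.obj (.of K (MvPolynomial σ K)))
    (hd : ∀ j, IsUniversal (D j) (d j)) (himm : ∀ j, IsOpenImmersion (pointOf Φ (d j)).left)
    (hpts : ∀ s : F.obj (.of K K), ∃ j, s ∈ (D j).obj (.of K K)) (s₀ : F.obj (.of K K))
    (hs₀ : ∀ j, s₀ ∈ (D j).obj (.of K K)) :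
    HasSmoothOpenCoveringPoints Y (Nat.card σ) := by
  let A : Scheme.{u} := Spec (CommRingCat.of (MvPolynomial σ K))
  let v (j : J) : A ⟶ Y.left := (pointOf Φ (d j)).left
  have hv : ∀ j, IsOpenImmersion (v j) := himm
  let U : Y.left.Opens := ⨆ j, (v j).opensRange
  have hvU : ∀ j, Set.range (v j) ⊆ (U : Set Y.left) := fun j =>
    le_iSup (fun j => (v j).opensRange) j
  let v' (j : J) : A ⟶ U := IsOpenImmersion.lift U.ι (v j) (by simpa using hvU j)
  have hfac : ∀ j, v' j ≫ U.ι = v j := fun j => IsOpenImmersion.lift_fac _ _ _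
  have hv' : ∀ j, IsOpenImmersion (v' j) := fun j => by
    have : IsOpenImmersion (v' j ≫ U.ι) := by rw [hfac]; exact hv j
    exact IsOpenImmersion.of_comp (v' j) U.ι
  have happ : ∀ j (a : A), U.ι (v' j a) = v j a := fun j a => by
    rw [← hfac j]
    rfl
  have hmem : ∀ (x : (U : Scheme.{u})) j, U.ι x ∈ Set.range (v j) → x ∈ Set.range (v' j) := by
    rintro x j ⟨a, ha⟩
    exact ⟨a, U.ι.isOpenEmbedding.injective ((happ j a).trans ha)⟩
  have hcov : ∀ x : (U : Scheme.{u}), ∃ j, x ∈ Set.range (v' j) := by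
    intro x
    obtain ⟨j, hj⟩ := TopologicalSpace.Opens.mem_iSup.1 x.2
    exact ⟨j, hmem x j hj⟩
  let 𝒰 : Scheme.OpenCover.{0} (U : Scheme.{u}) :=
    Scheme.Cover.mkOfCovers J (fun _ => A) v' hcov hv'
  have hemb : ∀ j, Topology.IsOpenEmbedding (v' j) := fun j => (v' j).isOpenEmbedding
  have hA : IsIntegral A := inferInstanceAs (IsIntegral (Spec (CommRingCat.of (MvPolynomial σ K))))
  refine ⟨U, ?_, ?_, ?_, ?_, ?_⟩
  · have hsm : ∀ j : J, Smooth (v' j ≫ U.ι ≫ Y.hom) := fun j => by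
      have : v j ≫ Y.hom = Spec.map (CommRingCat.ofHom (algebraMap K (MvPolynomial σ K))) :=
        Over.w (pointOf Φ (d j))
      rw [← Category.assoc, hfac, this]
      exact MvPolynomial.smooth_specMap K σ
    have hloc : IsZariskiLocalAtSource @Smooth.{u} :=
      HasRingHomProperty.instIsZariskiLocalAtSource (P := @Smooth.{u}) (Q := RingHom.Smooth)
    exact hloc.of_openCover 𝒰 hsm
  · have : ∀ i, IsReduced (𝒰.X i) := fun i => inferInstanceAs (IsReduced A)
    exact IsReduced.of_openCover _ 𝒰
  · let p : Spec (CommRingCat.of K) := IsLocalRing.closedPoint K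
    have hx : ∀ j, (pointOf Φ s₀).left p ∈ Set.range (v j) := fun j =>
      range_pointOf_subset Φ (hd j) (hs₀ j) ⟨p, rfl⟩
    let x₀ : (U : Scheme.{u}) := ⟨(pointOf Φ s₀).left p, hvU (Classical.arbitrary J) (hx _)⟩
    exact irreducibleSpace_of_isOpenEmbedding (fun j => v' j) hemb hcov (x₀ := x₀)
      fun j => hmem x₀ j (hx j)
  · exact topologicalKrullDim_eq_of_isOpenEmbedding (fun j => v' j) hemb hcov
      fun _ => MvPolynomial.topologicalKrullDim_spec K σ
  · intro p
    obtain ⟨j, hj⟩ := exists_range_subset Φ D d hd hpts p.left (Over.w p)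
    exact hj.trans (hvU j)

end AlgFunctor

/-! ### Closed subfunctors and finite products -/

namespace AlgFunctor

open Opposite Limits TwoSided

variable {K : Type u} [Field K]

section Closed

variable {F : CommAlgCat.{u} K ⥤ Type u}

/-- Closed subfunctors of functors on algebras. -/
def IsClosedSub (G : Subfunctor F) : Prop :=
  ∀ (R : CommAlgCat.{u} K) (s : F.obj R), ∃ I : Ideal R, ∀ (T : CommAlgCat.{u} K) (f : R ⟶ T),
    F.map f s ∈ G.obj T ↔ I.map f.hom.toRingHom = ⊥

theorem IsClosedSub.inf {G H : Subfunctor F} (hG : IsClosedSub G) (hH : IsClosedSub H) :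
    IsClosedSub (G ⊓ H) := by
  intro R s
  obtain ⟨I, hI⟩ := hG R s
  obtain ⟨J, hJ⟩ := hH R s
  refine ⟨I ⊔ J, fun T f => ?_⟩
  rw [Ideal.map_sup, sup_eq_bot_iff, ← hI, ← hJ]
  rfl

/-- Each element of the defining ideal dies in every `R_{f i}`, so it is killed by a power of each
`f i`. As the `f i` generate the unit ideal, it is zero. -/
theorem IsClosedSub.mem_of_cover {G : Subfunctor F} (hG : IsClosedSub G) {R : CommAlgCat.{u} K}
    {ι : Type u} (f : ι → R) (hf : Ideal.span (Set.range f) = ⊤) (s : F.obj R)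
    (hs : ∀ i, F.map (toAway (f i)) s ∈ G.obj (.of K (Localization.Away (f i)))) :
    s ∈ G.obj R := by
  obtain ⟨I, hI⟩ := hG R s
  have h := (hI R (𝟙 R)).2 ?_
  · rwa [Functor.map_id_apply] at h
  · have hid : (𝟙 R : R ⟶ R).hom.toRingHom = RingHom.id R := rfl
    rw [hid, Ideal.map_id, eq_bot_iff]
    intro x hx
    have h0 : ∀ i, ∃ n : ℕ, f i ^ n * x = 0 := by
      intro i
      have h1 : algebraMap R (Localization.Away (f i)) x = 0 := by
        have h2 := Ideal.mem_map_of_mem (toAway (f i)).hom.toRingHom hx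
        rw [(hI _ _).1 (hs i)] at h2
        exact h2
      obtain ⟨⟨_, n, rfl⟩, hn⟩ := (IsLocalization.map_eq_zero_iff
        (Submonoid.powers (f i)) (Localization.Away (f i)) x).1 h1
      exact ⟨n, hn⟩
    refine Submodule.mem_of_span_eq_top_of_smul_pow_mem (⊥ : Ideal R) (Set.range f) hf x ?_
    rintro ⟨_, i, rfl⟩
    obtain ⟨n, hn⟩ := h0 i
    exact ⟨n, hn⟩

theorem IsZariskiSheaf.toFunctor (hF : IsZariskiSheaf F) {G : Subfunctor F} (hG : IsClosedSub G) :
    IsZariskiSheaf G.toFunctor where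
  sep s t h := Subtype.ext (hF.sep s.1 t.1 fun T _ f => congrArg Subtype.val (h T f))
  glue f hf t compat := by
    obtain ⟨s, hs⟩ := hF.glue f hf (fun i => (t i).1) fun i j T a b hab =>
      congrArg Subtype.val (compat i j T a b hab)
    exact ⟨⟨s, hG.mem_of_cover f hf s fun i => by rw [hs]; exact (t i).2⟩,
      fun i => Subtype.ext (hs i)⟩

/-- The intersection of two subfunctors as a subfunctor of one of them. -/
def restrictSub (G C : Subfunctor F) : Subfunctor G.toFunctor where
  obj R := {x | x.1 ∈ C.obj R}
  map f _ hx := C.map f hx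

theorem IsOpenSub.restrictSub {C : Subfunctor F} (hC : IsOpenSub F C) (G : Subfunctor F) :
    IsOpenSub G.toFunctor (restrictSub G C) :=
  fun R s => hC R s.1

/-- If `I` is the ideal that `G` attaches to `c`, the closed part of the chart is represented by `A
⧸ I`. -/
theorem IsUniversal.exists_restrictSub {C : Subfunctor F} {A : CommAlgCat.{u} K} {c : F.obj A}
    (hc : IsUniversal C c) {G : Subfunctor F} (hG : IsClosedSub G) :
    ∃ (B : CommAlgCat.{u} K) (d : G.toFunctor.obj B), IsUniversal
        (AlgFunctor.restrictSub G C) d := by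
  obtain ⟨I, hI⟩ := hG A c
  let p : A ⟶ CommAlgCat.of K (A ⧸ I) := CommAlgCat.ofHom (Ideal.Quotient.mkₐ K I)
  have hp : F.map p c ∈ G.obj _ := (hI _ p).2 (Ideal.map_quotient_self I)
  refine ⟨.of K (A ⧸ I), ⟨F.map p c, hp⟩, C.map p hc.mem, fun {T} s hs => ?_, fun {T f g} h => ?_⟩
  · obtain ⟨f, hf⟩ := hc.exists_map_eq s.1 hs
    have hIf := (hI T f).1 (by rw [hf]; exact s.2)
    have hker : ∀ a ∈ I, f.hom a = 0 := fun a ha => by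
      have := Ideal.mem_map_of_mem f.hom.toRingHom ha
      rwa [hIf] at this
    refine ⟨CommAlgCat.ofHom (Ideal.Quotient.liftₐ I f.hom hker), Subtype.ext ?_⟩
    refine (Functor.map_comp_apply F _ _ c).symm.trans ?_
    exact hf
  · have h1 : F.map (p ≫ f) c = F.map (p ≫ g) c := by
      rw [Functor.map_comp_apply, Functor.map_comp_apply]
      exact congrArg Subtype.val h
    have h2 := hc.injective h1
    ext x
    obtain ⟨a, rfl⟩ := Ideal.Quotient.mk_surjective x
    exact congrArg (fun g => g.hom a) h2

variable (F) in
/-- `F` is a Zariski sheaf covered by open subfunctors which are represented by algebras. -/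
structure HasAffineCharts : Prop where
  isZariskiSheaf : IsZariskiSheaf F
  exists_charts : ∃ (ι : Type u) (C : ι → Subfunctor F) (A : ι → CommAlgCat.{u} K)
    (c : ∀ i, F.obj (A i)), (∀ i, IsOpenSub F (C i)) ∧ (∀ i, IsUniversal (C i) (c i)) ∧
    ∀ (R : CommAlgCat.{u} K) [IsLocalRing R] (s : F.obj R), ∃ i, s ∈ (C i).obj R

theorem HasAffineCharts.toFunctor (hF : HasAffineCharts F) {G : Subfunctor F}
    (hG : IsClosedSub G) : HasAffineCharts G.toFunctor := by
  refine ⟨hF.isZariskiSheaf.toFunctor hG, ?_⟩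
  obtain ⟨ι, C, A, c, hC, hc, hcov⟩ := hF.exists_charts
  choose B d hd using fun i => (hc i).exists_restrictSub hG
  exact ⟨ι, fun i => restrictSub G (C i), B, d, fun i => (hC i).restrictSub G, hd,
    fun R _ s => hcov R s.1⟩

theorem HasAffineCharts.exists_represents (hF : HasAffineCharts F) : ∃ Y, Represents Y F := by
  obtain ⟨ι, C, A, c, hC, hc, hcov⟩ := hF.exists_charts
  exact (AlgFunctor.exists_represents hF.isZariskiSheaf C hC A c hc hcov).1

theorem HasAffineCharts.isOpenImmersion (hF : HasAffineCharts F)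
    {Y : Over (Spec (CommRingCat.of K))} (Φ : functorOfPoints Y ≅ F) {D : Subfunctor F}
    {B : CommAlgCat.{u} K} {d : F.obj B} (hD : IsOpenSub F D) (hd : IsUniversal D d) :
    IsOpenImmersion (pointOf Φ d).left := by
  obtain ⟨ι, C, A, c, hC, hc, hcov⟩ := hF.exists_charts
  exact (AlgFunctor.exists_represents hF.isZariskiSheaf C hC A c hc hcov).2 Φ D d hD hd

end Closed

section Pi

variable {ι : Type} {F : ι → CommAlgCat.{u} K ⥤ Type u}

theorem IsZariskiSheaf.piFunctor (hF : ∀ i, IsZariskiSheaf (F i)) :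
    IsZariskiSheaf (TwoSided.piFunctor F) where
  sep s t h := funext fun i => (hF i).sep (s i) (t i) fun T _ f => congrFun (h T f) i
  glue f hf t compat := by
    choose s hs using fun i => (hF i).glue f hf (fun a => t a i) fun a b T p q h =>
      congrFun (compat a b T p q h) i
    exact ⟨s, fun a => funext fun i => hs i a⟩

/-- The product of subfunctors. -/
def piSub (C : ∀ i, Subfunctor (F i)) : Subfunctor (piFunctor F) where
  obj R := {x | ∀ i, x i ∈ (C i).obj R}
  map f _ hx i := (C i).map f (hx i)

theorem IsOpenSub.piSub [Finite ι] {C : ∀ i, Subfunctor (F i)} (hC : ∀ i, IsOpenSub (F i) (C i)) :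
    IsOpenSub (TwoSided.piFunctor F) (piSub C) := by
  have := Fintype.ofFinite ι
  intro R s
  choose I hI using fun i => hC i R (s i)
  -- A finite product of ideals is the unit ideal exactly when every factor is.
  refine ⟨∏ i, I i, fun T f => ?_⟩
  have h1 : (∏ i, I i).map f.hom.toRingHom = ∏ i, (I i).map f.hom.toRingHom :=
    map_prod (Ideal.mapHom f.hom.toRingHom) I Finset.univ
  rw [h1, ← Ideal.isUnit_iff, IsUnit.prod_univ_iff]
  exact forall_congr' fun i => (hI i T f).trans Ideal.isUnit_iff.symm

/-- Only the universal property of a coproduct is asked of `B`, so the statement serves both tensor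
products and polynomial rings in a disjoint union of variables. -/
theorem IsUniversal.piSub {C : ∀ i, Subfunctor (F i)} {A : ι → CommAlgCat.{u} K}
    {c : ∀ i, (F i).obj (A i)} (hc : ∀ i, IsUniversal (C i) (c i)) {B : CommAlgCat.{u} K}
    (j : ∀ i, A i ⟶ B) (hex : ∀ {T : CommAlgCat.{u} K} (f : ∀ i, A i ⟶ T),
      ∃ g : B ⟶ T, ∀ i, j i ≫ g = f i)
    (huniq : ∀ {T : CommAlgCat.{u} K} (g h : B ⟶ T), (∀ i, j i ≫ g = j i ≫ h) → g = h) :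
    IsUniversal (AlgFunctor.piSub C)
      (show (TwoSided.piFunctor F).obj B from fun i => (F i).map (j i) (c i)) where
  mem i := (C i).map (j i) (hc i).mem
  exists_map_eq {T} s hs := by
    choose f hf using fun i => (hc i).exists_map_eq (s i) (hs i)
    obtain ⟨g, hg⟩ := hex f
    refine ⟨g, funext fun i => ?_⟩
    refine (Functor.map_comp_apply (F i) _ _ _).symm.trans ?_
    rw [hg, hf]
  injective {T g h} hgh := by
    refine huniq g h fun i => (hc i).injective ?_
    rw [Functor.map_comp_apply, Functor.map_comp_apply]
    exact congrFun hgh i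

theorem exists_coproduct [Finite ι] (A : ι → CommAlgCat.{u} K) :
    ∃ (B : CommAlgCat.{u} K) (j : ∀ i, A i ⟶ B),
      (∀ {T : CommAlgCat.{u} K} (f : ∀ i, A i ⟶ T), ∃ g : B ⟶ T, ∀ i, j i ≫ g = f i) ∧
      ∀ {T : CommAlgCat.{u} K} (g h : B ⟶ T), (∀ i, j i ≫ g = j i ≫ h) → g = h := by
  classical
  have := Fintype.ofFinite ι
  refine ⟨.of K (⨂[K] i, A i), fun i => CommAlgCat.ofHom
    (PiTensorProduct.singleAlgHom (R := K) (A := fun i => A i) i),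
    fun {T} f => ?_, fun {T} g h hgh => ?_⟩
  · refine ⟨CommAlgCat.ofHom (PiTensorProduct.liftAlgHom
      ((MultilinearMap.mkPiAlgebra K ι T).compLinearMap fun i => (f i).hom.toLinearMap) ?_ ?_),
      fun i => ?_⟩
    · simp
    · intro x y
      simp [Finset.prod_mul_distrib]
    · refine CommAlgCat.hom_ext (AlgHom.ext fun x => ?_)
      change PiTensorProduct.lift _ (PiTensorProduct.tprod K
        (Pi.mulSingle (M := fun i => A i) i x)) = (f i).hom x
      rw [PiTensorProduct.lift.tprod]
      change ∏ i', (f i').hom (Pi.mulSingle (M := fun i => A i) i x i') = _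
      rw [Finset.prod_eq_single i]
      · rw [Pi.mulSingle_eq_same]
      · intro i' _ hi'
        rw [Pi.mulSingle_eq_of_ne hi', map_one]
      · simp
  · exact CommAlgCat.hom_ext (PiTensorProduct.algHom_ext fun i =>
      congrArg CommAlgCat.Hom.hom (hgh i))

theorem HasAffineCharts.piFunctor [Finite ι] (hF : ∀ i, HasAffineCharts (F i)) :
    HasAffineCharts (TwoSided.piFunctor F) := by
  refine ⟨IsZariskiSheaf.piFunctor fun i => (hF i).isZariskiSheaf, ?_⟩
  choose κ C A c hC hc hcov using fun i => (hF i).exists_charts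
  choose B j hex huniq using fun t : (∀ i, κ i) => exists_coproduct fun i => A i (t i)
  exact ⟨∀ i, κ i, fun t => piSub fun i => C i (t i), B, _,
    fun t => IsOpenSub.piSub fun i => hC i (t i),
    fun t => IsUniversal.piSub (fun i => hc i (t i)) (j t) (hex t) (huniq t),
    fun R _ s => ⟨fun i => (hcov i R (s i)).choose, fun i => (hcov i R (s i)).choose_spec⟩⟩

theorem IsUniversal.piSub_mvPolynomial {C : ∀ i, Subfunctor (F i)} {σ : ι → Type}
    {c : ∀ i, (F i).obj (.of K (MvPolynomial (σ i) K))} (hc : ∀ i, IsUniversal (C i) (c i)) :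
    ∃ d : (TwoSided.piFunctor F).obj (.of K (MvPolynomial (Σ i, σ i) K)),
      IsUniversal (AlgFunctor.piSub C) d := by
  refine ⟨_, IsUniversal.piSub hc
    (fun i => CommAlgCat.ofHom (MvPolynomial.rename fun a => ⟨i, a⟩)) (fun {T} f => ?_)
    fun {T} g h hgh => ?_⟩
  · refine ⟨CommAlgCat.ofHom (MvPolynomial.aeval fun a => (f a.1).hom (MvPolynomial.X a.2)),
      fun i => ?_⟩
    refine CommAlgCat.hom_ext (MvPolynomial.algHom_ext fun a => ?_)
    simp
  · refine CommAlgCat.hom_ext (MvPolynomial.algHom_ext fun a => ?_)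
    have := congrArg (fun g => g.hom (MvPolynomial.X a.2)) (hgh a.1)
    simpa using this

end Pi

end AlgFunctor

/-! ### Localization of families; the Grassmannian is a Zariski sheaf -/

namespace TwoSided

variable {K : Type u} [Field K] {V : Type u} [AddCommGroup V] [Module K V]

section Localization

variable {R : Type u} (T : Type u) [CommRing R] [Algebra K R] [CommRing T] [Algebra K T]
  [Algebra R T] [IsScalarTower K R T]

variable (K V R) in
/-- The map `R ⊗ V → T ⊗ V` as an `R`-linear map. -/
def scalarMapLinear : R ⊗[K] V →ₗ[R] T ⊗[K] V :=
  { scalarMap V (IsScalarTower.toAlgHom K R T) with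
    map_smul' := fun r x => (scalarMap_smul _ r x).trans (algebraMap_smul T r _) }

theorem isBaseChange_scalarMapLinear : IsBaseChange T (scalarMapLinear K V R T) := by
  refine IsBaseChange.of_equiv
    (TensorProduct.AlgebraTensorModule.cancelBaseChange K R T T V) fun x => ?_
  induction x with
  | zero => simp
  | tmul s y =>
    rw [TensorProduct.AlgebraTensorModule.cancelBaseChange_tmul, Algebra.smul_def, mul_one]
    rfl
  | add x y hx hy => rw [TensorProduct.tmul_add, map_add, map_add, hx, hy]

variable (S : Submonoid R) [IsLocalization S T]

instance isLocalizedModule_scalarMapLinear : IsLocalizedModule S (scalarMapLinear K V R T) :=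
  (isLocalizedModule_iff_isBaseChange S T _).2 (isBaseChange_scalarMapLinear T)

theorem familyPullback_eq_localized (M : Submodule R (R ⊗[K] V)) :
    familyPullback (IsScalarTower.toAlgHom K R T) M = M.localized' T S
        (scalarMapLinear K V R T) := by
  rw [Submodule.localized'_eq_span]
  rfl

theorem scalarMap_mem_familyPullback_iff {M : Submodule R (R ⊗[K] V)} {x : R ⊗[K] V} :
    scalarMap V (IsScalarTower.toAlgHom K R T) x ∈
      familyPullback (IsScalarTower.toAlgHom K R T) M ↔ ∃ s ∈ S, s • x ∈ M := by
  rw [familyPullback_eq_localized T S]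
  change scalarMapLinear K V R T x ∈ _ ↔ _
  constructor
  · rintro ⟨y, hy, s, h⟩
    rw [IsLocalizedModule.mk'_eq_iff, Submonoid.smul_def, ← map_smul] at h
    obtain ⟨c, hc⟩ := IsLocalizedModule.exists_of_eq (S := S) h
    refine ⟨c * s, mul_mem c.2 s.2, ?_⟩
    rw [mul_smul]
    have : c • y ∈ M := M.smul_mem _ hy
    rwa [hc] at this
  · rintro ⟨s, hs, h⟩
    refine ⟨s • x, h, ⟨s, hs⟩, ?_⟩
    rw [IsLocalizedModule.mk'_eq_iff, map_smul]
    rfl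

theorem exists_smul_eq_scalarMap (y : T ⊗[K] V) :
    ∃ s ∈ S, ∃ x : R ⊗[K] V, algebraMap R T s • y = scalarMap V
        (IsScalarTower.toAlgHom K R T) x := by
  obtain ⟨⟨x, s⟩, h⟩ := IsLocalizedModule.surj S (scalarMapLinear K V R T) y
  refine ⟨s, s.2, x, ?_⟩
  rw [algebraMap_smul]
  exact h

end Localization

theorem isComplemented_of_projective_quotient {R W : Type u} [CommRing R] [AddCommGroup W]
    [Module R W] {M : Submodule R W} [Module.Projective R (W ⧸ M)] : IsComplemented M := by
  obtain ⟨s, hs⟩ := Module.projective_lifting_property M.mkQ LinearMap.id M.mkQ_surjective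
  have hs' : ∀ x, M.mkQ (s x) = x := LinearMap.congr_fun hs
  let f : W →ₗ[R] M := LinearMap.codRestrict M (LinearMap.id - s ∘ₗ M.mkQ) fun x => by
    rw [← Submodule.Quotient.mk_eq_zero, ← Submodule.mkQ_apply]
    simp [hs', -Submodule.mkQ_apply]
  refine ⟨LinearMap.ker f, LinearMap.isCompl_of_proj fun x => Subtype.ext ?_⟩
  have : M.mkQ (x : W) = 0 := by simp
  simp [f, this, -Submodule.mkQ_apply]

theorem finite_of_isComplemented {R W : Type*} [CommRing R] [AddCommGroup W] [Module R W]
    [Module.Finite R W] {M : Submodule R W} (h : IsComplemented M) : Module.Finite R M := by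
  obtain ⟨N, hN⟩ := h
  exact Module.Finite.of_surjective (M.projectionOnto N hN)
    fun x => ⟨x, Submodule.projectionOnto_apply_left hN x⟩

theorem projective_of_isComplemented {R W : Type*} [CommRing R] [AddCommGroup W] [Module R W]
    [Module.Projective R W] {M : Submodule R W} (h : IsComplemented M) :
    Module.Projective R M := by
  obtain ⟨N, hN⟩ := h
  exact Module.Projective.of_split M.subtype (M.projectionOnto N hN) (by
    ext x
    exact congrArg Subtype.val (Submodule.projectionOnto_apply_left hN x))

/-- The surjection splits, so its kernel is finitely generated projective of rank zero, hence zero.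
-/
theorem injective_of_surjective_of_rankAtStalk_eq {R M P : Type*} [CommRing R] [AddCommGroup M]
    [Module R M] [AddCommGroup P] [Module R P] [Module.Finite R M] [Module.Projective R M]
    [Module.Finite R P] [Module.Projective R P] {g : M →ₗ[R] P} (hg : Function.Surjective g)
    (h : Module.rankAtStalk (R := R) M = Module.rankAtStalk P) : Function.Injective g := by
  obtain ⟨s, hs⟩ := Module.projective_lifting_property g LinearMap.id hg
  have hs' : ∀ y, g (s y) = y := LinearMap.congr_fun hs
  have hker : IsComplemented (LinearMap.ker g) := by
    have h : ∀ x : M, (LinearMap.id - s ∘ₗ g : M →ₗ[R] M) x ∈ LinearMap.ker g := fun x => by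
      simp [hs']
    refine ⟨_, LinearMap.isCompl_of_proj
      (f := LinearMap.codRestrict (LinearMap.ker g) (LinearMap.id - s ∘ₗ g) h) fun x => ?_⟩
    have hx : g x = 0 := x.2
    refine Subtype.ext ?_
    change (x : M) - s (g x) = x
    rw [hx, map_zero, sub_zero]
  have := finite_of_isComplemented hker
  have := projective_of_isComplemented hker
  have hsub : Subsingleton (LinearMap.ker g) := by
    rw [← Module.rankAtStalk_eq_zero_iff_subsingleton (R := R)]
    have h1 := Module.rankAtStalk_eq_of_equiv (lequivProdOfRightSplitExact
      (j := (LinearMap.ker g).subtype) (Submodule.injective_subtype _)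
      (Submodule.range_subtype _) hs)
    rw [Module.rankAtStalk_prod, h] at h1
    exact add_eq_right.1 h1
  exact LinearMap.ker_eq_bot.1 (Submodule.subsingleton_iff_eq_bot.1 hsub)

theorem IsSummandOfRank.projective_quotient {R : Type u} [CommRing R] [Algebra K R] {m : ℕ}
    {M : Submodule R (R ⊗[K] V)} (h : IsSummandOfRank m M) :
    Module.Projective R (R ⊗[K] V ⧸ M) := by
  obtain ⟨N, hN⟩ := h.isComplemented
  have : Module.Projective R N := projective_of_isComplemented ⟨M, hN.symm⟩
  exact Module.Projective.of_equiv (Submodule.quotientEquivOfIsCompl M N hN).symm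

theorem exists_pow_smul_mem {R : Type u} [CommRing R] [Algebra K R] (f g : R)
    (M : Submodule (Localization.Away f) (Localization.Away f ⊗[K] V))
    (N : Submodule (Localization.Away g) (Localization.Away g ⊗[K] V))
    (h : ∀ (T : Type u) [CommRing T] [Algebra K T] (a : Localization.Away f →ₐ[K] T)
      (b : Localization.Away g →ₐ[K] T), a.comp (IsScalarTower.toAlgHom K R _) =
      b.comp (IsScalarTower.toAlgHom K R _) → familyPullback a M = familyPullback b N)
    {x : R ⊗[K] V} (hx : scalarMap V (IsScalarTower.toAlgHom K R _) x ∈ N) :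
    ∃ n : ℕ, g ^ n • scalarMap V (IsScalarTower.toAlgHom K R (Localization.Away f)) x ∈ M := by
  -- Over the overlap `(R_f)_g` the two families agree. The image of `x` lies in the pullback of `M`
  -- there, so a power of `g` moves it into `M`.
  let T := Localization.Away (algebraMap R (Localization.Away f) g)
  let a : Localization.Away f →ₐ[K] T := IsScalarTower.toAlgHom K (Localization.Away f) T
  let b : Localization.Away g →ₐ[K] T := IsLocalization.liftAlgHom (M := Submonoid.powers g)
    (f := a.comp (IsScalarTower.toAlgHom K R (Localization.Away f))) (by
      rintro ⟨_, n, rfl⟩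
      rw [map_pow]
      exact (IsLocalization.Away.algebraMap_isUnit (algebraMap R (Localization.Away f) g)).pow n)
  have hab : a.comp (IsScalarTower.toAlgHom K R (Localization.Away f)) =
      b.comp (IsScalarTower.toAlgHom K R (Localization.Away g)) :=
    AlgHom.ext fun r => by
      change _ = b (algebraMap R _ r)
      rw [IsLocalization.liftAlgHom_apply, IsLocalization.lift_eq]
      rfl
  have h1 := scalarMap_mem_familyPullback b hx
  rw [← h T a b hab, ← scalarMap_comp, ← hab, scalarMap_comp] at h1
  obtain ⟨_, ⟨n, rfl⟩, hn⟩ := (scalarMap_mem_familyPullback_iff T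
    (Submonoid.powers (algebraMap R (Localization.Away f) g))).1 h1
  refine ⟨n, ?_⟩
  rw [← algebraMap_smul (Localization.Away f), map_pow]
  exact hn

variable [FiniteDimensional K V]

theorem IsSummandOfRank.finitePresentation {R : Type u} [CommRing R] [Algebra K R] {m : ℕ}
    {M : Submodule R (R ⊗[K] V)} (h : IsSummandOfRank m M) :
    Module.FinitePresentation R (R ⊗[K] V ⧸ M) := by
  have := h.projective_quotient
  exact Module.finitePresentation_of_projective _ _

/-- A submodule with projective quotient is a summand, and for the quotient projectivity follows
from finite presentation and flatness, both local. The rank at `p` is computed on a member of the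
cover that contains `p`. -/
theorem isSummandOfRank_of_cover {R : Type u} [CommRing R] [Algebra K R] {m : ℕ}
    {ι : Type u} (f : ι → R) (hf : Ideal.span (Set.range f) = ⊤) {M : Submodule R (R ⊗[K] V)}
    (hM : ∀ i, IsSummandOfRank m
      (familyPullback (IsScalarTower.toAlgHom K R (Localization.Away (f i))) M)) :
    IsSummandOfRank m M := by
  have hM' : ∀ r : Set.range f, IsSummandOfRank m
      (familyPullback (IsScalarTower.toAlgHom K R (Localization.Away r.1)) M) := by
    rintro ⟨_, i, rfl⟩
    exact hM i
  replace hM' : ∀ r : Set.range f, IsSummandOfRank m (M.localized' (Localization.Away r.1)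
      (Submonoid.powers r.1) (scalarMapLinear K V R (Localization.Away r.1))) := fun r => by
    rw [← familyPullback_eq_localized]
    exact hM' r
  have hfp : Module.FinitePresentation R (R ⊗[K] V ⧸ M) :=
    Module.FinitePresentation.of_localizationSpan' (Set.range f) hf
      (Rₚ := fun r => Localization.Away r.1)
      (fun r => M.toLocalizedQuotient' (Localization.Away r.1) (Submonoid.powers r.1)
        (scalarMapLinear K V R (Localization.Away r.1)))
      fun r => (hM' r).finitePresentation
  have hflat : Module.Flat R (R ⊗[K] V ⧸ M) := by
    refine Module.flat_of_isLocalized_span (R := R) R (R ⊗[K] V ⧸ M) (Set.range f) hf _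
      (fun r => M.toLocalizedQuotient' (Localization.Away r.1) (Submonoid.powers r.1)
        (scalarMapLinear K V R (Localization.Away r.1))) fun r => ?_
    have := (hM' r).projective_quotient
    exact Module.Flat.trans R (Localization.Away r.1) _
  have hproj : Module.Projective R (R ⊗[K] V ⧸ M) := Module.Flat.projective_of_finitePresentation
  refine ⟨isComplemented_of_projective_quotient, fun p => ?_⟩
  have hc : IsComplemented M := isComplemented_of_projective_quotient
  have := finite_of_isComplemented hc
  have := projective_of_isComplemented hc
  have hp : ∃ r : Set.range f, r.1 ∉ p.asIdeal := by
    by_contra! h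
    exact p.2.ne_top (eq_top_iff.2 (hf ▸ Ideal.span_le.2 fun r hr => h ⟨r, hr⟩))
  obtain ⟨r, hr⟩ := hp
  obtain ⟨q, rfl⟩ : p ∈ Set.range (PrimeSpectrum.comap
      (algebraMap R (Localization.Away r.1))) := by
    rw [PrimeSpectrum.localization_away_comap_range _ r.1]
    exact hr
  rw [← (hM' r).rank_eq q]
  exact (Module.rankAtStalk_isBaseChange (IsLocalizedModule.isBaseChange (Submonoid.powers r.1)
    (Localization.Away r.1) (M.toLocalized' (Localization.Away r.1) (Submonoid.powers r.1)
      (scalarMapLinear K V R (Localization.Away r.1)))) q).symm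



-- Submodules are separated by localization at maximal ideals. The glued family consists of the
-- vectors whose image lies in every `t i`; it has the right pullbacks because denominators can be
-- cleared for finitely many indices at once.
open AlgFunctor in
theorem grassmannian_isZariskiSheaf (m : ℕ) : IsZariskiSheaf (grassmannian (K := K) V m) where
  sep {R} M N h := by
    refine Subtype.ext (Submodule.eq_of_localization_maximal
      (fun P => Localization.AtPrime P)
      (fun P _ => Localization.AtPrime P ⊗[K] V)
      (fun P _ => scalarMapLinear K V R (Localization.AtPrime P)) fun P _ => ?_)
    have := congrArg Subtype.val (h (.of K (Localization.AtPrime P))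
      (CommAlgCat.ofHom (IsScalarTower.toAlgHom K R (Localization.AtPrime P))))
    rw [← familyPullback_eq_localized, ← familyPullback_eq_localized]
    exact this
  glue {R ι} _ f hf t compat := by
    classical
    let A (i : ι) := Localization.Away (f i)
    let s (i : ι) : R ⊗[K] V →ₗ[R] A i ⊗[K] V := scalarMapLinear K V R (A i)
    let M : Submodule R (R ⊗[K] V) := ⨅ i, ((t i).1.restrictScalars R).comap (s i)
    have hM : ∀ x, x ∈ M ↔ ∀ i, s i x ∈ (t i).1 := fun x => by
      simp [M, Submodule.mem_iInf]
    have key : ∀ i j x, s j x ∈ (t j).1 → ∃ n : ℕ, f j ^ n • s i x ∈ (t i).1 := by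
      refine fun i j x hx => exists_pow_smul_mem (f i) (f j) (t i).1 (t j).1
        (fun T _ _ a b hab => ?_) hx
      exact congrArg Subtype.val (compat i j (.of K T) (CommAlgCat.ofHom a)
        (CommAlgCat.ofHom b) (CommAlgCat.hom_ext hab))
    have hpull : ∀ j, familyPullback (IsScalarTower.toAlgHom K R (A j)) M = (t j).1 := by
      intro j
      apply le_antisymm
      · refine Submodule.span_le.2 ?_
        rintro _ ⟨x, hx, rfl⟩
        exact (hM x).1 hx j
      · intro y hy
        obtain ⟨_, ⟨k, rfl⟩, x, hx⟩ := exists_smul_eq_scalarMap (A j) (Submonoid.powers (f j)) y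
        have hxj : s j x ∈ (t j).1 := by
          change scalarMap V _ x ∈ _
          rw [← hx]
          exact Submodule.smul_mem _ _ hy
        choose n hn using fun i => key i j x hxj
        have := Fintype.ofFinite ι
        -- The sum of the exponents is at least each `n i`, so this single power works for all `i`.
        have hmem : f j ^ (∑ i, n i) • x ∈ M := by
          refine (hM _).2 fun i => ?_
          rw [← Finset.sum_erase_add _ _ (Finset.mem_univ i), pow_add, map_smul, mul_smul]
          exact Submodule.smul_of_tower_mem _ _ (hn i)
        have h2 := scalarMap_mem_familyPullback (IsScalarTower.toAlgHom K R (A j)) hmem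
        rw [scalarMap_smul, ← hx] at h2
        have hu : ∀ n : ℕ, IsUnit (algebraMap R (A j) (f j ^ n)) := fun n => by
          rw [map_pow]
          exact (IsLocalization.Away.algebraMap_isUnit (f j)).pow n
        exact (Submodule.smul_mem_iff_of_isUnit _ (hu k)).1
          ((Submodule.smul_mem_iff_of_isUnit _ (hu _)).1 h2)
    exact ⟨⟨M, isSummandOfRank_of_cover f hf fun i => by
      rw [hpull i]; exact (t i).2⟩, fun i => Subtype.ext (hpull i)⟩


end TwoSided

/-! ### Images of sections of a linear map -/

namespace TwoSided

variable {K : Type u} [Field K] {V : Type u} [AddCommGroup V] [Module K V]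
  {Q : Type v} [AddCommGroup Q] [Module K Q] (q : V →ₗ[K] Q)

section Sections

variable {R : Type u} [CommRing R] [Algebra K R] {T : Type u} [CommRing T] [Algebra K T]

/-- `σ` is a family of sections of `q`. -/
def IsSection (σ : Q →ₗ[K] R ⊗[K] V) : Prop :=
  ∀ y, q.baseChange R (σ y) = 1 ⊗ₜ y

/-- `M` is the image of a family of sections of `q`. -/
def IsGraph (M : Submodule R (R ⊗[K] V)) : Prop :=
  ∃ σ : Q →ₗ[K] R ⊗[K] V, IsSection q σ ∧ M = Submodule.span R (Set.range σ)

variable {q}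

theorem IsSection.comp_liftBaseChange {σ : Q →ₗ[K] R ⊗[K] V} (h : IsSection q σ) :
    q.baseChange R ∘ₗ σ.liftBaseChange R = LinearMap.id := by
  ext y
  simpa using h y

theorem span_range_eq_range_liftBaseChange (σ : Q →ₗ[K] R ⊗[K] V) :
    Submodule.span R (Set.range σ) = LinearMap.range (σ.liftBaseChange R) := by
  rw [LinearMap.range_liftBaseChange]
  rfl

theorem IsSection.eq_of_mem_span {σ : Q →ₗ[K] R ⊗[K] V} (h : IsSection q σ) {x : R ⊗[K] V}
    (hx : x ∈ Submodule.span R (Set.range σ)) : σ.liftBaseChange R (q.baseChange R x) = x := by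
  rw [span_range_eq_range_liftBaseChange] at hx
  obtain ⟨y, rfl⟩ := hx
  exact congrArg (σ.liftBaseChange R) (LinearMap.congr_fun h.comp_liftBaseChange y)

/-- On the image of a section `q` is injective, so an element of the image that lies over `1 ⊗ y`
must be `σ y`. This turns invariance of the image into linearity of `σ`. -/
theorem IsSection.apply_eq {σ : Q →ₗ[K] R ⊗[K] V} (h : IsSection q σ) {x : R ⊗[K] V}
    (hx : x ∈ Submodule.span R (Set.range σ)) {y : Q} (hy : q.baseChange R x = 1 ⊗ₜ y) :
    σ y = x := by
  rw [← h.eq_of_mem_span hx, hy, LinearMap.liftBaseChange_one_tmul]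

theorem IsSection.ext_of_span_eq {σ τ : Q →ₗ[K] R ⊗[K] V} (hσ : IsSection q σ)
    (hτ : IsSection q τ)
    (h : Submodule.span R (Set.range σ) = Submodule.span R (Set.range τ)) : σ = τ := by
  ext y
  refine hσ.apply_eq ?_ (hτ y)
  rw [h]
  exact Submodule.subset_span ⟨y, rfl⟩

theorem IsSection.isSummandOfRank {σ : Q →ₗ[K] R ⊗[K] V} (h : IsSection q σ) :
    IsSummandOfRank (Module.finrank K Q) (Submodule.span R (Set.range σ)) := by
  have hinj : Function.Injective (σ.liftBaseChange R) := fun x y hxy => by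
    simpa using (LinearMap.congr_fun h.comp_liftBaseChange x).symm.trans
      ((congrArg (q.baseChange R) hxy).trans (LinearMap.congr_fun h.comp_liftBaseChange y))
  -- The kernel of `q` is a complement, and `σ` identifies `R ⊗ Q` with the span.
  refine ⟨⟨LinearMap.ker (q.baseChange R), ?_⟩, fun p => ?_⟩
  · rw [span_range_eq_range_liftBaseChange]
    have hpi' : ∀ x, q.baseChange R (σ.liftBaseChange R x) = x :=
      LinearMap.congr_fun h.comp_liftBaseChange
    refine IsCompl.of_eq (eq_bot_iff.2 ?_) (eq_top_iff.2 ?_)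
    · rintro _ ⟨⟨x, rfl⟩, hx⟩
      have hx' : x = 0 := (hpi' x).symm.trans hx
      simp [hx']
    · intro x _
      refine Submodule.mem_sup.2 ⟨σ.liftBaseChange R (q.baseChange R x), ⟨_, rfl⟩,
        x - σ.liftBaseChange R (q.baseChange R x), ?_, by simp⟩
      rw [LinearMap.mem_ker, map_sub, hpi', sub_self]
  · have := p.nontrivial
    let E : R ⊗[K] Q ≃ₗ[R] Submodule.span R (Set.range σ) :=
      (LinearEquiv.ofInjective _ hinj).trans
        (LinearEquiv.ofEq _ _ (span_range_eq_range_liftBaseChange σ).symm)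
    refine (congrFun (Module.rankAtStalk_eq_of_equiv E) p).symm.trans ?_
    rw [Module.rankAtStalk_eq_finrank_of_free]
    exact Module.finrank_baseChange

theorem baseChange_scalarMap (q : V →ₗ[K] Q) (f : R →ₐ[K] T) (x : R ⊗[K] V) :
    q.baseChange T (scalarMap V f x) = LinearMap.rTensor Q f.toLinearMap (q.baseChange R x) := by
  induction x with
  | zero => simp
  | tmul s y => simp
  | add x y hx hy => simp only [map_add, hx, hy]

theorem IsSection.pullback {σ : Q →ₗ[K] R ⊗[K] V} (h : IsSection q σ) (f : R →ₐ[K] T) :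
    IsSection q (scalarMap V f ∘ₗ σ) := by
  intro y
  rw [LinearMap.comp_apply, baseChange_scalarMap, h]
  simp

theorem familyPullback_span (f : R →ₐ[K] T) (s : Set (R ⊗[K] V)) :
    familyPullback f (Submodule.span R s) = Submodule.span T (scalarMap V f '' s) := by
  refine le_antisymm (Submodule.span_le.2 ?_)
    (Submodule.span_mono (Set.image_mono Submodule.subset_span))
  rintro _ ⟨x, hx, rfl⟩
  induction hx using Submodule.span_induction with
  | mem x hx => exact Submodule.subset_span ⟨x, hx, rfl⟩
  | zero => rw [map_zero]; exact Submodule.zero_mem _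
  | add x y _ _ hx hy => rw [map_add]; exact Submodule.add_mem _ hx hy
  | smul r x _ hx => rw [SetLike.mem_coe, scalarMap_smul]; exact Submodule.smul_mem _ _ hx

theorem familyPullback_span_range (f : R →ₐ[K] T) (σ : Q →ₗ[K] R ⊗[K] V) :
    familyPullback f (Submodule.span R (Set.range σ)) =
      Submodule.span T (Set.range (scalarMap V f ∘ₗ σ)) := by
  rw [familyPullback_span, ← Set.range_comp]
  rfl

theorem IsGraph.pullback {M : Submodule R (R ⊗[K] V)} (h : IsGraph q M) (f : R →ₐ[K] T) :
    IsGraph q (familyPullback f M) := by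
  obtain ⟨σ, hσ, rfl⟩ := h
  exact ⟨_, hσ.pullback f, familyPullback_span_range f σ⟩

/-- A summand of the right rank which surjects onto `R ⊗ Q` is the image of sections. -/
theorem IsSummandOfRank.isGraph [FiniteDimensional K V] [FiniteDimensional K Q]
    {M : Submodule R (R ⊗[K] V)}
    (hM : IsSummandOfRank (Module.finrank K Q) M)
    (hq : ∀ y : R ⊗[K] Q, ∃ x ∈ M, q.baseChange R x = y) : IsGraph q M := by
  have := finite_of_isComplemented hM.isComplemented
  have := projective_of_isComplemented hM.isComplemented
  let g : M →ₗ[R] R ⊗[K] Q := q.baseChange R ∘ₗ M.subtype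
  have hg : Function.Surjective g := fun y => by
    obtain ⟨x, hx, h⟩ := hq y
    exact ⟨⟨x, hx⟩, h⟩
  have hrank : Module.rankAtStalk (R := R) M = Module.rankAtStalk (R ⊗[K] Q) := by
    funext p
    have := p.nontrivial
    rw [hM.rank_eq, Module.rankAtStalk_eq_finrank_of_free, Pi.natCast_apply,
      Module.finrank_baseChange, Nat.cast_id]
  let e := LinearEquiv.ofBijective g ⟨injective_of_surjective_of_rankAtStalk_eq hg hrank, hg⟩
  let s : R ⊗[K] Q →ₗ[R] M := e.symm.toLinearMap
  refine ⟨M.subtype.restrictScalars K ∘ₗ s.restrictScalars K ∘ₗ TensorProduct.mk K R Q 1,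
    fun y => e.apply_symm_apply _, le_antisymm (fun x hx => ?_) (Submodule.span_le.2 ?_)⟩
  · rw [span_range_eq_range_liftBaseChange]
    have h1 : LinearMap.liftBaseChange R (M.subtype.restrictScalars K ∘ₗ s.restrictScalars K ∘ₗ
        TensorProduct.mk K R Q 1) = M.subtype ∘ₗ s := by
      ext y
      simp
    rw [h1]
    refine ⟨g ⟨x, hx⟩, ?_⟩
    exact congrArg Subtype.val (e.symm_apply_apply ⟨x, hx⟩)
  · rintro _ ⟨y, rfl⟩
    exact (s (1 ⊗ₜ y)).2

end Sections

end TwoSided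

/-! ### Minors: charts are open and cover local rings -/

namespace TwoSided

open Module

/-- This is Cramer's rule. -/
theorem det_smul_mem_span {R P ι : Type*} [CommRing R] [AddCommGroup P] [Module R P] [Fintype ι]
    [DecidableEq ι] (e : Basis ι R P) (v : ι → P) (y : P) :
    e.det v • y ∈ Submodule.span R (Set.range v) := by
  let A := e.toMatrix v
  let c := A.cramer (e.repr y)
  have h : e.det v • y = ∑ j, c j • v j := by
    refine e.repr.injective (Finsupp.ext fun i => ?_)
    have h1 := congrFun (A.mulVec_cramer (e.repr y)) i
    rw [Basis.det_apply, map_smul, map_sum, Finsupp.smul_apply, Finsupp.finsetSum_apply]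
    refine h1.symm.trans (Finset.sum_congr rfl fun j _ => ?_)
    rw [map_smul, Finsupp.smul_apply, smul_eq_mul, mul_comm]
    rfl
  rw [h]
  exact Submodule.sum_mem _ fun j _ => Submodule.smul_mem _ _ (Submodule.subset_span ⟨j, rfl⟩)

/-- Expanding the rows of `C * A` writes `det (C * A) = 1` as a combination of the determinants of
the submatrices of `A`. If all of these were nonunits, `1` would lie in the maximal ideal. -/
theorem exists_isUnit_det_submatrix {R m n : Type*} [CommRing R] [IsLocalRing R] [Fintype m]
    [DecidableEq m] [Fintype n] (A : Matrix n m R) (C : Matrix m n R) (h : C * A = 1) :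
    ∃ κ : m → n, IsUnit (A.submatrix κ id).det := by
  classical
  by_contra! hA
  have h1 : (C * A).det = ∑ κ : m → n, (∏ i, C i (κ i)) • (A.submatrix κ id).det := by
    have hrow : (C * A) = fun i => ∑ j, C i j • A j := by
      ext i j
      simp [Matrix.mul_apply, Finset.sum_apply]
    rw [hrow]
    change (Matrix.detRowAlternating : (m → R) [⋀^m]→ₗ[R] R).toMultilinearMap _ = _
    rw [MultilinearMap.map_sum]
    refine Finset.sum_congr rfl fun κ _ => ?_
    rw [MultilinearMap.map_smul_univ]
    rfl
  have h2 : (C * A).det ∈ IsLocalRing.maximalIdeal R := by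
    rw [h1]
    exact Ideal.sum_mem _ fun κ _ => Ideal.mul_mem_left _ _ (hA κ)
  rw [h, Matrix.det_one] at h2
  exact (IsLocalRing.mem_maximalIdeal _).1 h2 isUnit_one

variable {K : Type u} [Field K] {V : Type u} [AddCommGroup V] [Module K V]
  {Q : Type v} [AddCommGroup Q] [Module K Q] (q : V →ₗ[K] Q)

theorem baseChange_repr_rTensor {R T : Type u} [CommRing R] [Algebra K R] [CommRing T]
    [Algebra K T] {ι : Type*} (b : Basis ι K Q) (f : R →ₐ[K] T) (z : R ⊗[K] Q) (i : ι) :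
    (Algebra.TensorProduct.basis T b).repr (LinearMap.rTensor Q f.toLinearMap z) i =
      f ((Algebra.TensorProduct.basis R b).repr z i) := by
  induction z with
  | zero => simp
  | tmul r y => simp
  | add x y hx hy => rw [map_add, map_add, map_add, Finsupp.add_apply, Finsupp.add_apply, hx, hy,
      map_add]

section Minors

variable {m : ℕ} (b : Basis (Fin m) K Q) {R : Type u} [CommRing R] [Algebra K R] {T : Type u}
  [CommRing T] [Algebra K T]

/-- The determinant of the images of `m` elements of `R ⊗ V` in `R ⊗ Q`. -/
def minor (R : Type u) [CommRing R] [Algebra K R] : (R ⊗[K] V) [⋀^Fin m]→ₗ[R] R :=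
  (Algebra.TensorProduct.basis R b).det.compLinearMap (q.baseChange R)

theorem minor_scalarMap (f : R →ₐ[K] T) (x : Fin m → R ⊗[K] V) :
    minor q b T (fun j => scalarMap V f (x j)) = f (minor q b R x) := by
  simp only [minor, AlternatingMap.compLinearMap_apply, Basis.det_apply]
  rw [AlgHom.map_det]
  congr 1
  ext i j
  simp only [Basis.toMatrix_apply, AlgHom.mapMatrix_apply, Matrix.map_apply]
  rw [baseChange_scalarMap, baseChange_repr_rTensor]

/-- The ideal generated by the minors of a submodule. -/
def minorIdeal (M : Submodule R (R ⊗[K] V)) : Ideal R :=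
  Ideal.span {r | ∃ x : Fin m → R ⊗[K] V, (∀ j, x j ∈ M) ∧ minor q b R x = r}

variable {q}

theorem IsGraph.minorIdeal_eq_top {M : Submodule R (R ⊗[K] V)} (h : IsGraph q M) :
    minorIdeal q b M = ⊤ := by
  obtain ⟨σ, hσ, rfl⟩ := h
  refine Ideal.eq_top_of_isUnit_mem _ (Ideal.subset_span
    ⟨fun j => σ (b j), fun j => Submodule.subset_span ⟨_, rfl⟩, ?_⟩) isUnit_one
  rw [minor, AlternatingMap.compLinearMap_apply]
  have : (fun i => (q.baseChange R ∘ fun j => σ (b j)) i) = Algebra.TensorProduct.basis R b := by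
    ext j
    rw [Algebra.TensorProduct.basis_apply]
    exact hσ _
  exact (congrArg _ this).trans (Basis.det_self _)

theorem map_minorIdeal (f : R →ₐ[K] T) (M : Submodule R (R ⊗[K] V)) :
    (minorIdeal q b M).map f.toRingHom = minorIdeal q b (familyPullback f M) := by
  refine le_antisymm (Ideal.map_le_iff_le_comap.2 (Ideal.span_le.2 ?_)) (Ideal.span_le.2 ?_)
  · rintro _ ⟨x, hx, rfl⟩
    exact Ideal.subset_span ⟨fun j => scalarMap V f (x j),
      fun j => scalarMap_mem_familyPullback f (hx j), minor_scalarMap q b f x⟩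
  · rintro _ ⟨x, hx, rfl⟩
    refine mem_of_forall_mem_span (minor q b T) (scalarMap V f '' M) _ (fun w hw => ?_) x hx
    choose y hy hyw using hw
    obtain rfl : (fun j => scalarMap V f (y j)) = w := funext hyw
    rw [minor_scalarMap]
    exact Ideal.mem_map_of_mem f.toRingHom (Ideal.subset_span ⟨y, hy, rfl⟩)

variable [FiniteDimensional K V]

/-- By Cramer's rule every minor multiplies `R ⊗ Q` into the image of `M`. If the minors generate
the unit ideal, then `M` surjects onto `R ⊗ Q`, and equality of ranks makes it the image of a
section. -/
theorem isGraph_iff_minorIdeal_eq_top {M : Submodule R (R ⊗[K] V)} (hM : IsSummandOfRank m M) :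
    IsGraph q M ↔ minorIdeal q b M = ⊤ := by
  refine ⟨fun h => h.minorIdeal_eq_top b, fun h => ?_⟩
  have : FiniteDimensional K Q := b.finiteDimensional_of_finite
  have hm : finrank K Q = m := by rw [finrank_eq_card_basis b, Fintype.card_fin]
  subst hm
  refine hM.isGraph fun y => ?_
  let N : Submodule R (R ⊗[K] Q) := M.map (q.baseChange R)
  have hI : minorIdeal q b M ≤ N.colon {y} := by
    refine Ideal.span_le.2 ?_
    rintro _ ⟨x, hx, rfl⟩
    refine Submodule.mem_colon_singleton.2 ?_
    refine Submodule.span_le.2 ?_ (det_smul_mem_span (Algebra.TensorProduct.basis R b)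
      (fun j => q.baseChange R (x j)) y)
    rintro _ ⟨j, rfl⟩
    exact ⟨x j, hx j, rfl⟩
  have h1 : (1 : R) ∈ N.colon {y} := hI (h ▸ Submodule.mem_top)
  have h2 := Submodule.mem_colon_singleton.1 h1
  rw [one_smul] at h2
  exact h2

end Minors

/-- Over a local ring `M` is free. A projection onto `M` gives a left inverse of the matrix of its
basis, so some choice of `m` coordinates has invertible minor. -/
theorem exists_isGraph [FiniteDimensional K V] {n : ℕ} (b : Basis (Fin n) K V) {R : Type u}
    [CommRing R] [Algebra K R] [IsLocalRing R] {m : ℕ} {M : Submodule R (R ⊗[K] V)}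
    (hM : IsSummandOfRank m M) :
    ∃ κ : Fin m → Fin n, IsGraph (LinearMap.pi fun j => b.coord (κ j)) M := by
  have := finite_of_isComplemented hM.isComplemented
  have := projective_of_isComplemented hM.isComplemented
  have : Module.Free R M := Module.free_of_flat_of_isLocalRing (R := R) (P := M)
  have hr : finrank R M = m := by
    have := hM.rank_eq (IsLocalRing.closedPoint R)
    rwa [rankAtStalk_eq_finrank_of_free, Pi.natCast_apply, Nat.cast_id] at this
  let x := finBasisOfFinrankEq R M hr
  obtain ⟨N, hN⟩ := hM.isComplemented
  let p := M.projectionOnto N hN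
  let c := Algebra.TensorProduct.basis R b
  obtain ⟨κ, hκ⟩ := exists_isUnit_det_submatrix (c.toMatrix fun j => (x j : R ⊗[K] V))
    (x.toMatrix fun i => p (c i)) (by
      ext j j'
      have : p (x j') = x j' := Submodule.projectionOnto_apply_left hN _
      have h2 := c.sum_repr (x j' : R ⊗[K] V)
      rw [← h2, map_sum] at this
      have h3 := DFunLike.congr_fun (congrArg x.repr this) j
      rw [Basis.repr_self, map_sum, Finsupp.finsetSum_apply] at h3
      rw [Matrix.mul_apply]
      refine Eq.trans (Finset.sum_congr rfl fun i _ => ?_) (h3.trans ?_)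
      swap
      · simp [Finsupp.single_apply, Matrix.one_apply, eq_comm]
      rw [map_smul, map_smul, Finsupp.smul_apply, smul_eq_mul, mul_comm]
      rfl)
  refine ⟨κ, (isGraph_iff_minorIdeal_eq_top (Pi.basisFun K (Fin m)) hM).2 ?_⟩
  refine Ideal.eq_top_of_isUnit_mem _ (Ideal.subset_span ⟨fun j => x j, fun j => (x j).2, rfl⟩) ?_
  convert hκ using 1
  rw [minor, AlternatingMap.compLinearMap_apply, Basis.det_apply]
  congr 1
  ext i j
  rw [Basis.toMatrix_apply, Matrix.submatrix_apply, Basis.toMatrix_apply]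
  simp only [c, id]
  induction (x j : R ⊗[K] V) with
  | zero => simp
  | tmul r v => simp
  | add y z hy hz => rw [map_add, map_add, map_add, Finsupp.add_apply, Finsupp.add_apply, hy, hz]

end TwoSided

namespace AlgFunctor

variable {K : Type u} [Field K] {F : CommAlgCat.{u} K ⥤ Type u}

/-- A subfunctor which is isomorphic to `R ↦ R ⊗ H` is represented by a polynomial ring. -/
theorem exists_isUniversal_of_param {C : Subfunctor F} {H : Type*} [AddCommGroup H] [Module K H]
    {τ : Type} [Finite τ] (b : Module.Basis τ K H) (e : ∀ R : CommAlgCat.{u} K, R ⊗[K] H → F.obj R)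
    (naturality : ∀ {R T : CommAlgCat.{u} K} (f : R ⟶ T) (h : R ⊗[K] H),
      F.map f (e R h) = e T (LinearMap.rTensor H f.hom.toLinearMap h))
    (injective : ∀ R, Function.Injective (e R))
    (mem_iff : ∀ {R : CommAlgCat.{u} K} (s : F.obj R), s ∈ C.obj R ↔ ∃ h, e R h = s) :
    ∃ c : F.obj (.of K (MvPolynomial τ K)), IsUniversal C c := by
  have := Fintype.ofFinite τ
  let A : CommAlgCat.{u} K := .of K (MvPolynomial τ K)
  -- This is the generic vector of `H`; the variables are its coordinates.
  let h₀ : A ⊗[K] H := ∑ i, (MvPolynomial.X i : MvPolynomial τ K) ⊗ₜ b i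
  have hrepr : ∀ {T : CommAlgCat.{u} K} (f : A ⟶ T) (i : τ), (Algebra.TensorProduct.basis T b).repr
      (LinearMap.rTensor H f.hom.toLinearMap h₀) i = f.hom (MvPolynomial.X i) := by
    intro T f i
    classical
    simp only [h₀, map_sum, LinearMap.rTensor_tmul, Finsupp.finsetSum_apply,
      Algebra.TensorProduct.basis_repr_tmul, Finsupp.smul_apply]
    rw [Finset.sum_eq_single i]
    · simp
    · intro j _ hj
      simp [hj]
    · simp
  refine ⟨e A h₀, (mem_iff _).2 ⟨h₀, rfl⟩, fun {T} s hs => ?_, fun {T f g} hfg => ?_⟩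
  · obtain ⟨h, rfl⟩ := (mem_iff s).1 hs
    refine ⟨CommAlgCat.ofHom (MvPolynomial.aeval fun i =>
      (Algebra.TensorProduct.basis T b).repr h i), ?_⟩
    rw [naturality]
    congr 1
    refine (Algebra.TensorProduct.basis T b).repr.injective (Finsupp.ext fun i => ?_)
    rw [hrepr]
    exact MvPolynomial.aeval_X _ _
  · rw [naturality, naturality] at hfg
    have h := injective T hfg
    refine CommAlgCat.hom_ext (MvPolynomial.algHom_ext fun i => ?_)
    rw [← hrepr, h, hrepr]

end AlgFunctor

/-! ### Charts parametrized by a vector space; affine charts of the Grassmannian -/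

namespace TwoSided

open Module AlgFunctor

variable {K : Type u} [Field K] {V : Type u} [AddCommGroup V] [Module K V]
  {Q : Type v} [AddCommGroup Q] [Module K Q] {H : Type w} [AddCommGroup H] [Module K H]

section Param

variable (σ₀ : Q →ₗ[K] V) (Θ : Q →ₗ[K] H →ₗ[K] V) {R : Type u} [CommRing R] [Algebra K R]
  {T : Type u} [CommRing T] [Algebra K T]

/-- The family of maps `Q → V` which is given by a linear family `Θ` of maps and a base point. -/
def sectionOf (h : R ⊗[K] H) : Q →ₗ[K] R ⊗[K] V :=
  TensorProduct.mk K R V 1 ∘ₗ σ₀ +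
    { toFun := fun y => (Θ y).baseChange R h
      map_add' := fun x y => by rw [map_add, LinearMap.baseChange_add]; rfl
      map_smul' := fun c x => by rw [map_smul, LinearMap.baseChange_smul]; rfl }

theorem sectionOf_apply (h : R ⊗[K] H) (y : Q) :
    sectionOf σ₀ Θ h y = 1 ⊗ₜ σ₀ y + (Θ y).baseChange R h := rfl

theorem isSection_sectionOf {q : V →ₗ[K] Q} (hq : ∀ y, q (σ₀ y) = y) (hΘ : ∀ y h, q (Θ y h) = 0)
    (h : R ⊗[K] H) : IsSection q (sectionOf σ₀ Θ h) := by
  intro y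
  have h0 : q.baseChange R ∘ₗ (Θ y).baseChange R = 0 := by
    rw [← LinearMap.baseChange_comp, show q ∘ₗ Θ y = 0 from LinearMap.ext (hΘ y),
      LinearMap.baseChange_zero]
  have h1 : q.baseChange R ((Θ y).baseChange R h) = 0 := LinearMap.congr_fun h0 h
  rw [sectionOf_apply, map_add, h1, add_zero, LinearMap.baseChange_tmul, hq]

theorem scalarMap_comp_sectionOf (f : R →ₐ[K] T) (h : R ⊗[K] H) :
    scalarMap V f ∘ₗ sectionOf σ₀ Θ h = sectionOf σ₀ Θ (LinearMap.rTensor H f.toLinearMap h) := by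
  ext y
  rw [LinearMap.comp_apply, sectionOf_apply, sectionOf_apply, map_add, scalarMap_tmul, map_one]
  congr 1
  induction h with
  | zero => simp
  | tmul r h => simp
  | add x y hx hy => simp only [map_add, hx, hy]

end Param

variable [FiniteDimensional K V] {m : ℕ} (q : V →ₗ[K] Q)

variable (m) in
/-- The families which are images of sections of `q`. -/
def graphs : Subfunctor (grassmannian (K := K) V m) where
  obj _ := {M | IsGraph q M.1}
  map f _ hM := IsGraph.pullback hM f.hom

theorem isOpenSub_graphs [FiniteDimensional K Q] (hm : finrank K Q = m) :
    IsOpenSub _ (graphs (V := V) m q) := by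
  intro R M
  let b := finBasisOfFinrankEq K Q hm
  refine ⟨minorIdeal q b M.1, fun T f => ?_⟩
  rw [map_minorIdeal]
  exact isGraph_iff_minorIdeal_eq_top b (M.2.pullback f.hom)

/-- If the sections with image in `G` form an affine-linear family with base point `σ₀` and
directions in `R ⊗ H`, the chart is an affine space on `H`. It is used with `H = Hom(Q, ker q)` for
the full Grassmannian and with `H = ker q` for invariant families. -/
theorem exists_isUniversal_of_sections [FiniteDimensional K Q] (hm : finrank K Q = m)
    {G : Subfunctor (grassmannian (K := K) V m)} {σ₀ : Q →ₗ[K] V} {Θ : Q →ₗ[K] H →ₗ[K] V}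
    (hq : ∀ y, q (σ₀ y) = y) (hΘ : ∀ y h, q (Θ y h) = 0)
    (hinj : ∀ (R : Type u) [CommRing R] [Algebra K R] (h h' : R ⊗[K] H),
      (∀ y, (Θ y).baseChange R h = (Θ y).baseChange R h') → h = h')
    (hG : ∀ {R : CommAlgCat.{u} K} {σ : Q →ₗ[K] R ⊗[K] V} (hσ : IsSection q σ),
      (⟨Submodule.span R (Set.range σ), hm ▸ hσ.isSummandOfRank⟩ : (grassmannian V m).obj R) ∈
        G.obj R ↔ ∃ h : R ⊗[K] H, sectionOf σ₀ Θ h = σ)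
    {τ : Type} [Finite τ] (b : Basis τ K H) :
    ∃ c : G.toFunctor.obj (.of K (MvPolynomial τ K)),
      IsUniversal (restrictSub G (graphs m q)) c := by
  have hs : ∀ {R : CommAlgCat.{u} K} (h : R ⊗[K] H), IsSection q (sectionOf σ₀ Θ h) :=
    fun h => isSection_sectionOf σ₀ Θ hq hΘ h
  refine exists_isUniversal_of_param b
    (fun R h => ⟨⟨Submodule.span R (Set.range (sectionOf σ₀ Θ h)), hm ▸ (hs h).isSummandOfRank⟩,
      (hG (hs h)).2 ⟨h, rfl⟩⟩)
    (fun {R T} f h => ?_) (fun R h h' hh => ?_) fun {R} s => ⟨fun hsR => ?_, ?_⟩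
  · refine Subtype.ext (Subtype.ext ?_)
    refine (familyPullback_span_range f.hom _).trans ?_
    rw [scalarMap_comp_sectionOf]
  · have h1 := (hs h).ext_of_span_eq (hs h') (congrArg (fun M => M.1.1) hh)
    refine hinj R h h' fun y => ?_
    have h2 := LinearMap.congr_fun h1 y
    rw [sectionOf_apply, sectionOf_apply] at h2
    exact add_left_cancel h2
  · obtain ⟨⟨M, hM⟩, hMG⟩ := s
    obtain ⟨σ, hσ, rfl⟩ : IsGraph q M := hsR
    obtain ⟨h, rfl⟩ := (hG hσ).1 hMG
    exact ⟨h, rfl⟩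
  · rintro ⟨h, rfl⟩
    exact ⟨_, hs h, rfl⟩

theorem exists_isUniversal_graphs [FiniteDimensional K Q] (hm : finrank K Q = m)
    (hq : Function.Surjective q) :
    ∃ (A : CommAlgCat.{u} K) (c : (grassmannian (K := K) V m).obj A),
      IsUniversal (graphs m q) c := by
  obtain ⟨σ₀, hσ₀⟩ := q.exists_rightInverse_of_surjective (LinearMap.range_eq_top.2 hq)
  have hσ₀' : ∀ y, q (σ₀ y) = y := LinearMap.congr_fun hσ₀
  let Θ : Q →ₗ[K] (Q →ₗ[K] LinearMap.ker q) →ₗ[K] V :=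
    LinearMap.mk₂ K (fun y h => (h y : V)) (by simp) (by simp) (by simp) (by simp)
  let π : V →ₗ[K] LinearMap.ker q :=
    LinearMap.codRestrict _ (LinearMap.id - σ₀ ∘ₗ q) fun v => by simp [hσ₀']
  have hπ : (LinearMap.ker q).subtype ∘ₗ π = LinearMap.id - σ₀ ∘ₗ q :=
    LinearMap.subtype_comp_codRestrict _ _ _
  have hπ' : ∀ v : LinearMap.ker q, π v = v := fun v => Subtype.ext (by
    have h0 : q v = 0 := v.2
    simp [π, h0])
  let c := finBasis K Q
  -- The maps `i j` recover an element of `R ⊗ Hom(Q, ker q)` from its values on the basis `c`. They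
  -- give injectivity, and applied to the values of `σ` they yield the parameter of `σ`.
  let i (j) : V →ₗ[K] Q →ₗ[K] LinearMap.ker q :=
    LinearMap.mk₂ K (fun v y => c.coord j y • π v) (by simp) (fun a v y => by
      rw [map_smul, smul_comm]) (by simp [add_smul]) (by simp [mul_smul])
  have hiΘ : ∑ j, i j ∘ₗ Θ (c j) = LinearMap.id := by
    ext h y : 2
    rw [LinearMap.sum_apply, LinearMap.sum_apply, LinearMap.id_apply]
    conv_rhs => rw [← c.sum_repr y, map_sum]
    refine Finset.sum_congr rfl fun j _ => ?_
    rw [map_smul]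
    exact congrArg (fun z => c.repr y j • z) (hπ' (h (c j)))
  have hΘi : ∀ y j, Θ y ∘ₗ i j = c.repr y j • (LinearMap.id - σ₀ ∘ₗ q) := fun y j => by
    rw [← hπ]
    rfl
  have hinj : ∀ (R : Type u) [CommRing R] [Algebra K R] (h h' : R ⊗[K] (Q →ₗ[K] LinearMap.ker q)),
      (∀ y, (Θ y).baseChange R h = (Θ y).baseChange R h') → h = h' := by
    intro R _ _ h h' hh
    have key : ∀ h : R ⊗[K] (Q →ₗ[K] LinearMap.ker q),
        h = ∑ j, (i j).baseChange R ((Θ (c j)).baseChange R h) := fun h => by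
      have h1 := LinearMap.congr_fun (congrArg (LinearMap.baseChange R) hiΘ) h
      rw [LinearMap.baseChange_id, LinearMap.id_apply] at h1
      refine h1.symm.trans ?_
      rw [← LinearMap.baseChangeHom_apply, map_sum, LinearMap.sum_apply]
      simp only [LinearMap.baseChangeHom_apply, LinearMap.baseChange_comp, LinearMap.comp_apply]
    rw [key h, key h']
    simp only [hh]
  have hsurj : ∀ {R : CommAlgCat.{u} K} {σ : Q →ₗ[K] R ⊗[K] V}, IsSection q σ →
      ∃ h, sectionOf σ₀ Θ h = σ := by
    intro R σ hσ
    refine ⟨∑ j, (i j).baseChange R (σ (c j)), ?_⟩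
    ext y
    rw [sectionOf_apply, map_sum]
    simp only [← LinearMap.comp_apply (LinearMap.baseChange R (Θ y)), ← LinearMap.baseChange_comp,
      hΘi, LinearMap.baseChange_smul, LinearMap.smul_apply]
    have hsm : ∀ (a : K) (j : Fin _) (L : R ⊗[K] V →ₗ[R] R ⊗[K] V),
        a • L (σ (c j)) = L (σ (a • c j)) := fun a j L => by
      rw [map_smul σ, LinearMap.map_smul_of_tower]
    simp only [hsm]
    rw [← map_sum, ← map_sum, c.sum_repr]
    rw [LinearMap.baseChange_sub, LinearMap.sub_apply, LinearMap.baseChange_id,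
      LinearMap.baseChange_comp, LinearMap.comp_apply, hσ, LinearMap.baseChange_tmul]
    simp
  obtain ⟨d, hd⟩ := exists_isUniversal_of_sections (G := ⊤) q hm hσ₀' (Θ := Θ)
    (fun y h => (h y).2) hinj (fun hσ => ⟨fun _ => hsurj hσ, fun _ => trivial⟩)
    (finBasis K (Q →ₗ[K] LinearMap.ker q))
  refine ⟨_, d.1, hd.mem, fun {T} s hs => ?_, fun {T f g} hfg => hd.injective (Subtype.ext hfg)⟩
  obtain ⟨f, hf⟩ := hd.exists_map_eq (⟨s, trivial⟩ : (⊤ : Subfunctor _).toFunctor.obj T) hs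
  exact ⟨f, congrArg Subtype.val hf⟩

theorem grassmannian_hasAffineCharts (m : ℕ) : HasAffineCharts (grassmannian (K := K) V m) := by
  refine ⟨grassmannian_isZariskiSheaf m, ?_⟩
  let b := finBasis K V
  let q (κ : Fin m → Fin (finrank K V)) : V →ₗ[K] Fin m → K := LinearMap.pi fun j => b.coord (κ j)
  have hm : finrank K (Fin m → K) = m := finrank_fin_fun K
  choose A c hc using fun κ : {κ // Function.Surjective (q κ)} =>
    exists_isUniversal_graphs (q κ) hm κ.2
  refine ⟨ULift {κ // Function.Surjective (q κ)}, fun κ => graphs m (q κ.down.1),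
    fun κ => A κ.down, fun κ => c κ.down, fun κ => isOpenSub_graphs _ hm, fun κ => hc κ.down,
    fun R _ M => ?_⟩
  obtain ⟨κ, σ, hσ, h⟩ := exists_isGraph b M.2
  -- The section makes `q κ` surjective over `R`, and surjectivity descends because `R` is
  -- faithfully flat over `K`. Repeated coordinates are thus excluded.
  have hsurj : Function.Surjective (q κ) := by
    rw [← Module.FaithfullyFlat.lTensor_surjective_iff_surjective K R]
    exact fun y => ⟨_, LinearMap.congr_fun hσ.comp_liftBaseChange y⟩
  exact ⟨⟨κ, hsurj⟩, σ, hσ, h⟩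

end TwoSided

/-! ### Invariance and generation by invariants are closed conditions -/

namespace TwoSided

open Module AlgFunctor

variable {K : Type u} [Field K] {V : Type u} [AddCommGroup V] [Module K V]

section ZeroIdeal

variable {R T : Type u} [CommRing R] [Algebra K R] [CommRing T] [Algebra K T]

/-- The ideal generated by the coordinates of the elements of a subset of `R ⊗ V`. -/
def coordIdeal (Y : Set (R ⊗[K] V)) : Ideal R :=
  Ideal.span {r | ∃ y ∈ Y, ∃ i,
    (Algebra.TensorProduct.basis R (Basis.ofVectorSpace K V)).repr y i = r}

theorem map_coordIdeal_eq_bot_iff (f : R →ₐ[K] T) (Y : Set (R ⊗[K] V)) :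
    (coordIdeal Y).map f.toRingHom = ⊥ ↔ ∀ y ∈ Y, scalarMap V f y = 0 := by
  rw [eq_bot_iff, Ideal.map_le_iff_le_comap, coordIdeal, Ideal.span_le]
  constructor
  · intro h y hy
    refine (Algebra.TensorProduct.basis T (Basis.ofVectorSpace K V)).repr.injective
      (Finsupp.ext fun i => ?_)
    rw [map_zero, Finsupp.zero_apply]
    exact (baseChange_repr_rTensor _ f y i).trans (h ⟨y, hy, i, rfl⟩)
  · rintro h _ ⟨y, hy, i, rfl⟩
    change f _ = 0
    rw [← baseChange_repr_rTensor]
    change (Algebra.TensorProduct.basis T (Basis.ofVectorSpace K V)).repr (scalarMap V f y) i = 0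
    rw [h y hy, map_zero, Finsupp.zero_apply]

/-- The projection `π` along `M` onto a complement is compatible with base change. Membership in a
pullback of `M` thereby becomes the vanishing of a vector, which is a closed condition. -/
theorem exists_mem_familyPullback_iff {M : Submodule R (R ⊗[K] V)} (hM : IsComplemented M) :
    ∃ π : R ⊗[K] V →ₗ[R] R ⊗[K] V, ∀ (T : Type u) [CommRing T] [Algebra K T] (f : R →ₐ[K] T)
      (y : R ⊗[K] V), scalarMap V f y ∈ familyPullback f M ↔ scalarMap V f (π y) = 0 := by
  obtain ⟨N, hN⟩ := hM
  let π : R ⊗[K] V →ₗ[R] R ⊗[K] V := LinearMap.id - M.subtype ∘ₗ M.projectionOnto N hN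
  have hπ : ∀ y, π y = y - (M.projectionOnto N hN y : R ⊗[K] V) := fun y => rfl
  have hM0 : ∀ x ∈ M, π x = 0 := fun x hx => by
    rw [hπ, Submodule.projectionOnto_apply_left hN ⟨x, hx⟩, sub_self]
  have hππ : ∀ y, π (π y) = π y := fun y => by
    conv_lhs => rw [hπ y, map_sub, hM0 _ (Subtype.property _), sub_zero]
  refine ⟨π, fun T _ _ f y => ?_⟩
  let πT : T ⊗[K] V →ₗ[T] T ⊗[K] V := LinearMap.liftBaseChange T
    (scalarMap V f ∘ₗ π.restrictScalars K ∘ₗ TensorProduct.mk K R V 1)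
  have hπT : ∀ x, πT (scalarMap V f x) = scalarMap V f (π x) := by
    intro x
    induction x with
    | zero => simp
    | tmul r v =>
      rw [scalarMap_tmul, LinearMap.liftBaseChange_tmul]
      change f r • scalarMap V f (π (1 ⊗ₜ v)) = _
      rw [← scalarMap_smul, ← map_smul, smul_tmul', smul_eq_mul, mul_one]
    | add x y hx hy => rw [map_add, map_add, map_add, map_add, hx, hy]
  have hsplit : scalarMap V f y = scalarMap V f (π y) +
      scalarMap V f (M.projectionOnto N hN y : R ⊗[K] V) := by
    rw [← map_add, hπ, sub_add_cancel]
  constructor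
  · intro h
    have h0 : ∀ z ∈ familyPullback f M, πT z = 0 := by
      intro z hz
      have : familyPullback f M ≤ LinearMap.ker πT := by
        refine Submodule.span_le.2 ?_
        rintro _ ⟨x, hx, rfl⟩
        exact (hπT x).trans (by rw [hM0 x hx, map_zero])
      exact this hz
    rw [← hπT]
    exact h0 _ h
  · intro h
    rw [hsplit, h, zero_add]
    exact scalarMap_mem_familyPullback f (Subtype.property _)

end ZeroIdeal

theorem isClosedSub_invariantFamilies [FiniteDimensional K V] (A : Subring (Module.End K V))
    (m : ℕ) : IsClosedSub (invariantFamilies V A m) := by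
  intro R M
  obtain ⟨π, hπ⟩ := exists_mem_familyPullback_iff M.2.isComplemented
  refine ⟨coordIdeal {y | ∃ a ∈ A, ∃ x ∈ M.1, π (LinearMap.baseChange R a x) = y},
    fun T f => ?_⟩
  rw [map_coordIdeal_eq_bot_iff]
  constructor
  · rintro h _ ⟨a, ha, x, hx, rfl⟩
    rw [← hπ, ← scalarMap_baseChange]
    exact h a ha _ (scalarMap_mem_familyPullback f.hom hx)
  · intro h a ha y hy
    have : familyPullback f.hom M.1 ≤
        (familyPullback f.hom M.1).comap (LinearMap.baseChange T a) := by
      refine Submodule.span_le.2 ?_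
      rintro _ ⟨x, hx, rfl⟩
      change LinearMap.baseChange T a (scalarMap V f.hom x) ∈ familyPullback f.hom M.1
      rw [scalarMap_baseChange, hπ]
      exact h _ ⟨a, ha, x, hx, rfl⟩
    exact this hy

section Wedge

variable (R T : Type u) [CommRing R] [Algebra K R] [CommRing T] [Algebra K T]
  [Algebra R T] [IsScalarTower K R T] (m : ℕ)

variable (K V) in
/-- The wedge product of `m` elements of `T ⊗ V` as an alternating map over a smaller ring. -/
def wedgeRestrict : (T ⊗[K] V) [⋀^Fin m]→ₗ[R] ⋀[T]^m (T ⊗[K] V) :=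
  { (exteriorPower.ιMulti T m).toMultilinearMap.restrictScalars R with
    map_eq_zero_of_eq' := (exteriorPower.ιMulti T m).map_eq_zero_of_eq' }

variable (K V) in
/-- The canonical map `T ⊗ ⋀ᵐ V → ⋀ᵐ (T ⊗ V)`. -/
def wedgeMap : T ⊗[K] ⋀[K]^m V →ₗ[T] ⋀[T]^m (T ⊗[K] V) :=
  LinearMap.liftBaseChange T (exteriorPower.alternatingMapLinearEquiv
    ((wedgeRestrict K V K T m).compLinearMap (TensorProduct.mk K T V 1)))

theorem wedgeMap_tmul (v : Fin m → V) :
    wedgeMap K V T m (1 ⊗ₜ exteriorPower.ιMulti K m v) =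
      exteriorPower.ιMulti T m fun j => (1 : T) ⊗ₜ[K] v j := by
  rw [wedgeMap, LinearMap.liftBaseChange_one_tmul,
    exteriorPower.alternatingMapLinearEquiv_apply_ιMulti]
  rfl

theorem wedgeMap_bijective [FiniteDimensional K V] :
    Function.Bijective (wedgeMap K V T m) := by
  let b := finBasis K V
  let B := Algebra.TensorProduct.basis T (b.exteriorPower m)
  let C := (Algebra.TensorProduct.basis T b).exteriorPower m
  have h : wedgeMap K V T m = (B.equiv C (Equiv.refl _)).toLinearMap := by
    refine B.ext fun s => ?_
    rw [LinearEquiv.coe_coe, Basis.equiv_apply, Algebra.TensorProduct.basis_apply,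
      exteriorPower.basis_apply, exteriorPower.basis_apply]
    refine (wedgeMap_tmul T m _).trans ?_
    refine congrArg (exteriorPower.ιMulti T m) (funext fun j => ?_)
    exact (Algebra.TensorProduct.basis_apply _ _).symm
  rw [h]
  exact (B.equiv C (Equiv.refl _)).bijective

theorem wedgeMap_scalarMap {w : Fin m → R ⊗[K] V} {z : R ⊗[K] ⋀[K]^m V}
    (h : wedgeMap K V R m z = exteriorPower.ιMulti R m w) :
    wedgeMap K V T m (scalarMap _ (IsScalarTower.toAlgHom K R T) z) =
      exteriorPower.ιMulti T m fun j => scalarMap V (IsScalarTower.toAlgHom K R T) (w j) := by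
  let Ψ : ⋀[R]^m (R ⊗[K] V) →ₗ[R] ⋀[T]^m (T ⊗[K] V) := exteriorPower.alternatingMapLinearEquiv
    ((wedgeRestrict K V R T m).compLinearMap (scalarMapLinear K V R T))
  have hΨ : ∀ w : Fin m → R ⊗[K] V, Ψ (exteriorPower.ιMulti R m w) =
      exteriorPower.ιMulti T m fun j => scalarMap V (IsScalarTower.toAlgHom K R T) (w j) :=
    fun w => exteriorPower.alternatingMapLinearEquiv_apply_ιMulti _ w
  have key : Ψ ∘ₗ wedgeMap K V R m =
      (wedgeMap K V T m).restrictScalars R ∘ₗ scalarMapLinear K (⋀[K]^m V) R T := by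
    refine TensorProduct.AlgebraTensorModule.curry_injective (LinearMap.ext_ring ?_)
    refine exteriorPower.linearMap_ext (AlternatingMap.ext fun v => ?_)
    change Ψ (wedgeMap K V R m (1 ⊗ₜ exteriorPower.ιMulti K m v)) =
      wedgeMap K V T m (scalarMap _ (IsScalarTower.toAlgHom K R T)
        (1 ⊗ₜ exteriorPower.ιMulti K m v))
    rw [wedgeMap_tmul, hΨ, scalarMap_tmul, map_one, wedgeMap_tmul]
    simp
  have h2 := LinearMap.congr_fun key z
  change Ψ (wedgeMap K V R m z) = _ at h2
  rw [h, hΨ] at h2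
  exact h2.symm

end Wedge

section Generated

variable (A : Subring (Module.End K V)) (m : ℕ)

/-- The subspace of `⋀ᵐ V` generated by the exterior products of bases of invariant subspaces. -/
def invariantSpan : Submodule K (⋀[K]^m V) :=
  Submodule.span K {ω | ∃ v : Fin m → V, LinearIndependent K v ∧
    (∀ a ∈ A, ∀ x ∈ Submodule.span K (Set.range v), a x ∈ Submodule.span K (Set.range v)) ∧
    ω = exteriorPower.ιMulti K m v}

theorem mem_baseChange_iff {W : Type u} [AddCommGroup W] [Module K W] (E : Submodule K W)
    (T : Type u) [CommRing T] [Algebra K T] (z : T ⊗[K] W) :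
    z ∈ E.baseChange T ↔ E.mkQ.baseChange T z = 0 := by
  have h := lTensor_exact T (LinearMap.exact_subtype_mkQ E) E.mkQ_surjective z
  rw [Submodule.baseChange]
  exact h.symm

/-- The span of the invariant wedges over `T` is the base change of a subspace over `K`, and by
right exactness membership in it is vanishing in the quotient. -/
theorem wedgeMap_mem_span_iff [FiniteDimensional K V] (T : Type u) [CommRing T] [Algebra K T]
    (z : T ⊗[K] ⋀[K]^m V) :
    wedgeMap K V T m z ∈ Submodule.span T (invariantWedges T A m) ↔
      (invariantSpan A m).mkQ.baseChange T z = 0 := by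
  have h : Submodule.span T (invariantWedges T A m) =
      ((invariantSpan A m).baseChange T).map (wedgeMap K V T m) := by
    rw [invariantSpan, Submodule.baseChange_span, Submodule.map_span]
    congr 1
    ext ω
    constructor
    · rintro ⟨v, hv, hA, rfl⟩
      exact ⟨_, ⟨_, ⟨v, hv, hA, rfl⟩, rfl⟩, wedgeMap_tmul T m v⟩
    · rintro ⟨_, ⟨_, ⟨v, hv, hA, rfl⟩, rfl⟩, rfl⟩
      exact ⟨v, hv, hA, wedgeMap_tmul T m v⟩
  rw [h, ← mem_baseChange_iff]
  refine ⟨?_, fun hz => ⟨z, hz, rfl⟩⟩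
  rintro ⟨y, hy, hyz⟩
  rwa [(wedgeMap_bijective T m).1 hyz] at hy

theorem isClosedSub_generatedFamilies [FiniteDimensional K V] :
    IsClosedSub (generatedFamilies V A m) := by
  intro R M
  let E := (invariantSpan A m).mkQ
  -- The equations are the coordinates, modulo `invariantSpan`, of all wedges of `m` elements of
  -- `M`.
  refine ⟨coordIdeal {y | ∃ (w : Fin m → R ⊗[K] V) (z : R ⊗[K] ⋀[K]^m V), (∀ j, w j ∈ M.1) ∧
    wedgeMap K V R m z = exteriorPower.ιMulti R m w ∧ E.baseChange R z = y}, fun T f => ?_⟩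
  let _ : Algebra R T := f.hom.toRingHom.toAlgebra
  have : IsScalarTower K R T := IsScalarTower.of_algebraMap_eq' f.hom.comp_algebraMap.symm
  have hf : f.hom = IsScalarTower.toAlgHom K R T := AlgHom.ext fun _ => rfl
  have hE : ∀ z : R ⊗[K] ⋀[K]^m V, scalarMap _ f.hom (E.baseChange R z) =
      E.baseChange T (scalarMap _ f.hom z) := fun z => (baseChange_scalarMap E f.hom z).symm
  rw [map_coordIdeal_eq_bot_iff]
  constructor
  · rintro h _ ⟨w, z, hw, hz, rfl⟩
    rw [hE, ← wedgeMap_mem_span_iff, hf, wedgeMap_scalarMap R T m hz]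
    exact h _ fun j => scalarMap_mem_familyPullback f.hom (hw j)
  · intro h w hw
    refine mem_of_forall_mem_span _ (scalarMap V f.hom '' M.1) _ (fun w hw => ?_) w hw
    choose x hx hxw using hw
    obtain rfl : (fun j => scalarMap V f.hom (x j)) = w := funext hxw
    obtain ⟨z, hz⟩ := (wedgeMap_bijective R m).2 (exteriorPower.ιMulti R m x)
    have h1 := h _ ⟨x, z, hx, hz, rfl⟩
    rw [hE, ← wedgeMap_mem_span_iff, hf, wedgeMap_scalarMap R T m hz] at h1
    exact h1

end Generated

end TwoSided

/-! ### Invariant sections over a simple bimodule -/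

namespace TwoSided

open Module AlgFunctor

variable {k : Type w} {K : Type u} [Field k] [Field K] [Algebra k K]
  {V : Type u} [AddCommGroup V] [Module K V] [Module (K ⊗[k] K) V] [IsScalarTower K (K ⊗[k] K) V]
  {S : Type v} [AddCommGroup S] [Module K S] [Module (K ⊗[k] K) S] [IsScalarTower K (K ⊗[k] K) S]

variable (k K) in
/-- The action of `K ⊗ K` on a bimodule by left linear maps. -/
def bimoduleAction (V : Type*) [AddCommGroup V] [Module K V] [Module (K ⊗[k] K) V]
    [IsScalarTower K (K ⊗[k] K) V] : K ⊗[k] K →ₗ[K] Module.End K V where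
  toFun b := Module.toModuleEnd K V b
  map_add' := map_add _
  map_smul' c b := LinearMap.ext fun v => smul_assoc c b v

/-- As a module `S` is the quotient of `K ⊗ K` by the annihilator of `s₀`. By commutativity this
ideal kills all of `S`, hence `V`, so the action on `V` factors through `S`. -/
theorem exists_pairing [IsSimpleModule (K ⊗[k] K) S]
    (hV : ∀ b : K ⊗[k] K, (∀ s : S, b • s = 0) → ∀ v : V, b • v = 0) {s₀ : S} (hs₀ : s₀ ≠ 0) :
    ∃ β : S →ₗ[K] Module.End K V, ∀ b : K ⊗[k] K, β (b • s₀) = bimoduleAction k K V b := by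
  let φ : K ⊗[k] K →ₗ[K] S := LinearMap.restrictScalars K (LinearMap.toSpanSingleton
      (K ⊗[k] K) S s₀)
  have hφ : ∀ b, φ b = b • s₀ := fun b => rfl
  have hsurj : Function.Surjective φ := IsSimpleModule.toSpanSingleton_surjective _ hs₀
  have hker : LinearMap.ker φ ≤ LinearMap.ker (bimoduleAction k K V) := by
    intro b hb
    refine LinearMap.ext fun v => hV b (fun s => ?_) v
    obtain ⟨c, rfl⟩ := hsurj s
    have hb' : b • s₀ = 0 := hb
    rw [hφ, smul_comm, hb', smul_zero]
  refine ⟨(LinearMap.ker φ).liftQ _ hker ∘ₗ (φ.quotKerEquivOfSurjective hsurj).symm.toLinearMap,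
    fun b => ?_⟩
  rw [LinearMap.comp_apply, LinearEquiv.coe_coe, ← hφ]
  have : (φ.quotKerEquivOfSurjective hsurj).symm (φ b) = Submodule.Quotient.mk b := by
    rw [LinearEquiv.symm_apply_eq]
    rfl
  rw [this]
  exact Submodule.liftQ_apply _ _ _

theorem isInvariant_span {R : Type u} [CommRing R] [Algebra K R] {Q : Type*} {σ : Q → R ⊗[K] V}
    {A : Subring (Module.End K V)}
    (h : ∀ a ∈ A, ∀ y, ∃ z, LinearMap.baseChange R a (σ y) = σ z) :
    IsInvariant A (Submodule.span R (Set.range σ)) := by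
  intro a ha x hx
  have : Submodule.span R (Set.range σ) ≤
      (Submodule.span R (Set.range σ)).comap (LinearMap.baseChange R a) := by
    refine Submodule.span_le.2 ?_
    rintro _ ⟨y, rfl⟩
    obtain ⟨z, hz⟩ := h a ha y
    exact Submodule.subset_span ⟨z, hz.symm⟩
  exact this hx

section Chart

variable (q : V →ₗ[K ⊗[k] K] S)

/-- For `b = 1 ⊗ x` the right-hand side lies in the invariant span and over `b • y`, so it is `σ (b
• y)`; left scalars are covered by linearity of `σ`. -/
theorem IsSection.apply_smul {R : Type u} [CommRing R] [Algebra K R] {σ : S →ₗ[K] R ⊗[K] V}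
    (hσ : IsSection (q.restrictScalars K) σ)
    (h : IsInvariant (rightAction k K V).range (Submodule.span R (Set.range σ)))
    (b : K ⊗[k] K) (y : S) :
    σ (b • y) = (bimoduleAction k K V b).baseChange R (σ y) := by
  induction b with
  | zero => simp
  | add b c hb hc => rw [add_smul, map_add, map_add, hb, hc, LinearMap.baseChange_add]; rfl
  | tmul c x =>
    have h1 : (c ⊗ₜ[k] x : K ⊗[k] K) = c • ((1 : K) ⊗ₜ[k] x) := by
      rw [smul_tmul', smul_eq_mul, mul_one]
    rw [h1, smul_assoc, LinearMap.map_smul σ c, LinearMap.map_smul (bimoduleAction k K V) c,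
      LinearMap.baseChange_smul, LinearMap.smul_apply]
    congr 1
    refine hσ.apply_eq (h _ ⟨x, rfl⟩ _ (Submodule.subset_span ⟨y, rfl⟩)) ?_
    have h2 : q.restrictScalars K ∘ₗ rightAction k K V x =
        bimoduleAction k K S ((1 : K) ⊗ₜ[k] x) ∘ₗ q.restrictScalars K :=
      LinearMap.ext fun v => map_smul q _ v
    have h3 := LinearMap.congr_fun (congrArg (LinearMap.baseChange R) h2) (σ y)
    rw [LinearMap.baseChange_comp, LinearMap.baseChange_comp, LinearMap.comp_apply,
      LinearMap.comp_apply, hσ, LinearMap.baseChange_tmul] at h3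
    exact h3

/-- An invariant section is determined by `σ s₀`, which is `1 ⊗ j s₀` plus an element of `R ⊗ ker
q`. Every such element occurs, since the action of `K ⊗ K` on `V` factors through `S`. This makes
the chart an affine space on `ker q`. -/
theorem exists_isUniversal_invariantFamilies [FiniteDimensional K V] [FiniteDimensional K S]
    [IsSimpleModule (K ⊗[k] K) S]
    (hV : ∀ b : K ⊗[k] K, (∀ s : S, b • s = 0) → ∀ v : V, b • v = 0)
    {j : S →ₗ[K ⊗[k] K] V} (hj : ∀ s, q (j s) = s) {m d : ℕ} (hm : finrank K S = m)
    (hd : finrank K V - m = d) :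
    ∃ c : (invariantFamilies V (rightAction k K V).range m).toFunctor.obj
        (.of K (MvPolynomial (Fin d) K)),
      IsUniversal (restrictSub _ (graphs m (q.restrictScalars K))) c := by
  have := IsSimpleModule.nontrivial (K ⊗[k] K) S
  obtain ⟨s₀, hs₀⟩ := exists_ne (0 : S)
  obtain ⟨β, hβ⟩ := exists_pairing (V := V) hV hs₀
  have hcyc : ∀ s : S, ∃ b : K ⊗[k] K, b • s₀ = s :=
    IsSimpleModule.toSpanSingleton_surjective _ hs₀
  let q' : V →ₗ[K] S := q.restrictScalars K
  have hq' : Function.Surjective q' := fun s => ⟨j s, hj s⟩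
  let H := LinearMap.ker q'
  -- The vector `b • s₀` acts on `ker q` as `b` does, so `sectionOf` sends `b • s₀` to `b` applied
  -- to `1 ⊗ j s₀ + h`.
  let Θ : S →ₗ[K] H →ₗ[K] V := LinearMap.lcomp K V H.subtype ∘ₗ β
  have hΘ : ∀ b : K ⊗[k] K, Θ (b • s₀) = bimoduleAction k K V b ∘ₗ H.subtype := fun b => by
    rw [← hβ]
    rfl
  have hfin : finrank K H = d := by
    have h1 := q'.finrank_range_add_finrank_ker
    rw [LinearMap.range_eq_top.2 hq', finrank_top, hm] at h1
    rw [← hd, ← h1, Nat.add_sub_cancel_left]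
  have hΘ₀ : Θ s₀ = H.subtype := by
    have h1 := hΘ 1
    rw [one_smul] at h1
    rw [h1]
    ext h
    exact one_smul _ _
  refine exists_isUniversal_of_sections q' hm (σ₀ := j.restrictScalars K) (Θ := Θ) hj
    (fun y h => ?_) (fun R _ _ h h' hh => ?_) (fun {R σ} hσ => ?_) (finBasisOfFinrankEq K H hfin)
  · obtain ⟨b, rfl⟩ := hcyc y
    rw [hΘ]
    have h0 : q (h : V) = 0 := h.2
    exact (map_smul q b (h : V)).trans (by rw [h0, smul_zero])
  · have h1 := hh s₀
    rw [hΘ₀] at h1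
    exact Module.Flat.lTensor_preserves_injective_linearMap (M := R) H.subtype
      H.injective_subtype h1
  · constructor
    · intro hinv
      have hsm := hσ.apply_smul q hinv
      -- Both vectors lie over `1 ⊗ s₀`; exactness of the tensor product puts their difference in `R
      -- ⊗ ker q`.
      obtain ⟨h, hh⟩ : σ s₀ - 1 ⊗ₜ j s₀ ∈ Set.range (H.subtype.lTensor R) := by
        refine (lTensor_exact R (LinearMap.exact_subtype_ker_map q') hq' _).1 ?_
        change q'.baseChange R _ = 0
        rw [map_sub, hσ, LinearMap.baseChange_tmul]
        exact sub_eq_zero.2 (congrArg (fun s => (1 : R) ⊗ₜ[K] s) (hj s₀).symm)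
      refine ⟨h, LinearMap.ext fun y => ?_⟩
      obtain ⟨b, rfl⟩ := hcyc y
      rw [sectionOf_apply, hΘ, LinearMap.baseChange_comp, hsm]
      have h2 : H.subtype.baseChange R h = σ s₀ - 1 ⊗ₜ j s₀ := hh
      rw [LinearMap.comp_apply, h2, map_sub, LinearMap.baseChange_tmul]
      have h3 : bimoduleAction k K V b (j s₀) = j (b • s₀) := (map_smul j b s₀).symm
      rw [h3]
      exact add_sub_cancel _ _
    · rintro ⟨h, rfl⟩
      refine isInvariant_span ?_
      rintro _ ⟨x, rfl⟩ y
      obtain ⟨b, rfl⟩ := hcyc y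
      refine ⟨((1 : K) ⊗ₜ[k] x : K ⊗[k] K) • b • s₀, ?_⟩
      rw [sectionOf_apply, sectionOf_apply, map_add, ← mul_smul, hΘ, hΘ, LinearMap.baseChange_tmul]
      congr 1
      · rw [mul_smul]
        exact congrArg (fun s => (1 : R) ⊗ₜ[K] s) (map_smul j _ _).symm
      · rw [← LinearMap.comp_apply, ← LinearMap.baseChange_comp]
        congr 2
        ext v
        exact (mul_smul ((1 : K) ⊗ₜ[k] x : K ⊗[k] K) b (v : V)).symm

end Chart

end TwoSided

/-! ### Rational points, and the homogeneous components -/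

namespace TwoSided

open Module AlgFunctor

variable {k : Type w} {K : Type u} [Field k] [Field K] [Algebra k K]

section RationalPoints

variable {V : Type u} [AddCommGroup V] [Module K V] [Module (K ⊗[k] K) V]
  [IsScalarTower K (K ⊗[k] K) V]

/-- The subbimodule of `V` which corresponds to an invariant subspace of `K ⊗ V`. -/
def constants {M : Submodule K (K ⊗[K] V)} (hM : IsInvariant (rightAction k K V).range M) :
    Submodule (K ⊗[k] K) V where
  carrier := {v | (1 : K) ⊗ₜ[K] v ∈ M}
  add_mem' {v w} hv hw := by
    change (1 : K) ⊗ₜ[K] (v + w) ∈ M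
    rw [tmul_add]
    exact add_mem hv hw
  zero_mem' := by
    change (1 : K) ⊗ₜ[K] (0 : V) ∈ M
    rw [tmul_zero]
    exact zero_mem _
  smul_mem' b v hv := by
    change (1 : K) ⊗ₜ[K] (b • v) ∈ M
    induction b with
    | zero => rw [zero_smul, tmul_zero]; exact zero_mem _
    | add b c hb hc => rw [add_smul, tmul_add]; exact add_mem hb hc
    | tmul c x =>
      have h1 : (c ⊗ₜ[k] x : K ⊗[k] K) = c • ((1 : K) ⊗ₜ[k] x) := by
        rw [smul_tmul', smul_eq_mul, mul_one]
      rw [h1, smul_assoc, tmul_smul]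
      refine M.smul_mem c ?_
      have h2 := hM _ ⟨x, rfl⟩ _ hv
      rw [LinearMap.baseChange_tmul] at h2
      exact h2

theorem exists_one_tmul_eq (x : K ⊗[K] V) : ∃ v : V, (1 : K) ⊗ₜ[K] v = x :=
  ⟨TensorProduct.lid K V x, (TensorProduct.lid K V).symm_apply_apply x⟩

theorem finrank_constants {M : Submodule K (K ⊗[K] V)}
    (hM : IsInvariant (rightAction k K V).range M) {m : ℕ} (h : IsSummandOfRank m M)
    [FiniteDimensional K V] :
    finrank K ((constants hM).restrictScalars K) = m := by
  have h1 : finrank K M = m := by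
    have : Module.Free K M := Module.Free.of_divisionRing K M
    have h2 := h.rank_eq ⊥
    rw [rankAtStalk_eq_finrank_of_free] at h2
    exact h2
  rw [← h1]
  refine LinearEquiv.finrank_eq ((LinearEquiv.submoduleMap (TensorProduct.lid K V).symm _).trans
    (LinearEquiv.ofEq _ _ ?_))
  ext x
  obtain ⟨v, rfl⟩ := exists_one_tmul_eq x
  constructor
  · rintro ⟨w, hw, hwv⟩
    have : (1 : K) ⊗ₜ[K] w = (1 : K) ⊗ₜ[K] v := hwv
    rw [← this]
    exact hw
  · exact fun hv => ⟨v, hv, rfl⟩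

/-- Over `K` the family comes from a subbimodule of dimension `m`. Any `m` of its vectors either
form a basis of it or have zero wedge. -/
theorem IsSummandOfRank.isGeneratedByInvariants [FiniteDimensional K V] {m : ℕ}
    {M : Submodule K (K ⊗[K] V)} (h : IsSummandOfRank m M)
    (hM : IsInvariant (rightAction k K V).range M) :
    IsGeneratedByInvariants (rightAction k K V).range m M := by
  intro w hw
  choose v hv using fun j => exists_one_tmul_eq (w j)
  obtain rfl : (fun j => (1 : K) ⊗ₜ[K] v j) = w := funext hv
  by_cases hli : LinearIndependent K v
  · refine Submodule.subset_span ⟨v, hli, ?_, rfl⟩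
    have hspan : Submodule.span K (Set.range v) = (constants hM).restrictScalars K := by
      refine Submodule.eq_of_le_of_finrank_eq (Submodule.span_le.2 ?_) ?_
      · rintro _ ⟨j, rfl⟩
        exact hw j
      · rw [finrank_constants hM h, finrank_span_eq_card hli, Fintype.card_fin]
    rw [hspan]
    rintro _ ⟨x, rfl⟩ y hy
    exact (constants hM).smul_mem _ hy
  · have h0 : exteriorPower.ιMulti K m (fun j => (1 : K) ⊗ₜ[K] v j) = 0 := by
      refine AlternatingMap.map_linearDependent _ _ fun h' => hli ?_
      exact h'.of_comp (TensorProduct.lid K V).symm.toLinearMap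
    rw [h0]
    exact zero_mem _

variable [FiniteDimensional K V] {S : Type v} [AddCommGroup S] [Module K S]
  [Module (K ⊗[k] K) S] [IsScalarTower K (K ⊗[k] K) S] {l : ℕ} (e : V ≃ₗ[K ⊗[k] K] (Fin l → S))

/-- The projection to a simple summand. -/
def coordinate (t : Fin l) : V →ₗ[K ⊗[k] K] S := LinearMap.proj t ∘ₗ e.toLinearMap

/-- The subbimodule is nonzero since `S` is, so some coordinate is nonzero on it and hence onto the
simple module `S`. Both sides have dimension `m`. -/
theorem exists_mem_graphs [FiniteDimensional K S] [IsSimpleModule (K ⊗[k] K) S] {m : ℕ}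
    (hm : finrank K S = m)
    (s : (invariantFamilies V (rightAction k K V).range m).toFunctor.obj (.of K K)) :
    ∃ t, s ∈ (restrictSub _ (graphs m ((coordinate e t).restrictScalars K))).obj (.of K K) := by
  obtain ⟨⟨M, h⟩, hM⟩ := s
  change Submodule K (K ⊗[K] V) at M
  change IsSummandOfRank m M at h
  change IsInvariant (rightAction k K V).range M at hM
  have := IsSimpleModule.nontrivial (K ⊗[k] K) S
  have hpos : 0 < finrank K ((constants hM).restrictScalars K) := by
    rw [finrank_constants hM h, ← hm]
    exact finrank_pos
  have := finrank_pos_iff.1 hpos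
  obtain ⟨⟨v, hv⟩, hv0⟩ := exists_ne (0 : (constants hM).restrictScalars K)
  have hv0' : e v ≠ 0 := fun h0 => hv0 (Subtype.ext (e.map_eq_zero_iff.1 h0))
  obtain ⟨t, ht⟩ := Function.ne_iff.1 hv0'
  have hsurj : Function.Surjective ((coordinate e t) ∘ₗ (constants hM).subtype) := by
    refine (LinearMap.surjective_or_eq_zero _).resolve_right fun h0 => ht ?_
    exact LinearMap.congr_fun h0 ⟨v, hv⟩
  refine ⟨t, ?_⟩
  subst hm
  refine IsSummandOfRank.isGraph h fun y => ?_
  obtain ⟨y, rfl⟩ : ∃ y' : S, (1 : K) ⊗ₜ[K] y' = y :=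
    ⟨TensorProduct.lid K S y, (TensorProduct.lid K S).symm_apply_apply y⟩
  obtain ⟨x, hx⟩ := hsurj y
  refine ⟨(1 : K) ⊗ₜ[K] (x : V), x.2, ?_⟩
  rw [LinearMap.baseChange_tmul]
  exact congrArg (fun s => (1 : K) ⊗ₜ[K] s) hx

theorem exists_forall_mem_graphs (hl : 0 < l) {m : ℕ} (hm : finrank K S = m) :
    ∃ s : (invariantFamilies V (rightAction k K V).range m).toFunctor.obj (.of K K), ∀ t,
      s ∈ (restrictSub _ (graphs m ((coordinate e t).restrictScalars K))).obj (.of K K) := by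
  -- The diagonal is a section of all coordinate projections at once.
  let δ : S →ₗ[K ⊗[k] K] V := e.symm.toLinearMap ∘ₗ LinearMap.pi fun _ => LinearMap.id
  have hδ : ∀ t y, coordinate e t (δ y) = y := fun t y =>
    congrFun (e.apply_symm_apply (fun _ => y)) t
  let σ : S →ₗ[K] K ⊗[K] V := TensorProduct.mk K K V 1 ∘ₗ δ.restrictScalars K
  have hσ : ∀ t, IsSection ((coordinate e t).restrictScalars K) σ := fun t y => by
    change LinearMap.baseChange K _ ((1 : K) ⊗ₜ[K] δ y) = _
    rw [LinearMap.baseChange_tmul]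
    exact congrArg (fun s => (1 : K) ⊗ₜ[K] s) (hδ t y)
  have hr : IsSummandOfRank m (Submodule.span K (Set.range σ)) := by
    exact hm ▸ (hσ ⟨0, hl⟩).isSummandOfRank
  refine ⟨⟨⟨_, hr⟩, ?_⟩, fun t => ⟨σ, hσ t, rfl⟩⟩
  refine isInvariant_span ?_
  rintro _ ⟨x, rfl⟩ y
  refine ⟨((1 : K) ⊗ₜ[k] x : K ⊗[k] K) • y, ?_⟩
  change LinearMap.baseChange K _ ((1 : K) ⊗ₜ[K] δ y) = (1 : K) ⊗ₜ[K] δ _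
  rw [LinearMap.baseChange_tmul, map_smul]
  rfl

end RationalPoints

section Generated

variable {F : CommAlgCat.{u} K ⥤ Type u}

theorem _root_.AlgFunctor.IsUniversal.restrictSub_inf {G G' C : Subfunctor F} {A : CommAlgCat.{u} K}
    {c : G.toFunctor.obj A} (hc : IsUniversal (restrictSub G C) c) (h : c.1 ∈ G'.obj A) :
    IsUniversal (F := (G ⊓ G').toFunctor) (restrictSub (G ⊓ G') C) ⟨c.1, c.2, h⟩ := by
  refine ⟨hc.mem, fun {T} s hs => ?_, fun {T} f g hfg => ?_⟩
  · obtain ⟨f, hf⟩ := hc.exists_map_eq (⟨s.1, s.2.1⟩ : G.toFunctor.obj T) hs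
    have h1 : F.map f c.1 = s.1 := congrArg Subtype.val hf
    exact ⟨f, Subtype.ext h1⟩
  · have h1 : F.map f c.1 = F.map g c.1 := congrArg Subtype.val hfg
    exact hc.injective (Subtype.ext h1)

/-- The defining ideal consists of polynomials that vanish at all rational points; over an infinite
field these are zero. -/
theorem _root_.AlgFunctor.IsClosedSub.mem_of_forall_rational [Infinite K] {G : Subfunctor F}
    (hG : IsClosedSub G)
    {σ : Type} (c : F.obj (.of K (MvPolynomial σ K)))
    (h : ∀ f : CommAlgCat.of K (MvPolynomial σ K) ⟶ .of K K, F.map f c ∈ G.obj _) :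
    c ∈ G.obj _ := by
  obtain ⟨I, hI⟩ := hG _ c
  have hbot : I = ⊥ := by
    refine eq_bot_iff.2 fun p hp => MvPolynomial.funext fun x => ?_
    let f : CommAlgCat.of K (MvPolynomial σ K) ⟶ .of K K :=
      CommAlgCat.ofHom (MvPolynomial.aeval x)
    have h1 := (hI _ f).1 (h f)
    have h2 := Ideal.mem_map_of_mem f.hom.toRingHom hp
    rw [h1] at h2
    have h3 : MvPolynomial.aeval x p = 0 := h2
    rw [map_zero, ← MvPolynomial.aeval_eq_eval, h3]
  have h1 := (hI _ (𝟙 _)).2 (by rw [hbot, Ideal.map_bot])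
  rwa [Functor.map_id_apply] at h1

end Generated

section Isotypic

variable {R : Type*} [CommRing R] {V : Type*} [AddCommGroup V] [Module R V] {ι : Type*}
  [DecidableEq ι] {S : ι → Type*} [∀ i, AddCommGroup (S i)] [∀ i, Module R (S i)]
  [∀ i, IsSimpleModule R (S i)] {n : ι → Type*} [∀ i, Finite (n i)]

/-- The `i`-th block is a sum of copies of `S i`. Conversely, by Schur's lemma a submodule
isomorphic to `S i` has zero projection to every `S j` with `j ≠ i`, so it lies in this block. -/
theorem nonempty_isotypicComponent_equiv (hS : ∀ i j, i ≠ j → IsEmpty (S i ≃ₗ[R] S j))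
    (e : V ≃ₗ[R] (∀ i, n i → S i)) (i : ι) :
    Nonempty (isotypicComponent R V (S i) ≃ₗ[R] (n i → S i)) := by
  classical
  let g : (n i → S i) →ₗ[R] V := e.symm.toLinearMap ∘ₗ LinearMap.single R (fun i => n i → S i) i
  have hg : Function.Injective g := e.symm.injective.comp (Pi.single_injective (M :=
      fun i => n i → S i) i)
  have hr : LinearMap.range g = isotypicComponent R V (S i) := by
    refine le_antisymm ?_ (sSup_le ?_)
    · rintro _ ⟨x, rfl⟩
      have := Fintype.ofFinite (n i)
      rw [← LinearMap.sum_single_apply (fun _ : n i => S i) x, map_sum]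
      refine sum_mem fun t _ => ?_
      let gt : S i →ₗ[R] V := g ∘ₗ LinearMap.single R (fun _ : n i => S i) t
      have hgt : Function.Injective gt := hg.comp (Pi.single_injective (M := fun _ : n i => S i) t)
      have hle : LinearMap.range gt ≤ isotypicComponent R V (S i) :=
        le_sSup ⟨(LinearEquiv.ofInjective gt hgt).symm⟩
      exact hle ⟨x t, rfl⟩
    · rintro N ⟨f⟩ v hv
      have h0 : ∀ j, j ≠ i → e v j = 0 := by
        intro j hj
        ext t
        let p : V →ₗ[R] S j := LinearMap.proj t ∘ₗ LinearMap.proj j ∘ₗ e.toLinearMap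
        have hp : p ∘ₗ N.subtype ∘ₗ f.symm.toLinearMap = 0 := by
          refine (LinearMap.bijective_or_eq_zero _).resolve_left fun hb => ?_
          exact (hS i j hj.symm).false (LinearEquiv.ofBijective _ hb)
        have h1 := LinearMap.congr_fun hp (f ⟨v, hv⟩)
        have h2 : p v = 0 := by simpa using h1
        exact h2
      refine ⟨e v i, ?_⟩
      change e.symm (Pi.single i (e v i)) = v
      rw [LinearEquiv.symm_apply_eq]
      ext j t
      by_cases hj : j = i
      · subst hj
        rw [Pi.single_eq_same]
      · rw [Pi.single_eq_of_ne hj, h0 j hj]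
  exact ⟨((LinearEquiv.ofInjective g hg).trans (LinearEquiv.ofEq _ _ hr)).symm⟩

end Isotypic

end TwoSided

/-! ### Products of charts and the main theorem -/

namespace AlgFunctor

open TwoSided

variable {K : Type u} [Field K]

theorem hasSmoothOpenCoveringPoints_piFunctor {ι : Type} [Fintype ι]
    {F : ι → CommAlgCat.{u} K ⥤ Type u}
    (hF : ∀ i, HasAffineCharts (F i)) {J : ι → Type} [∀ i, Nonempty (J i)]
    {C : ∀ i, J i → Subfunctor (F i)} (hC : ∀ i t, IsOpenSub _ (C i t)) {d : ι → ℕ}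
    (hc : ∀ i t, ∃ c : (F i).obj (.of K (MvPolynomial (Fin (d i)) K)), IsUniversal (C i t) c)
    (hpts : ∀ i (s : (F i).obj (.of K K)), ∃ t, s ∈ (C i t).obj (.of K K))
    (hs₀ : ∀ i, ∃ s₀ : (F i).obj (.of K K), ∀ t, s₀ ∈ (C i t).obj (.of K K))
    {Y : Over (Spec (CommRingCat.of K))} (hY : Represents Y (piFunctor F)) :
    HasSmoothOpenCoveringPoints Y (∑ i, d i) := by
  obtain ⟨Φ⟩ := hY
  choose c hc using hc
  choose s₀ hs₀ using hs₀
  -- A chart of the product is a choice of one chart in each factor. Its coordinate ring is the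
  -- polynomial ring in the disjoint union of the variables, so dimensions add up.
  choose D hD using fun t : ∀ i, J i => IsUniversal.piSub_mvPolynomial fun i => hc i (t i)
  have h := hasSmoothOpenCoveringPoints Φ (fun t : ∀ i, J i => piSub fun i => C i (t i)) D hD
    (fun t => (HasAffineCharts.piFunctor hF).isOpenImmersion Φ
      (IsOpenSub.piSub fun i => hC i (t i)) (hD t))
    (fun s => by
      choose t ht using fun i => hpts i (s i)
      exact ⟨t, ht⟩)
    s₀ (fun t i => hs₀ i (t i))
  have hcard : Nat.card (Σ i, Fin (d i)) = ∑ i, d i := by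
    rw [Nat.card_sigma]
    exact Finset.sum_congr rfl fun i _ => Nat.card_fin _
  rwa [hcard] at h

end AlgFunctor

namespace TwoSided

open Module AlgFunctor

variable {k : Type w} {K : Type u} [Field k] [Field K] [Algebra k K]
  {V : Type u} [AddCommGroup V] [Module K V] [Module (K ⊗[k] K) V]
  [IsScalarTower K (K ⊗[k] K) V] {S : Type v} [AddCommGroup S] [Module K S]
  [Module (K ⊗[k] K) S] [IsScalarTower K (K ⊗[k] K) S] [FiniteDimensional K S] {l m d : ℕ}

theorem finrank_eq_of_equiv (e : V ≃ₗ[K ⊗[k] K] (Fin l → S)) (hm : finrank K S =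
    m) : finrank K V = l * m := by
  rw [LinearEquiv.finrank_eq (e.restrictScalars K), finrank_pi_fintype, Finset.sum_const,
      Finset.card_univ,
    Fintype.card_fin, smul_eq_mul, hm]

variable [FiniteDimensional K V] [IsSimpleModule (K ⊗[k] K) S]
  (e : V ≃ₗ[K ⊗[k] K] (Fin l → S))

theorem exists_isUniversal_coordinate (hm : finrank K S = m) (hd : l * m - m = d) (t : Fin l) :
    ∃ c : (invariantFamilies V (rightAction k K V).range m).toFunctor.obj
        (.of K (MvPolynomial (Fin d) K)),
      IsUniversal (restrictSub _ (graphs m ((coordinate e t).restrictScalars K))) c := by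
  refine exists_isUniversal_invariantFamilies (coordinate e t)
    (j := e.symm.toLinearMap ∘ₗ LinearMap.single (K ⊗[k] K) (fun _ : Fin l => S) t)
    (fun b hb v => ?_) (fun s => ?_) hm (by rw [finrank_eq_of_equiv e hm, hd])
  -- What annihilates `S` annihilates `V`, coordinate by coordinate.
  · refine e.injective (funext fun t => ?_)
    rw [map_smul, map_zero]
    exact hb _
  · change e (e.symm (Pi.single t s)) t = s
    rw [e.apply_symm_apply, Pi.single_eq_same]

/-- All rational specializations of the universal family of `F` are generated by invariants. This
condition is closed and `K` is infinite, so the universal family itself satisfies it and is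
universal for `H`. -/
theorem exists_isUniversal_coordinate_inf [Infinite K] (hm : finrank K S = m) (hd : l * m - m = d)
    (t : Fin l) :
    ∃ c : (invariantFamilies V (rightAction k K V).range m ⊓
        generatedFamilies V (rightAction k K V).range m).toFunctor.obj
        (.of K (MvPolynomial (Fin d) K)),
      IsUniversal (restrictSub _ (graphs m ((coordinate e t).restrictScalars K))) c := by
  obtain ⟨c, hc⟩ := exists_isUniversal_coordinate e hm hd t
  refine ⟨_, hc.restrictSub_inf ?_⟩
  refine (isClosedSub_generatedFamilies _ m).mem_of_forall_rational c.1 fun f => ?_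
  exact IsSummandOfRank.isGeneratedByInvariants
    ((grassmannian V m).map f c.1).2
    ((invariantFamilies V (rightAction k K V).range m).map f c.2)

end TwoSided

theorem mainTheorem3 {k : Type w} {K : Type u} [Field k] [Field K] [Algebra k K]
    {V : Type u} [AddCommGroup V] [Module K V] [Module (K ⊗[k] K) V]
    [IsScalarTower K (K ⊗[k] K) V] [FiniteDimensional K V]
    {r : ℕ} {S : Fin r → Type v} [∀ i, AddCommGroup (S i)] [∀ i, Module K (S i)]
    [∀ i, Module (K ⊗[k] K) (S i)] [∀ i, IsScalarTower K (K ⊗[k] K) (S i)]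
    [∀ i, FiniteDimensional K (S i)] [∀ i, IsSimpleModule (K ⊗[k] K) (S i)]
    (hS : ∀ i j, i ≠ j → IsEmpty (S i ≃ₗ[K ⊗[k] K] S j))
    (l m : Fin r → ℕ) (hl : ∀ i, 1 ≤ l i) (hm : ∀ i, Module.finrank K (S i) = m i)
    (hV : Nonempty (V ≃ₗ[K ⊗[k] K] ((i : Fin r) → Fin (l i) → S i))) :
    ((∃ Y, TwoSided.Represents Y (TwoSided.functorF k K V S fun _ => 1)) ∧
      ∀ Y, TwoSided.Represents Y (TwoSided.functorF k K V S fun _ => 1) →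
        TwoSided.HasSmoothOpenCoveringPoints Y (∑ i, (l i * m i - m i))) ∧
    ((∃ Y, TwoSided.Represents Y (TwoSided.functorH k K V S fun _ => 1)) ∧
      (Infinite K → ∀ Y, TwoSided.Represents Y (TwoSided.functorH k K V S fun _ => 1) →
        TwoSided.HasSmoothOpenCoveringPoints Y (∑ i, (l i * m i - m i)))) := by
  have hl' : ∀ i, Nonempty (Fin (l i)) := fun i => ⟨⟨0, hl i⟩⟩
  have e := fun i => (TwoSided.nonempty_isotypicComponent_equiv hS hV.some i).some
  have hm' : ∀ i, Module.finrank K (S i) = 1 * Module.finrank K (S i) := fun i =>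
    (one_mul _).symm
  -- The factor `1` is the multiplicity of `[S i]` in the definition of the functors. The
  -- subtraction of natural numbers does not truncate, since `1 ≤ l i`.
  have hd : ∀ i, l i * (1 * Module.finrank K (S i)) - 1 * Module.finrank K (S i) =
      l i * m i - m i := fun i => by rw [one_mul, hm]
  have hF := fun i => (TwoSided.grassmannian_hasAffineCharts (1 * Module.finrank K (S i))).toFunctor
    (TwoSided.isClosedSub_invariantFamilies
      (V := isotypicComponent (K ⊗[k] K) V (S i)) (TwoSided.rightAction k K _).range _)
  have hH := fun i => (TwoSided.grassmannian_hasAffineCharts (1 * Module.finrank K (S i))).toFunctor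
    ((TwoSided.isClosedSub_invariantFamilies
      (V := isotypicComponent (K ⊗[k] K) V (S i)) (TwoSided.rightAction k K _).range _).inf
    (TwoSided.isClosedSub_generatedFamilies (TwoSided.rightAction k K _).range _))
  have hopen := fun i t => TwoSided.isOpenSub_graphs
    ((TwoSided.coordinate (e i) t).restrictScalars K) (hm' i)
  choose s₀ hs₀ using fun i => TwoSided.exists_forall_mem_graphs (e i) (hl i) (hm' i)
  refine ⟨⟨(AlgFunctor.HasAffineCharts.piFunctor hF).exists_represents, fun Y hY => ?_⟩,
    ⟨(AlgFunctor.HasAffineCharts.piFunctor hH).exists_represents, fun _ Y hY => ?_⟩⟩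
  · exact AlgFunctor.hasSmoothOpenCoveringPoints_piFunctor hF
      (fun i t => (hopen i t).restrictSub _)
      (fun i t => TwoSided.exists_isUniversal_coordinate (e i) (hm' i) (hd i) t)
      (fun i => TwoSided.exists_mem_graphs (e i) (hm' i)) (fun i => ⟨s₀ i, hs₀ i⟩) hY
  · exact AlgFunctor.hasSmoothOpenCoveringPoints_piFunctor hH
      (fun i t => (hopen i t).restrictSub _)
      (fun i t => TwoSided.exists_isUniversal_coordinate_inf (e i) (hm' i) (hd i) t)
      (fun i s => TwoSided.exists_mem_graphs (e i) (hm' i) ⟨s.1, s.2.1⟩)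
      (fun i => ⟨⟨(s₀ i).1, (s₀ i).2,
        (s₀ i).1.2.isGeneratedByInvariants (s₀ i).2⟩, hs₀ i⟩) hY
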